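/- Let $k$ be a field of characteristic $0$, let $Q$ be a finite quiver with vertex set $Q_0$, arrow set $Q_1$ and source and target maps $s,t$ (loops and oriented cycles are allowed; paths are composed from right to left, so that $a=e_{t(a)}\,a\,e_{s(a)}$), and let $W\in kQ/[kQ,kQ]$ be a potential, with cyclic derivatives determined by $\partial (a_n\cdots a_1)/\partial a=\sum_{j:\,a_j=a}a_{j-1}\cdots a_1a_n\cdots a_{j+1}$ for a cycle $a_n\cdots a_1$. Let $R=k^{Q_0}$, spanned by the constant paths $e_i$. Let $\overline Q$ be the double quiver, with arrows $a$ of degree $0$ and reversed arrows $a^*:t(a)\to s(a)$ of degree $-1$ for $a\in Q_1$, and let $\widehat Q$ be $\overline Q$ together with a loop $t_i$ of degree $-2$ at each vertex $i$. Let $\Gamma_{Q,W}$ be the graded path algebra $k\widehat Q$ with the $R$-linear super-derivation $d$ of degree $1$ given by $$d a=0,\qquad d a^*=\partial W/\partial a,\qquad d t_i=e_i\Big(\sum_{a\in Q_1}[a,a^*]\Big)e_i .$$ Notation. For a graded $R$-algebra $A$ (with $R$ in degree $0$) let $\Omega^1_RA=\ker(A\otimes_RA\to A)$, $D(a)=a\otimes1-1\otimes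 a$, $\Omega_R^\bullet A=T_A(\Omega^1_RA)$, and $\mathrm{DR}_R(A)=\Omega_R^\bullet A/[\Omega_R^\bullet A,\Omega_R^\bullet A]$. These are bigraded by form degree and internal degree, and signs follow the Koszul rule for both degrees: exchanging elements of bidegrees $(p,m)$ and $(q,n)$ costs $(-1)^{pq+mn}$. $\mathrm{Der}_R(A)$ and $\mathbb D\mathrm{er}_R(A)$ are the graded spaces of super-derivations $A\to A$ and $A\to A\otimes_kA$ (outer bimodule structure) that vanish on $R$. For $\theta\in\mathrm{Der}_R(A)$, $i_\theta$ is the contraction ($a\mapsto0$, $D(a)\mapsto\theta(a)$) and $L_\theta$ the Lie derivative ($a\mapsto\theta(a)$, $D(a)\mapsto D(\theta(a))$), extended as super-derivations; for $\lambda\in\mathbb D\mathrm{er}_R(A)$, $\iota_\lambda=m\circ\beta\circ i_\lambda$, where $i_\lambda:\Omega^\bullet_RA\to\Omega^\bullet_RA\otimes\Omega^\bullet_RA$ is the double super-derivation with $a\mapsto0$, $D(a)\mapsto\lambda(a)$, $\beta$ is the signed flip and $m$ the multiplication; these maps descend to $\mathrm{DR}_R(A)$. A closed $\omega\in\mathrm{DR}^2_R(A)$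 is bisymplectic if $\lambda\mapsto\iota_\lambda(\omega)$ is an isomorphism $\mathbb D\mathrm{er}_R(A)\to\Omega^1_RA$, and symplectic if $\theta\mapsto i_\theta(\omega)$ is an isomorphism $\mathrm{Der}_R(A)\to\mathrm{DR}^1_R(A)$; in the latter case $\{W,-\}_\omega$ is the $\theta$ with $i_\theta(\omega)=D(W)$. With $\delta(a)=\sum_i(ae_i\otimes e_i-e_i\otimes e_ia)$, an element $\mathbf w\in A$ represents $\mu_{\mathrm{nc}}(\omega)\in(A/R)^R$ if its class in $A/R$ commutes with $R$ and is the unique class with $D(\mathbf w)=\iota_\delta(\omega)$. Claim. Let $A=k\overline Q$, $\omega=\sum_{a\in Q_1}D(a^*)D(a)\in\mathrm{DR}^2_R(A)$ and $\mathbf w=\sum_{a\in Q_1}[a,a^*]$. There is a super-derivation $\xi\in\mathrm{Der}_R(A)$ of degree $1$ such that: 1. $A$ is non-positively graded, finitely generated over $k$, $\Omega^1_RA$ is a projective $A$-bimodule, and it is generated as an $A$-bimodule by homogeneous elements of degrees $0$ and $-1$; 2. $\omega$ is closed, homogeneous of internal degree $-1$, bisymplectic and symplectic; 3. $\xi=\{W,-\}_\omega$,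 and explicitly $\xi(a)=0$ and $\xi(a^*)=\partial W/\partial a$ for all $a\in Q_1$; 4. $\mathbf w$ is homogeneous of degree $-1$ and represents $\mu_{\mathrm{nc}}(\omega)$; 5. $\xi^2=0$, $L_\xi(\omega)=0$ in $\mathrm{DR}_R(A)$, and $\xi(\mathbf w)=0$; 6. $d^2=0$, and $\Gamma_{Q,W}$ is isomorphic, as a dg $R$-algebra, to the free product $A*_RR[t]$ with $t$ in degree $-2$ and with the differential given by $a\mapsto\xi(a)$ for $a\in A$ and $t\mapsto\mathbf w$; the isomorphism identifies the arrows $a$, $a^*$ of the two sides and sends $t$ to $\sum_{i\in Q_0}t_i$. That is, $\Gamma_{Q,W}$ is the relative Ginzburg dg algebra $\mathfrak D(A,\omega,\xi)$. -/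

import Mathlib

open scoped TensorProduct DirectSum

noncomputable section

namespace NCForms

universe u v w

/-! ### Graded algebras over `R = kI` -/

/-- A `ℤ`-graded `R`-algebra, where `R = I → k` is the algebra of `k`-valued functions on `I`:
a `k`-algebra `A` with an algebra homomorphism `R → A` (whose image need not be central) and a
grading for which the image of `R` lies in degree `0`. -/
class GrAlg (k : Type u) (I : Type v) (A : Type w) [Field k] [Ring A] [Algebra k A] where
  str : (I → k) →ₐ[k] A
  deg : ℤ → Submodule k A
  [graded : GradedAlgebra deg]
  str_mem : ∀ r, str r ∈ deg 0

attribute [reducible, instance] GrAlg.graded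

section General

variable (k : Type u) (I : Type v) (A : Type w) [Field k] [Ring A] [Algebra k A] [GrAlg k I A]

/-- The structure map `R → A`. -/
abbrev str : (I → k) →ₐ[k] A := GrAlg.str

/-- The homogeneous components of `A`. -/
abbrev deg : ℤ → Submodule k A := GrAlg.deg I

/-- The algebra automorphism of `A` that is multiplication by `(-1) ^ (n * m)` in degree `m`. -/
def twist (n : ℤ) : A →ₐ[k] A :=
  (DirectSum.toAlgebra k (fun m => deg k I A m)
    (fun m => ((-1 : k) ^ (n * m)) • (deg k I A m).subtype)
    (by simp)
    (by
      intro i j a b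
      simp [mul_add, zpow_add₀, smul_smul, mul_comm])).comp
    (DirectSum.decomposeAlgEquiv (deg k I A)).toAlgHom

variable {k I A}

theorem twist_of_mem (n : ℤ) {m : ℤ} {a : A} (ha : a ∈ deg k I A m) :
    twist k I A n a = ((-1 : k) ^ (n * m)) • a := by
  have h : DirectSum.decompose (deg k I A) a = DirectSum.of (fun m => deg k I A m) m ⟨a, ha⟩ :=
    DirectSum.decompose_of_mem _ ha
  simp only [twist, AlgHom.comp_apply]
  erw [DirectSum.decomposeAlgEquiv_apply, h]
  exact DirectSum.toAddMonoid_of (β := fun m => deg k I A m)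
    (fun m => (((-1 : k) ^ (n * m)) • (deg k I A m).subtype).toAddMonoidHom) m ⟨a, ha⟩

theorem twist_str (n : ℤ) (r : I → k) : twist k I A n (str k I A r) = str k I A r := by
  rw [twist_of_mem n (GrAlg.str_mem r)]; simp

theorem twist_ext {n : ℤ} {f : A →ₐ[k] A}
    (h : ∀ m, ∀ a ∈ deg k I A m, f a = ((-1 : k) ^ (n * m)) • a) : f = twist k I A n := by
  ext a
  induction a using DirectSum.Decomposition.inductionOn (deg k I A) with
  | zero => simp
  | homogeneous a => rw [h _ _ a.2, twist_of_mem n a.2]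
  | add a b ha hb => simp [ha, hb]

theorem twist_even {n : ℤ} (hn : Even n) : twist k I A n = AlgHom.id k A :=
  (twist_ext fun m a _ => by simp [(hn.mul_right m).neg_one_zpow]).symm

theorem twist_odd {n : ℤ} (hn : Odd n) : twist k I A n = twist k I A 1 :=
  (twist_ext fun m a ha => by
    rw [twist_of_mem 1 ha, one_mul, zpow_mul, hn.neg_one_zpow]).symm

theorem twist_one_twist_one (a : A) : twist k I A 1 (twist k I A 1 a) = a := by
  have : (twist k I A 1).comp (twist k I A 1) = twist k I A 0 := twist_ext fun m a ha => by
    rw [AlgHom.comp_apply, twist_of_mem 1 ha, map_smul, twist_of_mem 1 ha, smul_smul,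
      ← zpow_add₀ (by simp), zero_mul, one_mul, Even.neg_one_zpow (⟨m, rfl⟩ : Even (m + m)), zpow_zero]
  rw [twist_even (n := 0) (by simp)] at this
  exact DFunLike.congr_fun this a

variable (k I A)

/-! ### Relative one-forms -/

/-- The enveloping algebra `A ⊗ Aᵒᵖ`; its left modules are the `A`-bimodules.  Acting on itself by
left multiplication it is `A ⊗ A` with the outer bimodule structure. -/
abbrev Env (k : Type u) (A : Type w) [Field k] [Ring A] [Algebra k A] : Type w := A ⊗[k] Aᵐᵒᵖ

/-- The sub-bimodule of `A ⊗ A` generated by the elements `r ⊗ 1 - 1 ⊗ r`, `r ∈ R`. -/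
def relSub : Submodule (Env k A) (Env k A) :=
  Submodule.span _ (Set.range fun r : I → k =>
    (str k I A r) ⊗ₜ[k] (1 : Aᵐᵒᵖ) - (1 : A) ⊗ₜ[k] MulOpposite.op (str k I A r))

/-- The `A`-bimodule `A ⊗_R A`. -/
abbrev TenR : Type w := Env k A ⧸ relSub k I A

/-- `A` as a bimodule over itself. -/
local instance : Module (Env k A) A := instModuleTensorProductMop k A

theorem env_smul (a b x : A) : (a ⊗ₜ[k] MulOpposite.op b : Env k A) • x = a * x * b := by
  change TensorProduct.Algebra.moduleAux _ _ = _
  simp [TensorProduct.Algebra.moduleAux, ← mul_assoc]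

/-- The multiplication `A ⊗_R A → A`, `a ⊗ b ↦ a b`. -/
def mulR : TenR k I A →ₗ[Env k A] A :=
  (relSub k I A).liftQ (LinearMap.toSpanSingleton (Env k A) A 1) (by
    rw [relSub, Submodule.span_le]
    rintro _ ⟨r, rfl⟩
    have h1 := env_smul k A (str k I A r) 1 1
    have h2 := env_smul k A 1 (str k I A r) 1
    simp only [MulOpposite.op_one] at h1
    simp [sub_smul, h1, h2])

/-- The bimodule of relative one-forms `Ω¹_R A = Ker (A ⊗_R A → A)`. -/
def Omega1 : Submodule (Env k A) (TenR k I A) := LinearMap.ker (mulR k I A)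

instance : AddCommGroup (Omega1 k I A) := inferInstance
instance : Module (Env k A) (Omega1 k I A) := inferInstance
instance : Module k (Omega1 k I A) := inferInstance

variable {k A} in
/-- The class of `a ⊗ b` in `A ⊗_R A`. -/
def tmulR (a b : A) : TenR k I A := (relSub k I A).mkQ (a ⊗ₜ[k] MulOpposite.op b)

theorem mulR_tmulR (a b : A) : mulR k I A (tmulR I a b) = a * b := by
  have := env_smul k A a b 1
  simpa [mulR, tmulR] using this

theorem tmulR_add_left (a a' b : A) : tmulR (k := k) I (a + a') b = tmulR I a b + tmulR I a' b := by
  simp [tmulR, TensorProduct.add_tmul]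

theorem smul_tmulR (a b x y : A) :
    (a ⊗ₜ[k] MulOpposite.op b : Env k A) • tmulR (k := k) I x y = tmulR I (a * x) (y * b) := by
  simp only [tmulR, ← map_smul, smul_eq_mul, Algebra.TensorProduct.tmul_mul_tmul,
    MulOpposite.op_mul]

theorem tmulR_str (a b : A) (r : I → k) :
    tmulR (k := k) I (a * str k I A r) b = tmulR I a (str k I A r * b) := by
  rw [← sub_eq_zero]
  have h : ((relSub k I A).mkQ ((a ⊗ₜ[k] MulOpposite.op b : Env k A) •
      ((str k I A r) ⊗ₜ[k] (1 : Aᵐᵒᵖ) - (1 : A) ⊗ₜ[k] MulOpposite.op (str k I A r)))) = 0 := by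
    rw [map_smul]
    have : (relSub k I A).mkQ
      ((str k I A r) ⊗ₜ[k] (1 : Aᵐᵒᵖ) - (1 : A) ⊗ₜ[k] MulOpposite.op (str k I A r)) = 0 :=
      (Submodule.Quotient.mk_eq_zero _).2 (Submodule.subset_span ⟨r, rfl⟩)
    rw [this, smul_zero]
  simpa [tmulR, mul_sub] using h

/-- The universal derivation `D a = a ⊗ 1 - 1 ⊗ a`, with values in `Ω¹_R A`. -/
def dOne : A →ₗ[k] Omega1 k I A where
  toFun a := ⟨tmulR I a 1 - tmulR I 1 a, by
    simp [Omega1, LinearMap.mem_ker, map_sub, mulR_tmulR]⟩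
  map_add' a b := by
    ext
    simp [tmulR, TensorProduct.add_tmul, TensorProduct.tmul_add]
    abel
  map_smul' c a := by
    ext
    have : ∀ x : Env k A, (relSub k I A).mkQ (c • x) = c • (relSub k I A).mkQ x := fun _ => rfl
    simp only [tmulR, MulOpposite.op_smul, TensorProduct.tmul_smul, ← TensorProduct.smul_tmul',
      this, RingHom.id_apply, ← smul_sub]
    rfl

theorem dOne_str (r : I → k) : dOne k I A (str k I A r) = 0 := by
  ext
  have := tmulR_str k I A 1 1 r
  simp only [one_mul, mul_one] at this
  simp [dOne, this]

theorem dOne_mul (a b : A) : dOne k I A (a * b) =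
    ((1 : A) ⊗ₜ[k] MulOpposite.op b : Env k A) • dOne k I A a +
      (a ⊗ₜ[k] (1 : Aᵐᵒᵖ) : Env k A) • dOne k I A b := by
  ext
  have h := smul_tmulR k I A a 1
  simp only [MulOpposite.op_one] at h
  simp [dOne, smul_sub, smul_tmulR, h]

/-- A one-form `∑ a ⊗ b` (with `∑ a b = 0`) equals `∑ (D a) b`. -/
theorem omega1_induction {p : Omega1 k I A → Prop}
    (add : ∀ x y, p x → p y → p (x + y)) (zero : p 0)
    (mem : ∀ a b, p (((1 : A) ⊗ₜ[k] MulOpposite.op b : Env k A) • dOne k I A a)) (x) : p x := by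
  obtain ⟨x, hx⟩ := x
  obtain ⟨t, rfl⟩ := (relSub k I A).mkQ_surjective x
  have key : ∀ t : Env k A, ∃ (y : Omega1 k I A) (c : A), p y ∧
      (relSub k I A).mkQ t = (y : TenR k I A) + tmulR I 1 c := by
    intro t
    induction t using TensorProduct.induction_on with
    | zero => exact ⟨0, 0, zero, by simp [tmulR]⟩
    | tmul a b =>
      refine ⟨_, a * b.unop, mem a b.unop, ?_⟩
      simp only [dOne, LinearMap.coe_mk, AddHom.coe_mk, SetLike.val_smul, smul_sub, smul_tmulR]
      simp [tmulR]
    | add t t' h h' =>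
      obtain ⟨y, c, hy, h⟩ := h
      obtain ⟨y', c', hy', h'⟩ := h'
      refine ⟨y + y', c + c', add _ _ hy hy', ?_⟩
      rw [map_add, h, h']
      simp [tmulR, TensorProduct.tmul_add]
      abel
  obtain ⟨y, c, hy, h⟩ := key t
  have hc : c = 0 := by
    have h1 : mulR k I A ((relSub k I A).mkQ t) = 0 := hx
    have h2 : mulR k I A (y : TenR k I A) = 0 := y.2
    rw [h, map_add, h2, mulR_tmulR] at h1
    simpa using h1
  subst hc
  convert hy
  rw [h]
  simp [tmulR]

/-! ### The tensor algebra of a bimodule -/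

section TensorAlg

variable (M : Type w) [AddCommGroup M] [Module k M] [Module (Env k A) M]

/-- The relations that define `T_A(M)` as a quotient of the tensor algebra of the `k`-module
`A ⊕ M`. -/
inductive BimodTA.Rel : TensorAlgebra k (A × M) → TensorAlgebra k (A × M) → Prop
  | one : Rel (TensorAlgebra.ι k (1, 0)) 1
  | mul (a b : A) : Rel (TensorAlgebra.ι k (a * b, 0))
      (TensorAlgebra.ι k (a, 0) * TensorAlgebra.ι k (b, 0))
  | bimod (a b : A) (m : M) : Rel (TensorAlgebra.ι k (0, (a ⊗ₜ[k] MulOpposite.op b : Env k A) • m))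
      (TensorAlgebra.ι k (a, 0) * TensorAlgebra.ι k (0, m) * TensorAlgebra.ι k (b, 0))

/-- The tensor algebra `T_A(M)` of an `A`-bimodule `M`: the universal algebra that receives an
algebra homomorphism from `A` and a bimodule homomorphism from `M`. -/
def BimodTA : Type (max u w) := RingQuot (BimodTA.Rel k A M)

instance : Ring (BimodTA k A M) := inferInstanceAs (Ring (RingQuot _))
instance : Algebra k (BimodTA k A M) := inferInstanceAs (Algebra k (RingQuot _))

namespace BimodTA

/-- The projection from the tensor algebra of `A ⊕ M`. -/
def proj : TensorAlgebra k (A × M) →ₐ[k] BimodTA k A M := RingQuot.mkAlgHom k (Rel k A M)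

theorem proj_rel {x y : TensorAlgebra k (A × M)} (h : Rel k A M x y) :
    proj k A M x = proj k A M y := RingQuot.mkAlgHom_rel k h

/-- The inclusion `A = T_A⁰(M) → T_A(M)`. -/
def inA : A →ₐ[k] BimodTA k A M :=
  AlgHom.ofLinearMap
    ((proj k A M).toLinearMap ∘ₗ TensorAlgebra.ι k ∘ₗ LinearMap.inl k A M)
    (by simpa using proj_rel k A M Rel.one)
    (fun a b => by simpa using proj_rel k A M (Rel.mul a b))

/-- The inclusion `M = T_A¹(M) → T_A(M)`. -/
def inM : M →ₗ[k] BimodTA k A M :=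
  (proj k A M).toLinearMap ∘ₗ TensorAlgebra.ι k ∘ₗ LinearMap.inr k A M

theorem inM_smul (a b : A) (m : M) : inM k A M ((a ⊗ₜ[k] MulOpposite.op b : Env k A) • m) =
    inA k A M a * inM k A M m * inA k A M b := by
  simpa [inM, inA] using proj_rel k A M (Rel.bimod a b m)

variable {k A M} in
/-- The universal property of `T_A(M)`. -/
def lift {B : Type*} [Ring B] [Algebra k B] (f : A →ₐ[k] B) (g : M →ₗ[k] B)
    (h : ∀ a b m, g ((a ⊗ₜ[k] MulOpposite.op b : Env k A) • m) = f a * g m * f b) :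
    BimodTA k A M →ₐ[k] B :=
  RingQuot.liftAlgHom k ⟨TensorAlgebra.lift k (f.toLinearMap.coprod g), by
    rintro _ _ (_ | ⟨a, b⟩ | ⟨a, b, m⟩)
    · simp
    · simp
    · simp [h]⟩

variable {k A M} in
theorem lift_inA {B : Type*} [Ring B] [Algebra k B] (f : A →ₐ[k] B) (g : M →ₗ[k] B)
    (h : ∀ a b m, g ((a ⊗ₜ[k] MulOpposite.op b : Env k A) • m) = f a * g m * f b) (a : A) :
    lift f g h (inA k A M a) = f a := by
  simp only [lift, inA, proj, AlgHom.ofLinearMap_apply, LinearMap.comp_apply]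
  erw [RingQuot.liftAlgHom_mkAlgHom_apply]
  simp

variable {k A M} in
theorem lift_inM {B : Type*} [Ring B] [Algebra k B] (f : A →ₐ[k] B) (g : M →ₗ[k] B)
    (h : ∀ a b m, g ((a ⊗ₜ[k] MulOpposite.op b : Env k A) • m) = f a * g m * f b) (m : M) :
    lift f g h (inM k A M m) = g m := by
  simp only [lift, inM, proj, LinearMap.comp_apply]
  erw [RingQuot.liftAlgHom_mkAlgHom_apply]
  simp

variable {k A M} in
theorem hom_ext {B : Type*} [Ring B] [Algebra k B] {f g : BimodTA k A M →ₐ[k] B}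
    (hA : ∀ a, f (inA k A M a) = g (inA k A M a))
    (hM : ∀ m, f (inM k A M m) = g (inM k A M m)) : f = g := by
  refine RingQuot.ringQuot_ext' k f g (TensorAlgebra.hom_ext (LinearMap.prod_ext ?_ ?_))
  · exact LinearMap.ext fun a => hA a
  · exact LinearMap.ext fun a => hM a

end BimodTA

end TensorAlg


/-! ### Noncommutative differential forms -/

/-- The algebra of relative noncommutative differential forms `Ω_R A = T_A(Ω¹_R A)`. -/
def Omega : Type (max u w) := BimodTA k A (Omega1 k I A)

instance : Ring (Omega k I A) := inferInstanceAs (Ring (BimodTA k A (Omega1 k I A)))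
instance : Algebra k (Omega k I A) := inferInstanceAs (Algebra k (BimodTA k A (Omega1 k I A)))

namespace Omega

/-- The inclusion of `A = Ω⁰_R A`. -/
def inA : A →ₐ[k] Omega k I A := BimodTA.inA k A _

/-- The inclusion of `Ω¹_R A`. -/
def inOne : Omega1 k I A →ₗ[k] Omega k I A := BimodTA.inM k A _

/-- `a ↦ D a`, as a map from `A` to `Ω_R A`. -/
def dA : A →ₗ[k] Omega k I A := inOne k I A ∘ₗ dOne k I A

theorem dA_str (r : I → k) : dA k I A (str k I A r) = 0 := by
  simp [dA, dOne_str]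

theorem dA_mul (a b : A) :
    dA k I A (a * b) = dA k I A a * inA k I A b + inA k I A a * dA k I A b := by
  have h1 := BimodTA.inM_smul k A (Omega1 k I A) 1 b (dOne k I A a)
  have h2 := BimodTA.inM_smul k A (Omega1 k I A) a 1 (dOne k I A b)
  simp only [MulOpposite.op_one, map_one, one_mul, mul_one] at h1 h2
  change BimodTA.inM k A _ (dOne k I A (a * b)) = _
  rw [dOne_mul, map_add, h1, h2]
  rfl

theorem inOne_smul_dOne (a b : A) :
    inOne k I A (((1 : A) ⊗ₜ[k] MulOpposite.op b : Env k A) • dOne k I A a) =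
      dA k I A a * inA k I A b := by
  have h1 := BimodTA.inM_smul k A (Omega1 k I A) 1 b (dOne k I A a)
  rwa [map_one, one_mul] at h1

section Lift

variable {k I A} {C : Type*} [Ring C] [Algebra k C] (F : A →ₐ[k] C) (G : A →ₗ[k] C)
  (hG : ∀ a b, G (a * b) = G a * F b + F a * G b) (hR : ∀ r, G (str k I A r) = 0)

/-- The linear map `A ⊗ A → C`, `a ⊗ b ↦ G a * F b`. -/
def liftAux : Env k A →ₗ[k] C :=
  TensorProduct.lift ((LinearMap.mul k C).compl₁₂ G
    (F.toLinearMap ∘ₗ (MulOpposite.opLinearEquiv k).symm.toLinearMap))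

theorem liftAux_tmul (a b : A) :
    liftAux F G (a ⊗ₜ[k] MulOpposite.op b) = G a * F b := by
  simp [liftAux]

theorem liftAux_relSub (hG : ∀ a b, G (a * b) = G a * F b + F a * G b)
    (hR : ∀ r, G (str k I A r) = 0) (x : Env k A) (hx : x ∈ relSub k I A) : liftAux F G x = 0 := by
  suffices h : ∀ t : Env k A, liftAux F G (t • x) = 0 by simpa using h 1
  refine Submodule.span_induction ?_ ?_ ?_ ?_ hx
  · rintro _ ⟨r, rfl⟩ t
    induction t using TensorProduct.induction_on with
    | zero => simp
    | tmul a b =>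
      induction b using MulOpposite.rec' with
      | _ b =>
      have h1 := liftAux_tmul F G (a * str k I A r) b
      have h2 := liftAux_tmul F G a (str k I A r * b)
      rw [MulOpposite.op_mul] at h2
      simp only [smul_eq_mul, mul_sub, Algebra.TensorProduct.tmul_mul_tmul, mul_one, map_sub,
        h1, h2, hG, hR, map_mul]
      simp [mul_assoc]
    | add t t' h h' => simp only [add_smul, map_add, h, h', add_zero]
  · simp
  · intro x y _ _ hx hy t
    simp only [smul_add, map_add, hx, hy, add_zero]
  · intro a x _ hx t
    rw [smul_smul]
    exact hx _

/-- The linear map `Ω¹_R A → C` with `(D a) b ↦ G a * F b`. -/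
def liftOne : Omega1 k I A →ₗ[k] C :=
  (((relSub k I A).restrictScalars k).liftQ (liftAux F G) (liftAux_relSub F G hG hR)) ∘ₗ
    (Submodule.Quotient.restrictScalarsEquiv k (relSub k I A)).symm.toLinearMap ∘ₗ
    ((Omega1 k I A).subtype.restrictScalars k)

theorem liftOne_of (x : Omega1 k I A) (t : Env k A) (h : (x : TenR k I A) = (relSub k I A).mkQ t) :
    liftOne F G hG hR x = liftAux F G t := by
  simp only [liftOne, LinearMap.comp_apply, LinearMap.restrictScalars_apply, Submodule.subtype_apply,
    h]
  rfl

theorem liftOne_smul (a b x : A) :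
    liftOne F G hG hR ((a ⊗ₜ[k] MulOpposite.op b : Env k A) • dOne k I A x) = F a * G x * F b := by
  rw [liftOne_of F G hG hR _ ((a * x) ⊗ₜ MulOpposite.op b - a ⊗ₜ MulOpposite.op (x * b))]
  · rw [map_sub, liftAux_tmul, liftAux_tmul, hG, map_mul]
    noncomm_ring
  · simp only [dOne, LinearMap.coe_mk, AddHom.coe_mk, SetLike.val_smul, smul_sub, smul_tmulR]
    simp [tmulR]

/-- The universal property of `Ω_R A`: an algebra homomorphism `F` from `A` and an `R`-linear
derivation `G` along `F` extend to an algebra homomorphism with `D a ↦ G a`. -/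
def lift : Omega k I A →ₐ[k] C :=
  BimodTA.lift F (liftOne F G hG hR) (by
    intro a b m
    induction m using omega1_induction with
    | add x y hx hy => simp only [smul_add, map_add, hx, hy, mul_add, add_mul]
    | zero => simp
    | mem x y =>
      have e := (mul_smul (a ⊗ₜ[k] MulOpposite.op b : Env k A)
        ((1 : A) ⊗ₜ[k] MulOpposite.op y : Env k A) (dOne k I A x)).symm
      refine (congrArg (liftOne F G hG hR) e).trans ?_
      rw [Algebra.TensorProduct.tmul_mul_tmul, ← MulOpposite.op_mul, liftOne_smul, liftOne_smul]
      simp [mul_assoc])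

@[simp]
theorem lift_inA (a : A) : lift F G hG hR (inA k I A a) = F a := BimodTA.lift_inA _ _ _ _

@[simp]
theorem lift_dA (a : A) : lift F G hG hR (dA k I A a) = G a := by
  have h := liftOne_smul F G hG hR 1 1 a
  rw [MulOpposite.op_one, ← Algebra.TensorProduct.one_def, one_smul] at h
  refine (BimodTA.lift_inM _ _ _ _).trans (h.trans ?_)
  simp

theorem hom_ext {f g : Omega k I A →ₐ[k] C} (h0 : ∀ a, f (inA k I A a) = g (inA k I A a))
    (h1 : ∀ a, f (dA k I A a) = g (dA k I A a)) : f = g := by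
  refine BimodTA.hom_ext h0 fun m => ?_
  change f (inOne k I A m) = g (inOne k I A m)
  induction m using omega1_induction with
  | add x y hx hy => simp only [map_add, hx, hy]
  | zero => simp
  | mem a b =>
    rw [inOne_smul_dOne, map_mul, map_mul, h0, h1]

end Lift

variable {k I A} in
theorem induction {p : Omega k I A → Prop} (h0 : ∀ a, p (inA k I A a)) (h1 : ∀ a, p (dA k I A a))
    (add : ∀ x y, p x → p y → p (x + y)) (mul : ∀ x y, p x → p y → p (x * y)) (x) : p x := by
  let S : Subalgebra k (Omega k I A) :=
    { carrier := {x | p x}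
      add_mem' := fun hx hy => add _ _ hx hy
      mul_mem' := fun hx hy => mul _ _ hx hy
      algebraMap_mem' := fun r => by
        have := h0 (algebraMap k A r)
        rwa [AlgHom.commutes] at this }
  let F : A →ₐ[k] S := (inA k I A).codRestrict S h0
  let G : A →ₗ[k] S := (dA k I A).codRestrict (Subalgebra.toSubmodule S) h1
  let L : Omega k I A →ₐ[k] S := lift F G
    (fun a b => Subtype.ext (dA_mul k I A a b)) (fun r => Subtype.ext (dA_str k I A r))
  have : S.val.comp L = AlgHom.id k _ := by
    refine hom_ext (fun a => ?_) (fun a => ?_)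
    · simp [L, F]
    · simp [L]; rfl
  have hx := DFunLike.congr_fun this x
  simp only [AlgHom.comp_apply, AlgHom.id_apply] at hx
  rw [← hx]
  exact (L x).2

/-! ### Derivations of the algebra of forms -/

section Der

variable {k I A} {B : Type*} [Ring B] [Algebra k B] (f g : Omega k I A →ₐ[k] B)
  (d0 d1 : A →ₗ[k] B)

/-- `a ↦ !![p a, q a; 0, r a]`. -/
def triLin {X : Type*} [AddCommGroup X] [Module k X] (p q r : X →ₗ[k] B) :
    X →ₗ[k] Matrix (Fin 2) (Fin 2) B where
  toFun x := !![p x, q x; 0, r x]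
  map_add' x y := by
    ext i j
    fin_cases i <;> fin_cases j <;> simp
  map_smul' c x := by
    ext i j
    fin_cases i <;> fin_cases j <;> simp

/-- `a ↦ !![p a, q a; 0, r a]` as an algebra homomorphism, for a derivation `q` along `p`, `r`. -/
def triAlg {X : Type*} [Ring X] [Algebra k X] (p r : X →ₐ[k] B) (q : X →ₗ[k] B)
    (hq : ∀ a b, q (a * b) = q a * r b + p a * q b) : X →ₐ[k] Matrix (Fin 2) (Fin 2) B :=
  AlgHom.ofLinearMap (triLin p.toLinearMap q r.toLinearMap)
    (by
      have h1 : q 1 = 0 := by simpa using hq 1 1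
      ext i j
      fin_cases i <;> fin_cases j <;> simp [triLin, h1])
    (by
      intro a b
      ext i j
      fin_cases i <;> fin_cases j <;> simp [triLin, hq, Matrix.mul_apply, Fin.sum_univ_two, add_comm])

variable (h0 : ∀ a b, d0 (a * b) = d0 a * g (inA k I A b) + f (inA k I A a) * d0 b)
  (h1 : ∀ a b, d1 (a * b) = d1 a * g (inA k I A b) + f (dA k I A a) * d0 b +
    d0 a * g (dA k I A b) + f (inA k I A a) * d1 b)
  (hR : ∀ r, d1 (str k I A r) = 0)

/-- The matrix homomorphism `x ↦ !![f x, d x; 0, g x]` that defines the derivation below. -/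
def derMat : Omega k I A →ₐ[k] Matrix (Fin 2) (Fin 2) B :=
  lift (triAlg (f.comp (inA k I A)) (g.comp (inA k I A)) d0 h0)
    (triLin (f.toLinearMap ∘ₗ dA k I A) d1 (g.toLinearMap ∘ₗ dA k I A))
    (by
      intro a b
      ext i j
      fin_cases i <;> fin_cases j <;>
        simp [triLin, triAlg, h1, dA_mul]
      abel)
    (by
      intro r
      ext i j
      fin_cases i <;> fin_cases j <;> simp [triLin, hR, dA_str])

/-- The unique linear map `d : Ω_R A → B` with `d (x y) = d x * g y + f x * d y` that is given by
`d0` on `A` and sends `D a` to `d1 a`. -/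
def der : Omega k I A →ₗ[k] B :=
  (Matrix.entryLinearMap k B (0 : Fin 2) (1 : Fin 2)) ∘ₗ (derMat f g d0 d1 h0 h1 hR).toLinearMap

theorem derMat_apply (x : Omega k I A) :
    derMat f g d0 d1 h0 h1 hR x = !![f x, der f g d0 d1 h0 h1 hR x; 0, g x] := by
  have key : ∀ x, derMat f g d0 d1 h0 h1 hR x 0 0 = f x ∧ derMat f g d0 d1 h0 h1 hR x 1 0 = 0 ∧
      derMat f g d0 d1 h0 h1 hR x 1 1 = g x := by
    intro x
    induction x using Omega.induction with
    | h0 a => simp [derMat, triAlg, triLin]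
    | h1 a => simp [derMat, triLin]
    | add x y hx hy => simp [hx, hy]
    | mul x y hx hy => simp [hx, hy, Matrix.mul_apply, Fin.sum_univ_two]
  obtain ⟨k1, k2, k3⟩ := key x
  ext i j
  fin_cases i <;> fin_cases j <;> simp [k1, k2, k3, der]

@[simp]
theorem der_inA (a : A) : der f g d0 d1 h0 h1 hR (inA k I A a) = d0 a := by
  simp [der, derMat, triAlg, triLin]

@[simp]
theorem der_dA (a : A) : der f g d0 d1 h0 h1 hR (dA k I A a) = d1 a := by
  simp [der, derMat, triLin]

theorem der_mul (x y : Omega k I A) : der f g d0 d1 h0 h1 hR (x * y) =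
    der f g d0 d1 h0 h1 hR x * g y + f x * der f g d0 d1 h0 h1 hR y := by
  have h := map_mul (derMat f g d0 d1 h0 h1 hR) x y
  have h' := congrFun (congrFun h 0) 1
  simp only [derMat_apply] at h'
  simpa [Matrix.mul_apply, Fin.sum_univ_two, add_comm] using h'

theorem der_unique {f g : Omega k I A →ₐ[k] B} {d d' : Omega k I A →ₗ[k] B}
    (hd : ∀ x y, d (x * y) = d x * g y + f x * d y)
    (hd' : ∀ x y, d' (x * y) = d' x * g y + f x * d' y)
    (e0 : ∀ a, d (inA k I A a) = d' (inA k I A a))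
    (e1 : ∀ a, d (dA k I A a) = d' (dA k I A a)) : d = d' := by
  ext x
  induction x using Omega.induction with
  | h0 a => exact e0 a
  | h1 a => exact e1 a
  | add x y hx hy => simp [hx, hy]
  | mul x y hx hy => rw [hd, hd', hx, hy]

end Der

end Omega

theorem sign_congr {a b : ℤ} (h : Even (a - b)) : (-1 : k) ^ a = (-1 : k) ^ b := by
  have : a = (a - b) + b := by ring
  rw [this, zpow_add₀ (by simp), h.neg_one_zpow, one_mul]

theorem sign_mul (a b : ℤ) : (-1 : k) ^ a * (-1 : k) ^ b = (-1 : k) ^ (a + b) := by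
  rw [zpow_add₀ (by simp)]

/-! ### Super-derivations and double derivations -/

/-- The degree `n` part of `Der_R(A)`: the super-derivations of degree `n` of `A` over `R`. -/
def sder (n : ℤ) : Submodule k (A →ₗ[k] A) where
  carrier := {θ | (∀ r, θ (str k I A r) = 0) ∧ (∀ m, ∀ a ∈ deg k I A m, θ a ∈ deg k I A (m + n)) ∧
    ∀ m, ∀ a ∈ deg k I A m, ∀ b, θ (a * b) = θ a * b + ((-1 : k) ^ (n * m)) • (a * θ b)}
  add_mem' := by
    rintro θ η ⟨h1, h2, h3⟩ ⟨g1, g2, g3⟩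
    refine ⟨fun r => by simp [h1, g1], fun m a ha => add_mem (h2 m a ha) (g2 m a ha),
      fun m a ha b => ?_⟩
    simp only [LinearMap.add_apply, h3 m a ha, g3 m a ha, add_mul, mul_add, smul_add]
    abel
  zero_mem' := by simp
  smul_mem' := by
    rintro c θ ⟨h1, h2, h3⟩
    refine ⟨fun r => by simp [h1], fun m a ha => Submodule.smul_mem _ _ (h2 m a ha),
      fun m a ha b => ?_⟩
    simp only [LinearMap.smul_apply, h3 m a ha, smul_add, smul_mul_assoc, mul_smul_comm,
      smul_comm c]

/-- The homogeneous components of `A ⊗ A`. -/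
def degTen (n : ℤ) : Submodule k (A ⊗[k] A) :=
  Submodule.span k {t | ∃ i j, i + j = n ∧ ∃ x ∈ deg k I A i, ∃ y ∈ deg k I A j, t = x ⊗ₜ[k] y}

/-- The degree `n` part of the relative double derivations `𝔻er_R(A)`: the super-derivations
`A → A ⊗ A` of degree `n` over `R`, for the outer bimodule structure
`a (x ⊗ y) b = a x ⊗ y b`. -/
def dder (n : ℤ) : Submodule k (A →ₗ[k] A ⊗[k] A) where
  carrier := {μ | (∀ r, μ (str k I A r) = 0) ∧
    (∀ m, ∀ a ∈ deg k I A m, μ a ∈ degTen k I A (m + n)) ∧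
    ∀ m, ∀ a ∈ deg k I A m, ∀ b, μ (a * b) =
      μ a * ((1 : A) ⊗ₜ[k] b) + ((-1 : k) ^ (n * m)) • ((a ⊗ₜ[k] (1 : A)) * μ b)}
  add_mem' := by
    rintro θ η ⟨h1, h2, h3⟩ ⟨g1, g2, g3⟩
    refine ⟨fun r => by simp [h1, g1], fun m a ha => add_mem (h2 m a ha) (g2 m a ha),
      fun m a ha b => ?_⟩
    simp only [LinearMap.add_apply, h3 m a ha, g3 m a ha, add_mul, mul_add, smul_add]
    abel
  zero_mem' := by simp
  smul_mem' := by
    rintro c θ ⟨h1, h2, h3⟩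
    refine ⟨fun r => by simp [h1], fun m a ha => Submodule.smul_mem _ _ (h2 m a ha),
      fun m a ha b => ?_⟩
    simp only [LinearMap.smul_apply, h3 m a ha, smul_add, smul_mul_assoc, mul_smul_comm,
      smul_comm c]

/-- `Der_R(A)`, the graded vector space of super-derivations. -/
abbrev SDer : Type _ := ⨁ n : ℤ, sder k I A n

/-- `𝔻er_R(A)`, the graded vector space of relative double derivations. -/
abbrev DDer : Type _ := ⨁ n : ℤ, dder k I A n

variable {k I A}

theorem sder_mul {n : ℤ} {θ : A →ₗ[k] A} (h : θ ∈ sder k I A n) (a b : A) :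
    θ (a * b) = θ a * b + twist k I A n a * θ b := by
  induction a using DirectSum.Decomposition.inductionOn (deg k I A) with
  | zero => simp
  | homogeneous a => rw [h.2.2 _ _ a.2, twist_of_mem n a.2, smul_mul_assoc]
  | add a a' ha hb => simp only [add_mul, map_add, ha, hb]; abel

theorem sder_twist {n : ℤ} {θ : A →ₗ[k] A} (h : θ ∈ sder k I A n) (a : A) :
    θ (twist k I A 1 a) = ((-1 : k) ^ n) • twist k I A 1 (θ a) := by
  induction a using DirectSum.Decomposition.inductionOn (deg k I A) with
  | zero => simp
  | @homogeneous m a =>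
    rw [twist_of_mem 1 a.2, twist_of_mem 1 (h.2.1 _ _ a.2), map_smul, smul_smul, sign_mul]
    congr 1
    exact sign_congr k ⟨-n, by ring⟩
  | add a a' ha hb => simp only [map_add, ha, hb, smul_add]

theorem dder_mul {n : ℤ} {μ : A →ₗ[k] A ⊗[k] A} (h : μ ∈ dder k I A n) (a b : A) :
    μ (a * b) = μ a * ((1 : A) ⊗ₜ[k] b) + (twist k I A n a ⊗ₜ[k] (1 : A)) * μ b := by
  induction a using DirectSum.Decomposition.inductionOn (deg k I A) with
  | zero => simp
  | homogeneous a =>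
    rw [h.2.2 _ _ a.2, twist_of_mem n a.2, ← TensorProduct.smul_tmul', smul_mul_assoc]
  | add a a' ha hb => simp only [add_mul, map_add, ha, hb, TensorProduct.add_tmul]; abel

theorem degTen_twist {n : ℤ} {t : A ⊗[k] A} (ht : t ∈ degTen k I A n) :
    Algebra.TensorProduct.map (twist k I A 1) (twist k I A 1) t = ((-1 : k) ^ n) • t := by
  refine Submodule.span_induction ?_ ?_ ?_ ?_ ht
  · rintro _ ⟨i, j, rfl, x, hx, y, hy, rfl⟩
    rw [Algebra.TensorProduct.map_tmul, twist_of_mem 1 hx, twist_of_mem 1 hy,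
      TensorProduct.smul_tmul_smul, sign_mul]
    simp
  · simp
  · intro x y _ _ hx hy
    simp [hx, hy]
  · intro c x _ hx
    rw [map_smul, hx, smul_comm]

theorem dder_twist {n : ℤ} {μ : A →ₗ[k] A ⊗[k] A} (h : μ ∈ dder k I A n) (a : A) :
    μ (twist k I A 1 a) =
      ((-1 : k) ^ n) • Algebra.TensorProduct.map (twist k I A 1) (twist k I A 1) (μ a) := by
  induction a using DirectSum.Decomposition.inductionOn (deg k I A) with
  | zero => simp
  | @homogeneous m a =>
    rw [twist_of_mem 1 a.2, degTen_twist (h.2.1 _ _ a.2), map_smul, smul_smul, sign_mul]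
    congr 1
    exact sign_congr k ⟨-n, by ring⟩
  | add a a' ha hb => simp only [map_add, ha, hb, smul_add]

variable (k I A)

namespace Omega

/-! ### Parities of forms -/

/-- The automorphism of `Ω_R A` that is multiplication by `(-1) ^ p` on `p`-forms. -/
def par : Omega k I A →ₐ[k] Omega k I A :=
  lift (inA k I A) (-dA k I A) (fun a b => by simp [dA_mul]; abel) (fun r => by simp [dA_str])

/-- The automorphism of `Ω_R A` induced by `twist n` on `A`, so multiplication by
`(-1) ^ (n * m)` on forms of internal degree `m`. -/
def sgn (n : ℤ) : Omega k I A →ₐ[k] Omega k I A :=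
  lift ((inA k I A).comp (twist k I A n)) (dA k I A ∘ₗ (twist k I A n).toLinearMap)
    (fun a b => by simp [dA_mul]) (fun r => by simp [twist_str, dA_str])

@[simp] theorem par_inA (a : A) : par k I A (inA k I A a) = inA k I A a := by simp [par]
@[simp] theorem par_dA (a : A) : par k I A (dA k I A a) = -dA k I A a := by simp [par]
@[simp] theorem sgn_inA (n : ℤ) (a : A) :
    sgn k I A n (inA k I A a) = inA k I A (twist k I A n a) := lift_inA _ _ _ _ a
@[simp] theorem sgn_dA (n : ℤ) (a : A) :
    sgn k I A n (dA k I A a) = dA k I A (twist k I A n a) := lift_dA _ _ _ _ a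

@[simp] theorem par_par (x : Omega k I A) : par k I A (par k I A x) = x := by
  have : (par k I A).comp (par k I A) = AlgHom.id k _ := hom_ext (by simp) (by simp)
  exact DFunLike.congr_fun this x

@[simp] theorem sgn_sgn (x : Omega k I A) : sgn k I A 1 (sgn k I A 1 x) = x := by
  have : (sgn k I A 1).comp (sgn k I A 1) = AlgHom.id k _ :=
    hom_ext (by simp [twist_one_twist_one]) (by simp [twist_one_twist_one])
  exact DFunLike.congr_fun this x

theorem sgn_par (n : ℤ) (x : Omega k I A) :
    sgn k I A n (par k I A x) = par k I A (sgn k I A n x) := by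
  have : (sgn k I A n).comp (par k I A) = (par k I A).comp (sgn k I A n) :=
    hom_ext (by simp) (by simp)
  exact DFunLike.congr_fun this x

theorem sgn_even {n : ℤ} (hn : Even n) (x : Omega k I A) : sgn k I A n x = x := by
  have : sgn k I A n = AlgHom.id k _ := hom_ext (by simp [twist_even hn]) (by simp [twist_even hn])
  exact DFunLike.congr_fun this x

theorem sgn_odd {n : ℤ} (hn : Odd n) (x : Omega k I A) : sgn k I A n x = sgn k I A 1 x := by
  have : sgn k I A n = sgn k I A 1 := hom_ext (by simp [twist_odd hn]) (by simp [twist_odd hn])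
  exact DFunLike.congr_fun this x

variable {k I A} in
/-- `Par p m x`: every bihomogeneous component of the form `x` has form degree congruent to `p`
and internal degree congruent to `m` modulo `2`. -/
def Par (p m : ℤ) (x : Omega k I A) : Prop :=
  par k I A x = ((-1 : k) ^ p) • x ∧ sgn k I A 1 x = ((-1 : k) ^ m) • x

variable {k I A}

theorem Par.add {p m : ℤ} {x y : Omega k I A} (hx : Par p m x) (hy : Par p m y) :
    Par p m (x + y) := ⟨by simp [hx.1, hy.1], by simp [hx.2, hy.2]⟩

theorem Par.mul {p m q n : ℤ} {x y : Omega k I A} (hx : Par p m x) (hy : Par q n y) :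
    Par (p + q) (m + n) (x * y) :=
  ⟨by simp [hx.1, hy.1, smul_smul, sign_mul, add_comm],
    by simp [hx.2, hy.2, smul_smul, sign_mul, add_comm]⟩

theorem Par.sgn {p m : ℤ} {x : Omega k I A} (hx : Par p m x) (n : ℤ) :
    sgn k I A n x = ((-1 : k) ^ (n * m)) • x := by
  rcases Int.even_or_odd n with hn | hn
  · rw [sgn_even k I A hn, (hn.mul_right m).neg_one_zpow, one_smul]
  · rw [sgn_odd k I A hn, hx.2, zpow_mul, hn.neg_one_zpow]

theorem par_inA_of_mem {m : ℤ} {a : A} (ha : a ∈ deg k I A m) : Par 0 m (inA k I A a) :=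
  ⟨by simp, by simp [twist_of_mem 1 ha]⟩

theorem par_dA_of_mem {m : ℤ} {a : A} (ha : a ∈ deg k I A m) : Par 1 m (dA k I A a) :=
  ⟨by simp, by simp [twist_of_mem 1 ha]⟩

theorem par_decomp [CharZero k] {C : Omega k I A → Prop} (add : ∀ x y, C x → C y → C (x + y))
    (h : ∀ p m x, Par p m x → C x) (x : Omega k I A) : C x := by
  have e : x = (4⁻¹ : k) • (x + par k I A x + sgn k I A 1 x + par k I A (sgn k I A 1 x)) +
      (4⁻¹ : k) • (x + par k I A x - sgn k I A 1 x - par k I A (sgn k I A 1 x)) +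
      (4⁻¹ : k) • (x - par k I A x + sgn k I A 1 x - par k I A (sgn k I A 1 x)) +
      (4⁻¹ : k) • (x - par k I A x - sgn k I A 1 x + par k I A (sgn k I A 1 x)) := by
    simp only [← smul_add]
    rw [eq_inv_smul_iff₀ (by norm_num)]
    rw [show (4 : k) = 1 + 1 + 1 + 1 by norm_num]
    simp only [add_smul, one_smul]
    abel
  rw [e]
  refine add _ _ (add _ _ (add _ _ (h 0 0 _ ⟨?_, ?_⟩) (h 0 1 _ ⟨?_, ?_⟩)) (h 1 0 _ ⟨?_, ?_⟩))
    (h 1 1 _ ⟨?_, ?_⟩) <;>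
  · simp only [map_smul, map_add, map_sub, par_par, sgn_sgn, sgn_par, zpow_zero, zpow_one, one_smul,
      neg_smul, ← smul_neg]
    congr 1
    abel

/-! ### The differential, contractions and Lie derivatives -/

variable (k I A) in
/-- The differential `D` of `Ω_R A`: `D (x y) = D x * y + (-1) ^ p * x * D y` for a `p`-form `x`,
`D² = 0` on `A`. -/
def D : Omega k I A →ₗ[k] Omega k I A :=
  der (par k I A) (AlgHom.id k _) (dA k I A) 0
    (fun a b => by simp [dA_mul]) (fun a b => by simp) (fun r => by simp)

/-- The contraction `i_θ` with a super-derivation `θ` of degree `n`: the super-derivation of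
bidegree `(-1, n)` of `Ω_R A` that vanishes on `A` and sends `D a` to `θ a`. -/
def contr {n : ℤ} (θ : sder k I A n) : Omega k I A →ₗ[k] Omega k I A :=
  der ((par k I A).comp (sgn k I A n)) (AlgHom.id k _) 0 ((inA k I A).toLinearMap ∘ₗ θ.1)
    (fun a b => by simp) (fun a b => by simp [sder_mul θ.2]) (fun r => by simp [θ.2.1])

/-- The Lie derivative `L_θ` along a super-derivation `θ` of degree `n`: the super-derivation of
bidegree `(0, n)` of `Ω_R A` that sends `a` to `θ a` and `D a` to `D (θ a)`. -/
def lie {n : ℤ} (θ : sder k I A n) : Omega k I A →ₗ[k] Omega k I A :=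
  der (sgn k I A n) (AlgHom.id k _) ((inA k I A).toLinearMap ∘ₗ θ.1) (dA k I A ∘ₗ θ.1)
    (fun a b => by simp [sder_mul θ.2])
    (fun a b => by simp [sder_mul θ.2, dA_mul]; abel) (fun r => by simp [θ.2.1])

/-- The contraction `i_μ : Ω_R A → Ω_R A ⊗ Ω_R A` with a double derivation `μ` of degree `n`: the
double super-derivation of bidegree `(-1, n)` that vanishes on `A` and sends `D a` to `μ a`. -/
def dcontr {n : ℤ} (μ : dder k I A n) : Omega k I A →ₗ[k] Omega k I A ⊗[k] Omega k I A :=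
  der (Algebra.TensorProduct.includeLeft.comp ((par k I A).comp (sgn k I A n)))
    Algebra.TensorProduct.includeRight 0
    ((Algebra.TensorProduct.map (inA k I A) (inA k I A)).toLinearMap ∘ₗ μ.1)
    (fun a b => by simp)
    (fun a b => by
      rw [LinearMap.comp_apply, dder_mul μ.2, AlgHom.toLinearMap_apply, map_add, map_mul, map_mul]
      simp only [Algebra.TensorProduct.map_tmul, map_one]
      simp
      rfl)
    (fun r => by simp [μ.2.1])

variable (k I A) in
/-- The Koszul sign of an involution `U` with eigenvalues `±1`: the endomorphism of
`Ω_R A ⊗ Ω_R A` that multiplies `x ⊗ y` by `-1` if `U x = -x` and `U y = -y`, and fixes it if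
`U x = x` or `U y = y`. -/
def koszul (U : Omega k I A →ₐ[k] Omega k I A) :
    Omega k I A ⊗[k] Omega k I A →ₗ[k] Omega k I A ⊗[k] Omega k I A :=
  (2⁻¹ : k) • (LinearMap.id + TensorProduct.map U.toLinearMap LinearMap.id +
    TensorProduct.map LinearMap.id U.toLinearMap - TensorProduct.map U.toLinearMap U.toLinearMap)

variable (k I A) in
/-- The flip `β` of `Ω_R A ⊗ Ω_R A`:  `x ⊗ y ↦ (-1) ^ (p * q + m * n) • y ⊗ x` for `x` of
bidegree `(p, m)` and `y` of bidegree `(q, n)`. -/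
def flip : Omega k I A ⊗[k] Omega k I A →ₗ[k] Omega k I A ⊗[k] Omega k I A :=
  (TensorProduct.comm k _ _).toLinearMap ∘ₗ koszul k I A (par k I A) ∘ₗ koszul k I A (sgn k I A 1)

/-- The reduced contraction `ι_μ = m ∘ β ∘ i_μ`. -/
def iota {n : ℤ} (μ : dder k I A n) : Omega k I A →ₗ[k] Omega k I A :=
  LinearMap.mul' k _ ∘ₗ flip k I A ∘ₗ dcontr μ

theorem koszul_tmul [CharZero k] {U : Omega k I A →ₐ[k] Omega k I A} {p q : ℤ} {x y : Omega k I A}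
    (hx : U x = ((-1 : k) ^ p) • x) (hy : U y = ((-1 : k) ^ q) • y) :
    koszul k I A U (x ⊗ₜ y) = ((-1 : k) ^ (p * q)) • x ⊗ₜ[k] y := by
  have h2 : (2 : k) ≠ 0 := two_ne_zero
  simp only [koszul, LinearMap.smul_apply, LinearMap.sub_apply, LinearMap.add_apply,
    LinearMap.id_apply, TensorProduct.map_tmul, AlgHom.toLinearMap_apply, hx, hy,
    TensorProduct.smul_tmul', TensorProduct.tmul_smul, smul_smul]
  rw [inv_smul_eq_iff₀ h2, TensorProduct.smul_tmul', smul_smul]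
  have h : ∀ c d e f : k, 1 + c + d - e = f →
      x ⊗ₜ[k] y + (c • x) ⊗ₜ[k] y + (d • x) ⊗ₜ[k] y - (e • x) ⊗ₜ[k] y = (f • x) ⊗ₜ[k] y := by
    rintro c d e f rfl
    simp only [add_smul, sub_smul, one_smul, TensorProduct.add_tmul, TensorProduct.sub_tmul]
  apply h
  rcases Int.even_or_odd p with hp | hp <;> rcases Int.even_or_odd q with hq | hq
  · rw [hp.neg_one_zpow, hq.neg_one_zpow, (hp.mul_right q).neg_one_zpow]; ring
  · rw [hp.neg_one_zpow, hq.neg_one_zpow, (hp.mul_right q).neg_one_zpow]; ring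
  · rw [hp.neg_one_zpow, hq.neg_one_zpow, (hq.mul_left p).neg_one_zpow]; ring
  · rw [hp.neg_one_zpow, hq.neg_one_zpow, (hp.mul hq).neg_one_zpow]; ring

theorem flip_tmul [CharZero k] {p m q n : ℤ} {x y : Omega k I A} (hx : Par p m x)
    (hy : Par q n y) :
    flip k I A (x ⊗ₜ y) = ((-1 : k) ^ (p * q + m * n)) • y ⊗ₜ[k] x := by
  simp only [flip, LinearMap.comp_apply, koszul_tmul hx.2 hy.2, map_smul, koszul_tmul hx.1 hy.1,
    LinearEquiv.coe_coe, TensorProduct.comm_tmul, smul_smul, sign_mul]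
  rw [add_comm]

end Omega

namespace Omega

variable {k I A}

/-! ### The cyclic quotient -/

theorem der_comm {B : Type*} [Ring B] [Algebra k B] {f g : Omega k I A →ₐ[k] B}
    {d : Omega k I A →ₗ[k] B} (hd : ∀ x y, d (x * y) = d x * g y + f x * d y)
    {U : Omega k I A →ₐ[k] Omega k I A} {U' : B →ₐ[k] B} (c : k)
    (hf : ∀ x, f (U x) = U' (f x)) (hg : ∀ x, g (U x) = U' (g x))
    (h0 : ∀ a, d (U (inA k I A a)) = c • U' (d (inA k I A a)))
    (h1 : ∀ a, d (U (dA k I A a)) = c • U' (d (dA k I A a))) (x : Omega k I A) :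
    d (U x) = c • U' (d x) := by
  induction x using Omega.induction with
  | h0 a => exact h0 a
  | h1 a => exact h1 a
  | add x y hx hy => simp only [map_add, hx, hy, smul_add]
  | mul x y hx hy =>
    rw [map_mul, hd, hd, hx, hy, hf, hg, map_add, map_mul, map_mul, smul_add, smul_mul_assoc,
      mul_smul_comm]

theorem D_mul {p m : ℤ} {x : Omega k I A} (hx : Par p m x) (y : Omega k I A) :
    D k I A (x * y) = D k I A x * y + ((-1 : k) ^ p) • (x * D k I A y) := by
  rw [D, der_mul, hx.1, smul_mul_assoc]; rfl

theorem contr_mul {n : ℤ} (θ : sder k I A n) {p m : ℤ} {x : Omega k I A} (hx : Par p m x)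
    (y : Omega k I A) :
    contr θ (x * y) = contr θ x * y + ((-1 : k) ^ (p + n * m)) • (x * contr θ y) := by
  rw [contr, der_mul, AlgHom.comp_apply, hx.sgn, map_smul, hx.1, smul_smul, sign_mul,
    smul_mul_assoc, add_comm p]; rfl

theorem lie_mul {n : ℤ} (θ : sder k I A n) {p m : ℤ} {x : Omega k I A} (hx : Par p m x)
    (y : Omega k I A) :
    lie θ (x * y) = lie θ x * y + ((-1 : k) ^ (n * m)) • (x * lie θ y) := by
  rw [lie, der_mul, hx.sgn, smul_mul_assoc]; rfl

theorem D_par {p m : ℤ} {x : Omega k I A} (hx : Par p m x) : Par (p + 1) m (D k I A x) := by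
  constructor
  · have h := der_comm (d := D k I A) (der_mul _ _ _ _ _ _ _) (U := par k I A) (U' := par k I A)
      (-1) (fun _ => rfl) (fun _ => rfl) (fun a => by simp [D]) (fun a => by simp [D]) x
    rw [hx.1, map_smul] at h
    rw [← sign_mul, mul_comm, mul_smul, h, smul_smul]
    simp
  · have h := der_comm (d := D k I A) (der_mul _ _ _ _ _ _ _) (U := sgn k I A 1)
      (U' := sgn k I A 1)
      1 (fun _ => (sgn_par _ _ _ _ _).symm) (fun _ => rfl) (fun a => by simp [D])
      (fun a => by simp [D]) x
    rw [hx.2, map_smul, one_smul] at h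
    exact h.symm

theorem contr_par {n : ℤ} (θ : sder k I A n) {p m : ℤ} {x : Omega k I A} (hx : Par p m x) :
    Par (p - 1) (m + n) (contr θ x) := by
  constructor
  · have h := der_comm (d := contr θ) (der_mul _ _ _ _ _ _ _) (U := par k I A) (U' := par k I A)
      (-1) (fun _ => by simp [sgn_par]) (fun _ => rfl) (fun a => by simp [contr])
      (fun a => by simp [contr]) x
    rw [hx.1, map_smul] at h
    rw [sub_eq_add_neg, ← sign_mul, mul_comm, mul_smul, h, smul_smul]
    simp
  · have h := der_comm (d := contr θ) (der_mul _ _ _ _ _ _ _) (U := sgn k I A 1)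
      (U' := sgn k I A 1)
      ((-1) ^ n) (fun x => by
        rcases Int.even_or_odd n with hn | hn
        · simp [sgn_even _ _ _ hn, sgn_par]
        · simp [sgn_odd _ _ _ hn, sgn_par]) (fun _ => rfl) (fun a => by simp [contr])
      (fun a => by simp [contr, sder_twist θ.2]) x
    rw [hx.2, map_smul] at h
    rw [← sign_mul, mul_comm, mul_smul, h, smul_smul, sign_mul,
      Even.neg_one_zpow (⟨n, rfl⟩ : Even (n + n)), one_smul]

theorem lie_par {n : ℤ} (θ : sder k I A n) {p m : ℤ} {x : Omega k I A} (hx : Par p m x) :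
    Par p (m + n) (lie θ x) := by
  constructor
  · have h := der_comm (d := lie θ) (der_mul _ _ _ _ _ _ _) (U := par k I A) (U' := par k I A)
      1 (fun _ => by simp [sgn_par]) (fun _ => rfl) (fun a => by simp [lie])
      (fun a => by simp [lie]) x
    rw [hx.1, map_smul, one_smul] at h
    exact h.symm
  · have h := der_comm (d := lie θ) (der_mul _ _ _ _ _ _ _) (U := sgn k I A 1)
      (U' := sgn k I A 1)
      ((-1) ^ n) (fun x => by
        rcases Int.even_or_odd n with hn | hn
        · simp [sgn_even _ _ _ hn]
        · simp [sgn_odd _ _ _ hn]) (fun _ => rfl) (fun a => by simp [lie, sder_twist θ.2])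
      (fun a => by simp [lie, sder_twist θ.2]) x
    rw [hx.2, map_smul] at h
    rw [← sign_mul, mul_comm, mul_smul, h, smul_smul, sign_mul,
      Even.neg_one_zpow (⟨n, rfl⟩ : Even (n + n)), one_smul]

variable (k I A) in
/-- The subspace `[Ω_R A, Ω_R A]` spanned by the super-commutators
`x y - (-1) ^ (p * q + m * n) y x` for `x` of bidegree `(p, m)` and `y` of bidegree `(q, n)` (form
degree and internal degree; only their parities matter). -/
def comm : Submodule k (Omega k I A) :=
  Submodule.span k {z | ∃ (p m q n : ℤ) (x y : Omega k I A), Par p m x ∧ Par q n y ∧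
    z = x * y - ((-1 : k) ^ (p * q + m * n)) • (y * x)}

theorem map_comm_le {d : Omega k I A →ₗ[k] Omega k I A} {e n : ℤ}
    (hmul : ∀ (p m : ℤ) (x y : Omega k I A), Par p m x →
      d (x * y) = d x * y + ((-1 : k) ^ (e * p + n * m)) • (x * d y))
    (hpar : ∀ (p m : ℤ) (x : Omega k I A), Par p m x → Par (p + e) (m + n) (d x)) :
    comm k I A ≤ (comm k I A).comap d := by
  rw [comm, Submodule.span_le]
  rintro _ ⟨p, m, q, l, x, y, hx, hy, rfl⟩
  have h1 : d x * y - ((-1 : k) ^ ((p + e) * q + (m + n) * l)) • (y * d x) ∈ comm k I A :=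
    Submodule.subset_span ⟨_, _, _, _, _, _, hpar _ _ _ hx, hy, rfl⟩
  have h2 : x * d y - ((-1 : k) ^ (p * (q + e) + m * (l + n))) • (d y * x) ∈ comm k I A :=
    Submodule.subset_span ⟨_, _, _, _, _, _, hx, hpar _ _ _ hy, rfl⟩
  have h3 := add_mem h1 (Submodule.smul_mem _ ((-1 : k) ^ (e * p + n * m)) h2)
  change d _ ∈ comm k I A
  convert h3 using 1
  rw [map_sub, map_smul, hmul _ _ _ _ hx, hmul _ _ _ _ hy]
  simp only [smul_sub, smul_add, smul_smul, sign_mul]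
  rw [sign_congr k (a := p * q + m * l + (e * q + n * l)) (b := (p + e) * q + (m + n) * l)
    ⟨0, by ring⟩, sign_congr k (a := e * p + n * m + (p * (q + e) + m * (l + n)))
    (b := p * q + m * l) ⟨e * p + n * m, by ring⟩]
  abel

/-- The product `m ∘ β`, on pure tensors. -/
theorem mulFlip_tmul [CharZero k] {p m q n : ℤ} {x y : Omega k I A} (hx : Par p m x)
    (hy : Par q n y) : LinearMap.mul' k _ (flip k I A (x ⊗ₜ y)) =
      ((-1 : k) ^ (p * q + m * n)) • (y * x) := by
  rw [flip_tmul hx hy, map_smul, LinearMap.mul'_apply]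

/-- `U ⊗ U` if `q` is odd, the identity if `q` is even. -/
def tpow (U : Omega k I A →ₐ[k] Omega k I A) (q : ℤ) :
    Omega k I A ⊗[k] Omega k I A →ₐ[k] Omega k I A ⊗[k] Omega k I A :=
  open Classical in if Even q then AlgHom.id k _ else Algebra.TensorProduct.map U U

theorem tpow_tmul {U : Omega k I A →ₐ[k] Omega k I A} (q : ℤ) {p p' : ℤ} {x y : Omega k I A}
    (hx : U x = ((-1 : k) ^ p) • x) (hy : U y = ((-1 : k) ^ p') • y) :
    tpow U q (x ⊗ₜ y) = ((-1 : k) ^ ((p + p') * q)) • x ⊗ₜ[k] y := by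
  rcases Int.even_or_odd q with hq | hq
  · simp [tpow, hq, (hq.mul_left (p + p')).neg_one_zpow]
  · rw [tpow, if_neg (Int.not_even_iff_odd.2 hq), Algebra.TensorProduct.map_tmul, hx, hy,
      TensorProduct.smul_tmul_smul, sign_mul, mul_comm (p + p'), zpow_mul, hq.neg_one_zpow]

theorem tpow_apply {U : Omega k I A →ₐ[k] Omega k I A} (q : ℤ) {p : ℤ}
    {z : Omega k I A ⊗[k] Omega k I A}
    (hz : Algebra.TensorProduct.map U U z = ((-1 : k) ^ p) • z) :
    tpow U q z = ((-1 : k) ^ (p * q)) • z := by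
  rcases Int.even_or_odd q with hq | hq
  · simp [tpow, hq, (hq.mul_left p).neg_one_zpow]
  · rw [tpow, if_neg (Int.not_even_iff_odd.2 hq), hz, mul_comm p, zpow_mul, hq.neg_one_zpow]

theorem mulFlip_rotate [CharZero k] {q l : ℤ} {y : Omega k I A} (hy : Par q l y)
    (z : Omega k I A ⊗[k] Omega k I A) :
    LinearMap.mul' k _ (flip k I A (tpow (par k I A) q (tpow (sgn k I A 1) l z) * (1 ⊗ₜ[k] y))) =
      LinearMap.mul' k _ (flip k I A ((y ⊗ₜ[k] 1) * z)) := by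
  induction z using TensorProduct.induction_on with
  | zero => simp
  | add z z' h h' => simp only [map_add, add_mul, mul_add, h, h']
  | tmul x x' =>
    induction x using par_decomp with
    | add x z h h' => simp only [TensorProduct.add_tmul, map_add, add_mul, mul_add, h, h']
    | h p m x hx =>
    induction x' using par_decomp with
    | add x z h h' => simp only [TensorProduct.tmul_add, map_add, add_mul, mul_add, h, h']
    | h p' m' x' hx' =>
    rw [tpow_tmul l hx.2 hx'.2, map_smul, tpow_tmul q hx.1 hx'.1, smul_mul_assoc, smul_mul_assoc,
      Algebra.TensorProduct.tmul_mul_tmul, Algebra.TensorProduct.tmul_mul_tmul, mul_one, one_mul,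
      map_smul, map_smul, map_smul, map_smul, mulFlip_tmul hx (hx'.mul hy),
      mulFlip_tmul (hy.mul hx) hx', smul_smul, smul_smul, sign_mul, sign_mul, mul_assoc]
    congr 1
    exact sign_congr k ⟨p * q + m * l, by ring⟩

theorem mulFlip_rotate' [CharZero k] {q l p m : ℤ} {y : Omega k I A} (hy : Par q l y)
    {z : Omega k I A ⊗[k] Omega k I A}
    (h1 : Algebra.TensorProduct.map (par k I A) (par k I A) z = ((-1 : k) ^ p) • z)
    (h2 : Algebra.TensorProduct.map (sgn k I A 1) (sgn k I A 1) z = ((-1 : k) ^ m) • z) :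
    LinearMap.mul' k _ (flip k I A ((y ⊗ₜ[k] 1) * z)) =
      ((-1 : k) ^ (p * q + m * l)) • LinearMap.mul' k _ (flip k I A (z * (1 ⊗ₜ[k] y))) := by
  rw [← mulFlip_rotate hy, tpow_apply l h2, map_smul, tpow_apply q h1, smul_mul_assoc,
    smul_mul_assoc, map_smul, map_smul, map_smul, map_smul, smul_smul, sign_mul, add_comm]

theorem dcontr_mul_raw {n : ℤ} (μ : dder k I A n) (x y : Omega k I A) : dcontr μ (x * y) =
    dcontr μ x * (Algebra.TensorProduct.includeRight : _ →ₐ[k] Omega k I A ⊗[k] Omega k I A) y +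
      ((Algebra.TensorProduct.includeLeft : _ →ₐ[k] Omega k I A ⊗[k] Omega k I A).comp
        ((par k I A).comp (sgn k I A n))) x * dcontr μ y :=
  der_mul _ _ _ _ _ _ _ x y

theorem dcontr_inA {n : ℤ} (μ : dder k I A n) (a : A) : dcontr μ (inA k I A a) = 0 :=
  der_inA _ _ _ _ _ _ _ a

theorem dcontr_dA {n : ℤ} (μ : dder k I A n) (a : A) : dcontr μ (dA k I A a) =
    Algebra.TensorProduct.map (inA k I A) (inA k I A) (μ.1 a) :=
  der_dA _ _ _ _ _ _ _ a

theorem dcontr_mul {n : ℤ} (μ : dder k I A n) {p m : ℤ} {x : Omega k I A} (hx : Par p m x)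
    (y : Omega k I A) : dcontr μ (x * y) =
      dcontr μ x * (1 ⊗ₜ[k] y) + ((-1 : k) ^ (p + n * m)) • ((x ⊗ₜ[k] 1) * dcontr μ y) := by
  rw [dcontr_mul_raw, AlgHom.comp_apply, AlgHom.comp_apply, hx.sgn, map_smul, hx.1, smul_smul,
    sign_mul, map_smul, smul_mul_assoc, add_comm p]; rfl

theorem dcontr_par {n : ℤ} (μ : dder k I A n) {p m : ℤ} {x : Omega k I A} (hx : Par p m x) :
    Algebra.TensorProduct.map (par k I A) (par k I A) (dcontr μ x) =
      ((-1 : k) ^ (p - 1)) • dcontr μ x := by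
  have hAA : ∀ t : A ⊗[k] A, Algebra.TensorProduct.map (par k I A) (par k I A)
      (Algebra.TensorProduct.map (inA k I A) (inA k I A) t) =
        Algebra.TensorProduct.map (inA k I A) (inA k I A) t := by
    intro t
    induction t using TensorProduct.induction_on with
    | zero => simp
    | add z z' h h' => rw [map_add, map_add, h, h']
    | tmul x x' => simp
  have h := der_comm (dcontr_mul_raw μ) (U := par k I A)
    (U' := Algebra.TensorProduct.map (par k I A) (par k I A))
    (-1) (fun _ => by simp [sgn_par]) (fun _ => by simp) (fun a => by simp [dcontr_inA])
    (fun a => by rw [par_dA, map_neg, neg_smul, one_smul, dcontr_dA, hAA]) x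
  rw [hx.1, map_smul] at h
  rw [sub_eq_add_neg, ← sign_mul, mul_comm, mul_smul, h, smul_smul]
  simp

theorem dcontr_sgn {n : ℤ} (μ : dder k I A n) {p m : ℤ} {x : Omega k I A} (hx : Par p m x) :
    Algebra.TensorProduct.map (sgn k I A 1) (sgn k I A 1) (dcontr μ x) =
      ((-1 : k) ^ (m + n)) • dcontr μ x := by
  have hAA : ∀ t : A ⊗[k] A, Algebra.TensorProduct.map (sgn k I A 1) (sgn k I A 1)
      (Algebra.TensorProduct.map (inA k I A) (inA k I A) t) =
        Algebra.TensorProduct.map (inA k I A) (inA k I A)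
          (Algebra.TensorProduct.map (twist k I A 1) (twist k I A 1) t) := by
    intro t
    induction t using TensorProduct.induction_on with
    | zero => simp
    | add z z' h h' => simp only [map_add, h, h']
    | tmul x x' => simp
  have h := der_comm (dcontr_mul_raw μ) (U := sgn k I A 1)
    (U' := Algebra.TensorProduct.map (sgn k I A 1) (sgn k I A 1))
    ((-1) ^ n) (fun x => by
        rcases Int.even_or_odd n with hn | hn
        · simp [sgn_even _ _ _ hn, sgn_par]
        · simp [sgn_odd _ _ _ hn, sgn_par]) (fun _ => by simp) (fun a => by simp [dcontr_inA])
    (fun a => by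
      rw [sgn_dA, dcontr_dA, dcontr_dA, dder_twist μ.2, map_smul, hAA]) x
  rw [hx.2, map_smul] at h
  rw [← sign_mul, mul_comm, mul_smul, h, smul_smul, sign_mul,
    Even.neg_one_zpow (⟨n, rfl⟩ : Even (n + n)), one_smul]

theorem iota_comm [CharZero k] {n : ℤ} (μ : dder k I A n) :
    comm k I A ≤ LinearMap.ker (iota μ) := by
  rw [comm, Submodule.span_le]
  rintro _ ⟨p, m, q, l, x, y, hx, hy, rfl⟩
  have h1 := mulFlip_rotate' hx (dcontr_par μ hy) (dcontr_sgn μ hy)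
  have h2 := mulFlip_rotate' hy (dcontr_par μ hx) (dcontr_sgn μ hx)
  rw [SetLike.mem_coe, LinearMap.mem_ker, map_sub, map_smul, sub_eq_zero]
  simp only [iota, LinearMap.comp_apply]
  rw [dcontr_mul μ hx, dcontr_mul μ hy]
  simp only [map_add, map_smul, h1, h2, smul_add, smul_smul, sign_mul]
  rw [sign_congr k (a := p + n * m + ((q - 1) * p + (l + n) * m)) (b := p * q + m * l)
    ⟨n * m, by ring⟩,
    sign_congr k (a := p * q + m * l + (q + n * l + ((p - 1) * q + (m + n) * l))) (b := 0)
    ⟨p * q + n * l + m * l, by ring⟩]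
  rw [zpow_zero, one_smul, add_comm]

end Omega

/-- The cyclic quotient `DR_R(A) = Ω_R A / [Ω_R A, Ω_R A]`. -/
abbrev DR : Type _ := Omega k I A ⧸ Omega.comm k I A

namespace DR

/-- The class of a form in `DR_R(A)`. -/
abbrev mk : Omega k I A →ₗ[k] DR k I A := (Omega.comm k I A).mkQ

/-- The differential of `DR_R(A)`. -/
def D : DR k I A →ₗ[k] DR k I A :=
  (Omega.comm k I A).mapQ _ (Omega.D k I A)
    (Omega.map_comm_le (e := 1) (n := 0)
      (fun p m x y hx => by rw [Omega.D_mul hx]; simp)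
      (fun p m x hx => by simpa using Omega.D_par hx))

variable {k I A}

/-- The contraction `i_θ : DR_R(A) → DR_R(A)` with a super-derivation. -/
def contr {n : ℤ} (θ : sder k I A n) : DR k I A →ₗ[k] DR k I A :=
  (Omega.comm k I A).mapQ _ (Omega.contr θ)
    (Omega.map_comm_le (e := -1) (n := n)
      (fun p m x y hx => by
        rw [Omega.contr_mul θ hx, sign_congr k (a := p + n * m) (b := -1 * p + n * m)
          ⟨p, by ring⟩])
      (fun p m x hx => Omega.contr_par θ hx))

/-- The Lie derivative `L_θ : DR_R(A) → DR_R(A)` along a super-derivation. -/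
def lie {n : ℤ} (θ : sder k I A n) : DR k I A →ₗ[k] DR k I A :=
  (Omega.comm k I A).mapQ _ (Omega.lie θ)
    (Omega.map_comm_le (e := 0) (n := n)
      (fun p m x y hx => by rw [Omega.lie_mul θ hx]; simp)
      (fun p m x hx => by simpa using Omega.lie_par θ hx))

/-- The reduced contraction `ι_μ : DR_R(A) → Ω_R A` with a double derivation. -/
def iota [CharZero k] {n : ℤ} (μ : dder k I A n) : DR k I A →ₗ[k] Omega k I A :=
  (Omega.comm k I A).liftQ (Omega.iota μ) (Omega.iota_comm μ)

end DR

variable {k I A}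

theorem Omega.contr_add {n : ℤ} (θ η : sder k I A n) :
    Omega.contr (θ + η) = Omega.contr θ + Omega.contr η :=
  Omega.der_unique (f := (par k I A).comp (sgn k I A n)) (g := AlgHom.id k _)
    (Omega.der_mul _ _ _ _ _ _ _)
    (fun x y => by
      simp only [LinearMap.add_apply, Omega.contr, Omega.der_mul, add_mul, mul_add]; abel)
    (fun a => by simp [Omega.contr]) (fun a => by simp [Omega.contr])

theorem Omega.contr_smul {n : ℤ} (c : k) (θ : sder k I A n) :
    Omega.contr (c • θ) = c • Omega.contr θ :=
  Omega.der_unique (f := (par k I A).comp (sgn k I A n)) (g := AlgHom.id k _)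
    (Omega.der_mul _ _ _ _ _ _ _)
    (fun x y => by
      simp only [LinearMap.smul_apply, Omega.contr, Omega.der_mul, smul_add, smul_mul_assoc,
        mul_smul_comm])
    (fun a => by simp [Omega.contr]) (fun a => by simp [Omega.contr])

theorem Omega.dcontr_add {n : ℤ} (μ ν : dder k I A n) :
    Omega.dcontr (μ + ν) = Omega.dcontr μ + Omega.dcontr ν :=
  Omega.der_unique (Omega.dcontr_mul_raw _)
    (fun x y => by
      simp only [LinearMap.add_apply, Omega.dcontr_mul_raw, add_mul, mul_add]; abel)
    (fun a => by simp [Omega.dcontr_inA])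
    (fun a => by simp only [LinearMap.add_apply, Omega.dcontr_dA, Submodule.coe_add, map_add])

theorem Omega.dcontr_smul {n : ℤ} (c : k) (μ : dder k I A n) :
    Omega.dcontr (c • μ) = c • Omega.dcontr μ :=
  Omega.der_unique (Omega.dcontr_mul_raw _)
    (fun x y => by
      simp only [LinearMap.smul_apply, Omega.dcontr_mul_raw, smul_add, smul_mul_assoc,
        mul_smul_comm])
    (fun a => by simp [Omega.dcontr_inA])
    (fun a => by simp only [LinearMap.smul_apply, Omega.dcontr_dA, Submodule.coe_smul, map_smul])

/-- The map `i^ω : Der_R(A) → DR_R(A)`, `θ ↦ i_θ(ω)`. -/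
def contrForm (ω : DR k I A) : SDer k I A →ₗ[k] DR k I A :=
  DirectSum.toModule k ℤ _ fun n =>
    { toFun := fun θ => DR.contr θ ω
      map_add' := fun θ η => by
        obtain ⟨x, rfl⟩ := Submodule.mkQ_surjective _ ω
        simp [DR.contr, Omega.contr_add]
      map_smul' := fun c θ => by
        obtain ⟨x, rfl⟩ := Submodule.mkQ_surjective _ ω
        simp [DR.contr, Omega.contr_smul] }

/-- The map `ι^ω : 𝔻er_R(A) → Ω_R A`, `μ ↦ ι_μ(ω)`. -/
def iotaForm [CharZero k] (ω : DR k I A) : DDer k I A →ₗ[k] Omega k I A :=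
  DirectSum.toModule k ℤ _ fun n =>
    { toFun := fun μ => DR.iota μ ω
      map_add' := fun θ η => by
        obtain ⟨x, rfl⟩ := Submodule.mkQ_surjective _ ω
        simp [DR.iota, Omega.iota, Omega.dcontr_add]
      map_smul' := fun c θ => by
        obtain ⟨x, rfl⟩ := Submodule.mkQ_surjective _ ω
        simp [DR.iota, Omega.iota, Omega.dcontr_smul] }

variable (k I A)

/-! ### The bigrading of the forms -/

/-- The one-forms of internal degree `n`: those in the span of the `a ⊗ b` with
`a ∈ A_i`, `b ∈ A_j`, `i + j = n`. -/
def omega1Deg (n : ℤ) : Submodule k (Omega1 k I A) :=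
  (Submodule.span k {t : TenR k I A | ∃ i j, i + j = n ∧ ∃ x ∈ deg k I A i, ∃ y ∈ deg k I A j,
    t = tmulR I x y}).comap ((Omega1 k I A).subtype.restrictScalars k)

/-- The `p`-forms of internal degree `n`. -/
def omegaDeg : ℕ → ℤ → Submodule k (Omega k I A)
  | 0, n => (deg k I A n).map (Omega.inA k I A).toLinearMap
  | p + 1, n => Submodule.span k {z | ∃ i j, i + j = n ∧ ∃ x ∈ omegaDeg p i,
      ∃ η ∈ omega1Deg k I A j, z = x * Omega.inOne k I A η}

/-- The subspace `Ω¹_R A` of `Ω_R A`. -/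
def oneForms : Submodule k (Omega k I A) := LinearMap.range (Omega.inOne k I A)

variable {k I A}

/-! ### Symplectic and bisymplectic forms, and the moment map -/

/-- `ω` is a closed element of `DR²_R(A)`, homogeneous of internal degree `c`. -/
def IsClosedTwoForm (c : ℤ) (ω : DR k I A) : Prop :=
  ω ∈ (omegaDeg k I A 2 c).map (DR.mk k I A) ∧ DR.D k I A ω = 0

/-- `ω` is symplectic: `i^ω` is an isomorphism from `Der_R(A)` to `DR¹_R(A)`. -/
def IsSymplectic (ω : DR k I A) : Prop :=
  Set.BijOn (contrForm ω) Set.univ ((oneForms k I A).map (DR.mk k I A))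

/-- `ω` is bisymplectic: `ι^ω` is an isomorphism from `𝔻er_R(A)` to `Ω¹_R A`. -/
def IsBisymplectic [CharZero k] (ω : DR k I A) : Prop :=
  Set.BijOn (iotaForm ω) Set.univ (oneForms k I A)

section Moment

variable [DecidableEq I]

variable (k I A) in
/-- The image in `A` of the indicator function of `i`. -/
def idem (i : I) : A := str k I A (Pi.single i 1)

theorem str_mul_idem (r : I → k) (i : I) : str k I A r * idem k I A i = r i • idem k I A i := by
  rw [idem, ← map_mul, ← map_smul]
  congr 1
  ext j
  by_cases h : j = i
  · subst h; simp
  · simp [h]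

theorem idem_mul_str (r : I → k) (i : I) : idem k I A i * str k I A r = r i • idem k I A i := by
  rw [← str_mul_idem, idem, ← map_mul, ← map_mul, mul_comm]

variable [Fintype I]

variable (k I A) in
/-- The distinguished double derivation `δ : a ↦ a · e - e · a`, where
`e = ∑ i, 1_i ⊗ 1_i ∈ R ⊗ R`. -/
def delta : dder k I A 0 where
  val := ∑ i, ((TensorProduct.mk k A A).flip (idem k I A i) ∘ₗ LinearMap.mulRight k (idem k I A i) -
    TensorProduct.mk k A A (idem k I A i) ∘ₗ LinearMap.mulLeft k (idem k I A i))
  property := by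
    have hi : ∀ i, idem k I A i ∈ deg k I A 0 := fun i => GrAlg.str_mem _
    refine ⟨fun r => ?_, fun m a ha => ?_, fun m a ha b => ?_⟩
    · simp [LinearMap.sum_apply, str_mul_idem, idem_mul_str]
    · rw [LinearMap.sum_apply]
      refine Submodule.sum_mem _ fun i _ => ?_
      refine Submodule.sub_mem _ (Submodule.subset_span ⟨m, 0, by simp, a * idem k I A i, ?_,
        idem k I A i, hi i, rfl⟩) (Submodule.subset_span ⟨0, m, by simp, idem k I A i, hi i,
        idem k I A i * a, ?_, rfl⟩)
      · simpa using SetLike.mul_mem_graded ha (hi i)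
      · simpa using SetLike.mul_mem_graded (hi i) ha
    · simp only [LinearMap.sum_apply, Finset.sum_mul, Finset.mul_sum, Finset.smul_sum,
        ← Finset.sum_add_distrib]
      refine Finset.sum_congr rfl fun i _ => ?_
      simp [sub_mul, mul_sub, mul_assoc]

/-- `w ∈ A` represents `μ_nc(ω) ∈ (A / R)^R`: the class of `w` in `A / R` commutes with `R`, and it
is the unique class with `D w = ι_δ(ω)`. -/
def RepresentsMoment [CharZero k] (ω : DR k I A) (w : A) : Prop :=
  (∀ r, str k I A r * w - w * str k I A r ∈ (str k I A).range) ∧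
    ∀ a, Omega.dA k I A a = DR.iota (delta k I A) ω ↔ a - w ∈ (str k I A).range

/-! ### Relative Ginzburg dg algebras -/

/-- The conditions on the triple `(A, ω, ξ)`, with `c` the degree of `ω` and `w` a representative of
`μ_nc(ω)`, under which the relative Ginzburg dg algebra `𝔇(A, ω, ξ)` is defined. -/
structure IsGinzburgTriple [CharZero k] (c : ℤ) (ω : DR k I A) (ξ : sder k I A 1) (w : A) :
    Prop where
  nonpos : ∀ n, 0 < n → deg k I A n = ⊥
  finiteType : Algebra.FiniteType k A
  projective : Module.Projective (Env k A) (Omega1 k I A)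
  generated : Submodule.span (Env k A)
    {η : Omega1 k I A | ∃ n, c ≤ n ∧ n ≤ 0 ∧ η ∈ omega1Deg k I A n} = ⊤
  closed : IsClosedTwoForm c ω
  bisymplectic : IsBisymplectic ω
  sq_zero : ∀ a, ξ.1 (ξ.1 a) = 0
  lie_zero : DR.lie ξ ω = 0
  moment : RepresentsMoment ω w
  moment_deg : w ∈ deg k I A c
  moment_zero : ξ.1 w = 0

end Moment

/-! ### Free products over `R` -/

variable (k I A)

/-- The relations that define `A *_R R[t]` as a quotient of the tensor algebra of the `k`-module
`A ⊕ R[t]`. -/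
inductive FreeProd.Rel : TensorAlgebra k (A × Polynomial (I → k)) →
    TensorAlgebra k (A × Polynomial (I → k)) → Prop
  | one : Rel (TensorAlgebra.ι k (1, 0)) 1
  | mul_left (a b : A) : Rel (TensorAlgebra.ι k (a * b, 0))
      (TensorAlgebra.ι k (a, 0) * TensorAlgebra.ι k (b, 0))
  | mul_right (f g : Polynomial (I → k)) : Rel (TensorAlgebra.ι k (0, f * g))
      (TensorAlgebra.ι k (0, f) * TensorAlgebra.ι k (0, g))
  | amalg (r : I → k) : Rel (TensorAlgebra.ι k (str k I A r, 0))
      (TensorAlgebra.ι k (0, Polynomial.C r))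

/-- The free product `A *_R R[t]` of `R`-algebras: the universal algebra that receives algebra
homomorphisms from `A` and from the polynomial ring `R[t]` which agree on `R`. -/
def FreeProd : Type _ := RingQuot (FreeProd.Rel k I A)

instance : Ring (FreeProd k I A) := inferInstanceAs (Ring (RingQuot _))
instance : Algebra k (FreeProd k I A) := inferInstanceAs (Algebra k (RingQuot _))

namespace FreeProd

/-- The canonical map from `A`. -/
def inl (a : A) : FreeProd k I A := RingQuot.mkAlgHom k (Rel k I A) (TensorAlgebra.ι k (a, 0))

/-- The element `t`. -/
def t : FreeProd k I A := RingQuot.mkAlgHom k (Rel k I A) (TensorAlgebra.ι k (0, Polynomial.X))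

/-- The degree `n` part of `A *_R R[t]`, where `A` keeps its grading and `t` has degree `e`: the
span of the products of homogeneous generators of total degree `n`. -/
def degree (e n : ℤ) : Submodule k (FreeProd k I A) :=
  Submodule.span k {x | ∃ l : List (FreeProd k I A × ℤ),
    (∀ y ∈ l, (∃ a ∈ deg k I A y.2, y.1 = inl k I A a) ∨ (y.1 = t k I A ∧ y.2 = e)) ∧
    (l.map Prod.snd).sum = n ∧ x = (l.map Prod.fst).prod}

end FreeProd

variable {k I A}

/-- `φ` is an isomorphism of dg `R`-algebras from the free product `A *_R R[t]`, graded with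
`t` in degree `c - 1` and with the differential given by `a ↦ ξ a` and `t ↦ w`, to the graded
`R`-algebra `G` with differential `d` (a super-derivation of degree `1` over `R` of square zero, hence
determined by its values on generators). -/
structure IsGinzburgIso {G : Type*} [Ring G] [Algebra k G] [GrAlg k I G] (c : ℤ)
    (ξ : sder k I A 1) (w : A) (d : G →ₗ[k] G) (φ : FreeProd k I A ≃ₐ[k] G) : Prop where
  map_str : ∀ r, φ (FreeProd.inl k I A (str k I A r)) = str k I G r
  map_degree : ∀ n, (FreeProd.degree k I A (c - 1) n).map φ.toLinearMap = deg k I G n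
  superder : d ∈ sder k I G 1
  sq_zero : ∀ x, d (d x) = 0
  d_inl : ∀ a, d (φ (FreeProd.inl k I A a)) = φ (FreeProd.inl k I A (ξ.1 a))
  d_t : d (φ (FreeProd.t k I A)) = φ (FreeProd.inl k I A w)

end General

/-! ### Quivers and path algebras -/

/-- A quiver with vertex set `V` and arrow set `E`. -/
structure FinQuiver (V : Type v) (E : Type w) where
  src : E → V
  tgt : E → V

/-- A quiver whose arrows carry integral degrees. -/
structure GrQuiver (V : Type v) (E : Type w) extends FinQuiver V E where
  deg : E → ℤ

section PathAlgebra

variable (k : Type u) [Field k] {V : Type v} {E : Type w} [Fintype V] (Q : GrQuiver V E)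

/-- The relations of the path algebra: the constant paths are orthogonal idempotents with sum `1`,
and `e_{t(a)} a = a = a e_{s(a)}`; products are composed from right to left. -/
inductive PathAlg.Rel : FreeAlgebra k (V ⊕ E) → FreeAlgebra k (V ⊕ E) → Prop
  | sum : Rel (∑ i : V, FreeAlgebra.ι k (Sum.inl i)) 1
  | idem (i : V) : Rel (FreeAlgebra.ι k (Sum.inl i) * FreeAlgebra.ι k (Sum.inl i))
      (FreeAlgebra.ι k (Sum.inl i))
  | orth (i j : V) (h : i ≠ j) : Rel (FreeAlgebra.ι k (Sum.inl i) * FreeAlgebra.ι k (Sum.inl j)) 0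
  | tgt (a : E) : Rel (FreeAlgebra.ι k (Sum.inl (Q.tgt a)) * FreeAlgebra.ι k (Sum.inr a))
      (FreeAlgebra.ι k (Sum.inr a))
  | src (a : E) : Rel (FreeAlgebra.ι k (Sum.inr a) * FreeAlgebra.ι k (Sum.inl (Q.src a)))
      (FreeAlgebra.ι k (Sum.inr a))

/-- The path algebra of a (graded) quiver. -/
def PathAlg : Type (max u v w) := RingQuot (PathAlg.Rel k Q)

instance : Ring (PathAlg k Q) := inferInstanceAs (Ring (RingQuot _))
instance : Algebra k (PathAlg k Q) := inferInstanceAs (Algebra k (RingQuot _))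

namespace PathAlg

/-- The projection from the free algebra. -/
def proj : FreeAlgebra k (V ⊕ E) →ₐ[k] PathAlg k Q := RingQuot.mkAlgHom k (Rel k Q)

theorem proj_rel {x y : FreeAlgebra k (V ⊕ E)} (h : Rel k Q x y) : proj k Q x = proj k Q y :=
  RingQuot.mkAlgHom_rel k h

/-- The constant path `e_i`. -/
def vert (i : V) : PathAlg k Q := proj k Q (FreeAlgebra.ι k (Sum.inl i))

/-- An arrow, as an element of the path algebra. -/
def arrow (a : E) : PathAlg k Q := proj k Q (FreeAlgebra.ι k (Sum.inr a))

theorem sum_vert : ∑ i, vert k Q i = 1 := by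
  simpa [vert] using proj_rel k Q Rel.sum

theorem vert_mul_self (i : V) : vert k Q i * vert k Q i = vert k Q i := by
  simpa [vert] using proj_rel k Q (Rel.idem i)

theorem vert_mul_of_ne {i j : V} (h : i ≠ j) : vert k Q i * vert k Q j = 0 := by
  simpa [vert] using proj_rel k Q (Rel.orth i j h)

theorem tgt_mul (a : E) : vert k Q (Q.tgt a) * arrow k Q a = arrow k Q a := by
  simpa [vert, arrow] using proj_rel k Q (Rel.tgt a)

theorem mul_src (a : E) : arrow k Q a * vert k Q (Q.src a) = arrow k Q a := by
  simpa [vert, arrow] using proj_rel k Q (Rel.src a)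

theorem arrow_mul_of_ne {a : E} {i : V} (h : Q.src a ≠ i) : arrow k Q a * vert k Q i = 0 := by
  rw [← mul_src, mul_assoc, vert_mul_of_ne k Q h, mul_zero]

section Lift

variable {k Q} {B : Type*} [Ring B] [Algebra k B] (e : V → B) (x : E → B)
  (hsum : ∑ i, e i = 1) (hidem : ∀ i, e i * e i = e i) (horth : ∀ i j, i ≠ j → e i * e j = 0)
  (htgt : ∀ a, e (Q.tgt a) * x a = x a) (hsrc : ∀ a, x a * e (Q.src a) = x a)

/-- The universal property of the path algebra. -/
def lift : PathAlg k Q →ₐ[k] B :=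
  RingQuot.liftAlgHom k ⟨FreeAlgebra.lift k (Sum.elim e x), by
    rintro _ _ (_ | i | ⟨i, j, h⟩ | a | a)
    · simp [hsum]
    · simp [hidem]
    · simp [horth i j h]
    · simp [htgt]
    · simp [hsrc]⟩

@[simp]
theorem lift_vert (i : V) : lift (Q := Q) e x hsum hidem horth htgt hsrc (vert k Q i) = e i := by
  simp only [lift, vert, proj]
  erw [RingQuot.liftAlgHom_mkAlgHom_apply]
  simp

@[simp]
theorem lift_arrow (a : E) : lift (Q := Q) e x hsum hidem horth htgt hsrc (arrow k Q a) = x a := by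
  simp only [lift, arrow, proj]
  erw [RingQuot.liftAlgHom_mkAlgHom_apply]
  simp

theorem hom_ext {f g : PathAlg k Q →ₐ[k] B} (hv : ∀ i, f (vert k Q i) = g (vert k Q i))
    (ha : ∀ a, f (arrow k Q a) = g (arrow k Q a)) : f = g := by
  refine RingQuot.ringQuot_ext' k f g (FreeAlgebra.hom_ext (funext fun i => ?_))
  rcases i with i | a
  · exact hv i
  · exact ha a

end Lift

/-- The product of a list of arrows. -/
def word (l : List E) : PathAlg k Q := (l.map (arrow k Q)).prod

/-- The degree `n` part of the path algebra: the span of the paths whose arrows have total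
degree `n`. -/
def grading (n : ℤ) : Submodule k (PathAlg k Q) :=
  Submodule.span k {x | ∃ (i : V) (l : List E), (l.map Q.deg).sum = n ∧ x = vert k Q i * word k Q l}

variable {k Q}

theorem vert_mul_word_mem (i : V) (l : List E) :
    vert k Q i * word k Q l ∈ grading k Q (l.map Q.deg).sum :=
  Submodule.subset_span ⟨i, l, rfl, rfl⟩

theorem word_mem (l : List E) : word k Q l ∈ grading k Q (l.map Q.deg).sum := by
  rw [← one_mul (word k Q l), ← sum_vert, Finset.sum_mul]
  exact Submodule.sum_mem _ fun i _ => vert_mul_word_mem i l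

theorem vert_mem (i : V) : vert k Q i ∈ grading k Q 0 := by
  simpa [word] using vert_mul_word_mem (k := k) (Q := Q) i []

theorem arrow_mem (a : E) : arrow k Q a ∈ grading k Q (Q.deg a) := by
  simpa [word] using word_mem (k := k) (Q := Q) [a]

instance : SetLike.GradedMonoid (grading k Q) where
  one_mem := by
    rw [← sum_vert]
    exact Submodule.sum_mem _ fun i _ => vert_mem i
  mul_mem := by
    intro m n x y hx hy
    refine Submodule.span_induction₂ (p := fun x y _ _ => x * y ∈ grading k Q (m + n))
      ?_ ?_ ?_ ?_ ?_ ?_ ?_ hx hy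
    · rintro _ _ ⟨i, l, rfl, rfl⟩ ⟨j, l', rfl, rfl⟩
      have hll : vert k Q i * word k Q (l ++ l') ∈ grading k Q ((l.map Q.deg).sum +
          (l'.map Q.deg).sum) := by
        simpa using vert_mul_word_mem (k := k) (Q := Q) i (l ++ l')
      have e : vert k Q i * word k Q l * (vert k Q j * word k Q l') =
          vert k Q i * (word k Q l * vert k Q j) * word k Q l' := by simp only [mul_assoc]
      rw [e]
      induction l using List.reverseRecOn with
      | nil =>
        by_cases h : i = j
        · subst h
          simpa [word, vert_mul_self] using hll
        · simp [word, vert_mul_of_ne k Q h]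
      | append_singleton l a _ =>
        by_cases h : Q.src a = j
        · subst h
          simpa [word, mul_assoc, mul_src] using hll
        · simp [word, mul_assoc, arrow_mul_of_ne k Q h]
    · simp
    · simp
    · intro x y z _ _ _ h h'
      rw [add_mul]; exact add_mem h h'
    · intro x y z _ _ _ h h'
      rw [mul_add]; exact add_mem h h'
    · intro c x y _ _ h
      rw [smul_mul_assoc]; exact Submodule.smul_mem _ _ h
    · intro c x y _ _ h
      rw [mul_smul_comm]; exact Submodule.smul_mem _ _ h

theorem of_mul_of' {m n p : ℤ} {x y z : PathAlg k Q} (hx : x ∈ grading k Q m)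
    (hy : y ∈ grading k Q n) (hz : z ∈ grading k Q p) (h : m + n = p) (e : x * y = z) :
    DirectSum.of (fun n => grading k Q n) m ⟨x, hx⟩ *
      DirectSum.of (fun n => grading k Q n) n ⟨y, hy⟩ =
      DirectSum.of (fun n => grading k Q n) p ⟨z, hz⟩ := by
  subst h e
  rw [DirectSum.of_mul_of]
  rfl

theorem of_zero' {m : ℤ} (h : (0 : PathAlg k Q) ∈ grading k Q m) :
    DirectSum.of (fun n => grading k Q n) m ⟨0, h⟩ = 0 :=
  map_zero (DirectSum.of (fun n => grading k Q n) m)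

variable (k Q) in
/-- The decomposition of the path algebra into its homogeneous components. -/
def decomp : PathAlg k Q →ₐ[k] ⨁ n, grading k Q n :=
  lift (fun i => DirectSum.of (fun n => grading k Q n) 0 ⟨vert k Q i, vert_mem i⟩)
    (fun a => DirectSum.of (fun n => grading k Q n) (Q.deg a) ⟨arrow k Q a, arrow_mem a⟩)
    (by
      rw [← map_sum, DirectSum.one_def]
      congr 1
      ext
      simp [sum_vert])
    (fun i => of_mul_of' _ _ _ (by simp) (vert_mul_self k Q i))
    (fun i j h => (of_mul_of' _ _ (zero_mem _) (zero_add 0) (vert_mul_of_ne k Q h)).trans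
      (of_zero' _))
    (fun a => of_mul_of' _ _ _ (by simp) (tgt_mul k Q a))
    (fun a => of_mul_of' _ _ _ (by simp) (mul_src k Q a))

theorem decomp_word (l : List E) : decomp k Q (word k Q l) =
    DirectSum.of (fun n => grading k Q n) (l.map Q.deg).sum ⟨word k Q l, word_mem l⟩ := by
  induction l with
  | nil => simp [word]; rfl
  | cons a l ih =>
    have h1 : decomp k Q (word k Q (a :: l)) = decomp k Q (arrow k Q a) * decomp k Q (word k Q l) := by
      rw [← map_mul]; simp [word]
    rw [h1, ih, decomp, lift_arrow]
    exact of_mul_of' _ _ _ (by simp) (by simp [word])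

instance : GradedAlgebra (grading k Q) :=
  GradedAlgebra.ofAlgHom _ (decomp k Q)
    (hom_ext (fun i => by simp [decomp]) (fun a => by simp [decomp]))
    (by
      rintro n ⟨x, hx⟩
      refine Submodule.span_induction (p := fun x hx => decomp k Q x =
        DirectSum.of (fun n => grading k Q n) n ⟨x, hx⟩) ?_ ?_ ?_ ?_ hx
      · rintro _ ⟨i, l, rfl, rfl⟩
        rw [map_mul, decomp_word, decomp, lift_vert]
        exact of_mul_of' _ _ _ (by simp) rfl
      · rw [map_zero]; exact (map_zero _).symm
      · intro x y hx hy h h'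
        rw [map_add, h, h', ← map_add]; rfl
      · intro c x hx h
        rw [map_smul, h, ← DirectSum.lof_eq_of k, ← map_smul]; rfl)

variable (k Q) in
/-- The inclusion of `R = kV`, `r ↦ ∑ i, r i • e_i`. -/
def ofFun : (V → k) →ₐ[k] PathAlg k Q :=
  AlgHom.ofLinearMap
    { toFun := fun r => ∑ i, r i • vert k Q i
      map_add' := fun r r' => by simp [add_smul, Finset.sum_add_distrib]
      map_smul' := fun c r => by simp [Finset.smul_sum, mul_smul] }
    (by simp [sum_vert])
    (fun r r' => by
      classical
      simp only [LinearMap.coe_mk, AddHom.coe_mk, Finset.sum_mul_sum]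
      refine Finset.sum_congr rfl fun i _ => ?_
      rw [Finset.sum_eq_single i]
      · simp [vert_mul_self, smul_smul, mul_comm]
      · intro j _ h
        simp [vert_mul_of_ne k Q h.symm]
      · simp)

/-- The path algebra as a graded algebra over `R = kV`. -/
instance : GrAlg k V (PathAlg k Q) where
  str := ofFun k Q
  deg := grading k Q
  str_mem _ := Submodule.sum_mem _ fun i _ => Submodule.smul_mem _ _ (vert_mem i)

end PathAlg

end PathAlgebra

section PathDerivations

variable {k : Type u} [Field k] {V : Type v} {E : Type w} [Fintype V] {Q : GrQuiver V E}

namespace PathAlg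

theorem induction {p : PathAlg k Q → Prop} (hv : ∀ i, p (vert k Q i)) (ha : ∀ a, p (arrow k Q a))
    (hs : ∀ c : k, p (algebraMap k _ c)) (add : ∀ x y, p x → p y → p (x + y))
    (mul : ∀ x y, p x → p y → p (x * y)) (x) : p x := by
  let S : Subalgebra k (PathAlg k Q) :=
    { carrier := {x | p x}
      add_mem' := fun hx hy => add _ _ hx hy
      mul_mem' := fun hx hy => mul _ _ hx hy
      algebraMap_mem' := hs }
  let L : PathAlg k Q →ₐ[k] S := lift (fun i => ⟨vert k Q i, hv i⟩) (fun a => ⟨arrow k Q a, ha a⟩)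
    (Subtype.ext (by simpa using sum_vert k Q)) (fun i => Subtype.ext (vert_mul_self k Q i))
    (fun i j h => Subtype.ext (vert_mul_of_ne k Q h)) (fun a => Subtype.ext (tgt_mul k Q a))
    (fun a => Subtype.ext (mul_src k Q a))
  have : S.val.comp L = AlgHom.id k _ := hom_ext (fun i => by simp [L]) (fun a => by simp [L])
  have hx := DFunLike.congr_fun this x
  simp only [AlgHom.comp_apply, AlgHom.id_apply] at hx
  rw [← hx]
  exact (L x).2

section Der

variable {B : Type*} [Ring B] [Algebra k B] (f g : PathAlg k Q →ₐ[k] B) (x : E → B)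

/-- The matrix homomorphism `y ↦ !![f y, d y; 0, g y]` that defines the derivation below. -/
def derMat : PathAlg k Q →ₐ[k] Matrix (Fin 2) (Fin 2) B :=
  lift (fun i => !![f (vert k Q i), 0; 0, g (vert k Q i)])
    (fun a => !![f (arrow k Q a), f (vert k Q (Q.tgt a)) * x a * g (vert k Q (Q.src a));
      0, g (arrow k Q a)])
    (by
      have h : ∀ i : V, (!![f (vert k Q i), 0; 0, g (vert k Q i)] : Matrix (Fin 2) (Fin 2) B) =
          Omega.triLin f.toLinearMap 0 g.toLinearMap (vert k Q i) := fun i => by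
        simp [Omega.triLin]
      simp only [h, ← map_sum, sum_vert]
      ext i j
      fin_cases i <;> fin_cases j <;> simp [Omega.triLin])
    (fun i => by
      ext i j
      fin_cases i <;> fin_cases j <;> simp [← map_mul, vert_mul_self])
    (fun i j h => by
      ext i j
      fin_cases i <;> fin_cases j <;> simp [← map_mul, vert_mul_of_ne k Q h])
    (fun a => by
      ext i j
      fin_cases i <;> fin_cases j <;>
        simp [← mul_assoc, ← map_mul, vert_mul_self, tgt_mul])
    (fun a => by
      ext i j
      fin_cases i <;> fin_cases j <;>
        simp [mul_assoc, ← map_mul, vert_mul_self, mul_src])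

/-- The unique linear map `d` with `d (y z) = d y * g z + f y * d z` that vanishes on the constant
paths and sends each arrow `a` to `e_{t(a)} x_a e_{s(a)}`. -/
def der : PathAlg k Q →ₗ[k] B :=
  (Matrix.entryLinearMap k B (0 : Fin 2) (1 : Fin 2)) ∘ₗ (derMat f g x).toLinearMap

theorem derMat_apply (y : PathAlg k Q) : derMat f g x y = !![f y, der f g x y; 0, g y] := by
  have key : ∀ y, derMat f g x y 0 0 = f y ∧ derMat f g x y 1 0 = 0 ∧
      derMat f g x y 1 1 = g y := by
    intro y
    induction y using PathAlg.induction with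
    | hv a => simp [derMat]
    | ha a => simp [derMat]
    | hs c => simp [Matrix.algebraMap_matrix_apply]
    | add x y hx hy => simp [hx, hy]
    | mul x y hx hy => simp [hx, hy, Matrix.mul_apply, Fin.sum_univ_two]
  obtain ⟨k1, k2, k3⟩ := key y
  ext i j
  fin_cases i <;> fin_cases j <;> simp [k1, k2, k3, der]

@[simp]
theorem der_vert (i : V) : der f g x (vert k Q i) = 0 := by simp [der, derMat]

@[simp]
theorem der_arrow (a : E) : der f g x (arrow k Q a) =
    f (vert k Q (Q.tgt a)) * x a * g (vert k Q (Q.src a)) := by simp [der, derMat]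

theorem der_mul (y z : PathAlg k Q) :
    der f g x (y * z) = der f g x y * g z + f y * der f g x z := by
  have h := map_mul (derMat f g x) y z
  have h' := congrFun (congrFun h 0) 1
  simp only [derMat_apply] at h'
  simpa [Matrix.mul_apply, Fin.sum_univ_two, add_comm] using h'

theorem der_algebraMap (c : k) : der f g x (algebraMap k _ c) = 0 := by
  have h : der f g x 1 = 0 := by simpa using der_mul f g x 1 1
  rw [Algebra.algebraMap_eq_smul_one, map_smul, h, smul_zero]

end Der

/-- The homomorphism of path algebras induced by a morphism of quivers that is the identity on
vertices. -/
def map {E' : Type*} {Q' : GrQuiver V E'} (h : E → E') (hsrc : ∀ a, Q'.src (h a) = Q.src a)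
    (htgt : ∀ a, Q'.tgt (h a) = Q.tgt a) : PathAlg k Q →ₐ[k] PathAlg k Q' :=
  lift (vert k Q') (fun a => arrow k Q' (h a)) (sum_vert k Q') (vert_mul_self k Q')
    (fun _ _ hij => vert_mul_of_ne k Q' hij) (fun a => by rw [← htgt, tgt_mul])
    (fun a => by rw [← hsrc, mul_src])

theorem map_vert {E' : Type*} {Q' : GrQuiver V E'} (h : E → E')
    (hsrc : ∀ a, Q'.src (h a) = Q.src a) (htgt : ∀ a, Q'.tgt (h a) = Q.tgt a) (i : V) :
    map (k := k) h hsrc htgt (vert k Q i) = vert k Q' i := by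
  simp [map]

section Cyclic

/-- The double derivation of the path algebra with `a ↦ e_{t(a)} ⊗ e_{s(a)}` that vanishes on
all other arrows. -/
def partialDer [DecidableEq E] (a : E) : PathAlg k Q →ₗ[k] PathAlg k Q ⊗[k] PathAlg k Q :=
  der Algebra.TensorProduct.includeLeft Algebra.TensorProduct.includeRight
    (fun b => if b = a then 1 else 0)

/-- The cyclic derivative with respect to the arrow `a`; see `cyclicDer_word`. -/
def cyclicDer [DecidableEq E] (a : E) : PathAlg k Q →ₗ[k] PathAlg k Q :=
  LinearMap.mul' k _ ∘ₗ (TensorProduct.comm k _ _).toLinearMap ∘ₗ partialDer a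

theorem mul_comm_rotate (z : PathAlg k Q ⊗[k] PathAlg k Q) (y : PathAlg k Q) :
    LinearMap.mul' k _ (TensorProduct.comm k _ _ (z * (1 ⊗ₜ[k] y))) =
      LinearMap.mul' k _ (TensorProduct.comm k _ _ ((y ⊗ₜ[k] 1) * z)) := by
  induction z using TensorProduct.induction_on with
  | zero => simp
  | add z z' h h' => simp only [add_mul, mul_add, map_add, h, h']
  | tmul x x' => simp [mul_assoc]

theorem cyclicDer_mul_comm [DecidableEq E] (a : E) (x y : PathAlg k Q) :
    cyclicDer a (x * y) = cyclicDer a (y * x) := by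
  simp only [cyclicDer, LinearMap.comp_apply, LinearEquiv.coe_coe, partialDer, der_mul, map_add,
    Algebra.TensorProduct.includeLeft_apply, Algebra.TensorProduct.includeRight_apply,
    mul_comm_rotate]
  rw [add_comm]

theorem partialDer_word [DecidableEq E] (a : E) (l : List E) : partialDer (k := k) (Q := Q) a (word k Q l) =
    ∑ j : Fin l.length, if l[j] = a then (word k Q (l.take j) * vert k Q (Q.tgt a)) ⊗ₜ[k]
      (vert k Q (Q.src a) * word k Q (l.drop (j + 1))) else 0 := by
  induction l with
  | nil =>
    have h := der_algebraMap (Q := Q) (Algebra.TensorProduct.includeLeft :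
      _ →ₐ[k] PathAlg k Q ⊗[k] PathAlg k Q) Algebra.TensorProduct.includeRight
      (fun b => if b = a then 1 else 0) 1
    simpa [word, partialDer] using h
  | cons b l ih =>
    have e : word k Q (b :: l) = arrow k Q b * word k Q l := by simp [word]
    have h : partialDer (k := k) (Q := Q) a (arrow k Q b * word k Q l) =
        partialDer a (arrow k Q b) * (1 ⊗ₜ[k] word k Q l) +
          (arrow k Q b ⊗ₜ[k] 1) * partialDer a (word k Q l) := der_mul _ _ _ _ _
    rw [e, h, ih, Finset.mul_sum]
    simp only [List.length_cons]
    rw [Fin.sum_univ_succ]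
    congr 1
    · by_cases hb : b = a
      · subst hb
        simp [partialDer, word]
      · simp [partialDer, hb]
    · refine Finset.sum_congr rfl fun j _ => ?_
      have e' : word k Q (b :: l.take j) = arrow k Q b * word k Q (l.take j) := by simp [word]
      by_cases hb : l[(j : ℕ)] = a
      · simp [hb, e', mul_assoc]
      · simp [hb]

/-- The cyclic derivative of a word `a_n ⋯ a_1` is the sum, over the positions `j` with `a_j = a`,
of `a_{j-1} ⋯ a_1 a_n ⋯ a_{j+1}` (understood as a path from `t(a)` to `s(a)`). -/
theorem cyclicDer_word [DecidableEq E] (a : E) (l : List E) : cyclicDer (k := k) (Q := Q) a (word k Q l) =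
    ∑ j : Fin l.length, if l[j] = a then vert k Q (Q.src a) * word k Q (l.drop (j + 1)) *
      (word k Q (l.take j) * vert k Q (Q.tgt a)) else 0 := by
  simp only [cyclicDer, LinearMap.comp_apply, partialDer_word, map_sum]
  refine Finset.sum_congr rfl fun j _ => ?_
  split_ifs <;> simp

theorem cyclicDer_vert [DecidableEq E] (a : E) (i : V) : cyclicDer a (vert k Q i) = 0 := by
  simp [cyclicDer, partialDer]

end Cyclic

end PathAlg

end PathDerivations

/-! ### Quivers with potential -/

section Potential

variable {V : Type v} {E : Type w}

/-- `Q`, with all arrows in degree `0`. -/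
def FinQuiver.plain (Q : FinQuiver V E) : GrQuiver V E where
  src := Q.src
  tgt := Q.tgt
  deg := 0

/-- The double quiver: `Sum.inl a` is the arrow `a` in degree `0`, `Sum.inr a` is the reverse arrow
`a*` in degree `-1`. -/
def FinQuiver.double (Q : FinQuiver V E) : GrQuiver V (E ⊕ E) where
  src := Sum.elim Q.src Q.tgt
  tgt := Sum.elim Q.tgt Q.src
  deg := Sum.elim 0 (-1)

/-- The double quiver together with the loops `t_i = Sum.inr i` in degree `-2`. -/
def FinQuiver.hat (Q : FinQuiver V E) : GrQuiver V ((E ⊕ E) ⊕ V) where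
  src := Sum.elim Q.double.src id
  tgt := Sum.elim Q.double.tgt id
  deg := Sum.elim Q.double.deg (-2)

variable (k : Type u) [Field k] [Fintype V] (Q : FinQuiver V E)

/-- The subspace `[kQ, kQ]`. -/
def commutators : Submodule k (PathAlg k Q.plain) :=
  Submodule.span k {z | ∃ x y, z = x * y - y * x}

/-- Potentials: the elements of `kQ / [kQ, kQ]`. -/
abbrev Potential : Type _ := PathAlg k Q.plain ⧸ commutators k Q

/-- The class of an element of `kQ` in `kQ / [kQ, kQ]`. -/
abbrev Potential.mk : PathAlg k Q.plain →ₗ[k] Potential k Q := (commutators k Q).mkQ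

/-- The inclusion of `kQ` into the path algebra of the double quiver. -/
def toDouble : PathAlg k Q.plain →ₐ[k] PathAlg k Q.double :=
  PathAlg.map Sum.inl (fun _ => rfl) (fun _ => rfl)

/-- The inclusion of `kQ` into the path algebra of `Q.hat`. -/
def toHat : PathAlg k Q.plain →ₐ[k] PathAlg k Q.hat :=
  PathAlg.map (fun a => Sum.inl (Sum.inl a)) (fun _ => rfl) (fun _ => rfl)

variable {k Q} in
/-- The derivative `∂W/∂a` of a potential. -/
def Potential.deriv [DecidableEq E] (a : E) : Potential k Q →ₗ[k] PathAlg k Q.plain :=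
  (commutators k Q).liftQ (PathAlg.cyclicDer a) (by
    rw [commutators, Submodule.span_le]
    rintro _ ⟨x, y, rfl⟩
    simp [PathAlg.cyclicDer_mul_comm a x y])

/-- The arrow `a`, in the path algebra of the double quiver. -/
def arr (a : E) : PathAlg k Q.double := PathAlg.arrow k Q.double (Sum.inl a)

/-- The arrow `a*`, in the path algebra of the double quiver. -/
def arrStar (a : E) : PathAlg k Q.double := PathAlg.arrow k Q.double (Sum.inr a)

/-- The arrow `a`, in `Γ`. -/
def hatArr (a : E) : PathAlg k Q.hat := PathAlg.arrow k Q.hat (Sum.inl (Sum.inl a))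

/-- The arrow `a*`, in `Γ`. -/
def hatStar (a : E) : PathAlg k Q.hat := PathAlg.arrow k Q.hat (Sum.inl (Sum.inr a))

/-- The loop `t_i`, in `Γ`. -/
def hatLoop (i : V) : PathAlg k Q.hat := PathAlg.arrow k Q.hat (Sum.inr i)

variable [Fintype E]

variable {k Q} in
/-- The differential of `Γ_{Q,W}`, the path algebra of `Q.hat`: the super-derivation of degree `1` over
`R` with `a ↦ 0`, `a* ↦ ∂W/∂a` and `t_i ↦ e_i (∑ [a, a*]) e_i`. -/
def gammaD [DecidableEq E] (W : Potential k Q) : PathAlg k Q.hat →ₗ[k] PathAlg k Q.hat :=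
  PathAlg.der (twist k V (PathAlg k Q.hat) 1) (AlgHom.id k _)
    (Sum.elim (Sum.elim 0 fun a => toHat k Q (W.deriv a))
      fun _ => ∑ a, (hatArr k Q a * hatStar k Q a - hatStar k Q a * hatArr k Q a))

/-- The two-form `ω = ∑ D(a*) D(a)` on the path algebra of the double quiver. -/
def quiverForm : DR k V (PathAlg k Q.double) :=
  DR.mk k V _ (∑ a, Omega.dA k V _ (arrStar k Q a) * Omega.dA k V _ (arr k Q a))

/-- The element `w = ∑ [a, a*]` of the path algebra of the double quiver. -/
def quiverMoment : PathAlg k Q.double :=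
  ∑ a, (arr k Q a * arrStar k Q a - arrStar k Q a * arr k Q a)

end Potential

/-! ### The values of the differential on generators -/

section Values

variable {V : Type v} {E : Type w} {k : Type u} [Field k] [Fintype V]

theorem PathAlg.twist_vert {Q : GrQuiver V E} (n : ℤ) (i : V) :
    twist k V (PathAlg k Q) n (PathAlg.vert k Q i) = PathAlg.vert k Q i := by
  rw [twist_of_mem n (m := 0) (PathAlg.vert_mem i)]; simp

variable [DecidableEq E]

theorem PathAlg.cyclicDer_sandwich {Q : GrQuiver V E} (a : E) (x : PathAlg k Q) :
    vert k Q (Q.src a) * cyclicDer a x * vert k Q (Q.tgt a) = cyclicDer a x := by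
  let K : PathAlg k Q ⊗[k] PathAlg k Q →ₗ[k] PathAlg k Q ⊗[k] PathAlg k Q :=
    TensorProduct.map (LinearMap.mulRight k (vert k Q (Q.tgt a)))
      (LinearMap.mulLeft k (vert k Q (Q.src a)))
  have hr : ∀ z y, K (z * (1 ⊗ₜ[k] y)) = K z * (1 ⊗ₜ[k] y) := by
    intro z y
    induction z using TensorProduct.induction_on with
    | zero => simp
    | add z z' h h' => simp only [add_mul, map_add, h, h']
    | tmul x x' => simp [K, mul_assoc]
  have hl : ∀ z y, K ((y ⊗ₜ[k] 1) * z) = (y ⊗ₜ[k] 1) * K z := by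
    intro z y
    induction z using TensorProduct.induction_on with
    | zero => simp
    | add z z' h h' => simp only [mul_add, map_add, h, h']
    | tmul x x' => simp [K, mul_assoc]
  have hK : K (partialDer a x) = partialDer a x := by
    induction x using PathAlg.induction with
    | hv i => simp [partialDer]
    | ha b =>
      by_cases hb : b = a
      · subst hb; simp [partialDer, K, vert_mul_self]
      · simp [partialDer, hb]
    | hs c => simp [partialDer, der_algebraMap]
    | add x y hx hy => simp only [map_add, hx, hy]
    | mul x y hx hy =>
      have h : partialDer (k := k) (Q := Q) a (x * y) =
        partialDer a x * (1 ⊗ₜ[k] y) + (x ⊗ₜ[k] 1) * partialDer a y := der_mul _ _ _ _ _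
      rw [h, map_add, hr, hl, hx, hy]
  have hm : ∀ z, LinearMap.mul' k _ (TensorProduct.comm k _ _ (K z)) = vert k Q (Q.src a) *
      LinearMap.mul' k _ (TensorProduct.comm k _ _ z) * vert k Q (Q.tgt a) := by
    intro z
    induction z using TensorProduct.induction_on with
    | zero => simp
    | add z z' h h' => simp only [mul_add, add_mul, map_add, h, h']
    | tmul x x' => simp [K, mul_assoc]
  have h := hm (partialDer a x)
  rw [hK] at h
  exact h.symm

variable {Q : FinQuiver V E} [Fintype E] (W : Potential k Q)

theorem gammaD_arr (a : E) : gammaD W (hatArr k Q a) = 0 :=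
  (PathAlg.der_arrow _ _ _ _).trans (by simp)

theorem gammaD_star (a : E) : gammaD W (hatStar k Q a) = toHat k Q (W.deriv a) := by
  refine (PathAlg.der_arrow _ _ _ _).trans ?_
  rw [PathAlg.twist_vert]
  obtain ⟨x, rfl⟩ := Submodule.mkQ_surjective _ W
  have h1 : ∀ i, PathAlg.vert k Q.hat i = toHat k Q (PathAlg.vert k Q.plain i) := fun i =>
    (PathAlg.map_vert _ _ _ i).symm
  have h := congrArg (toHat k Q) (PathAlg.cyclicDer_sandwich (Q := Q.plain) a x)
  rw [map_mul, map_mul, ← h1, ← h1] at h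
  exact h

theorem gammaD_loop (i : V) : gammaD W (hatLoop k Q i) = PathAlg.vert k Q.hat i *
    (∑ a, (hatArr k Q a * hatStar k Q a - hatStar k Q a * hatArr k Q a)) *
      PathAlg.vert k Q.hat i := by
  refine (PathAlg.der_arrow _ _ _ _).trans ?_
  rw [PathAlg.twist_vert]
  rfl

end Values
end NCForms

end

/-!
On the path algebra of a quiver everything is determined by the arrows: a derivation that vanishes
on the constant paths is given by arbitrary values on the arrows `b`, subject to
`e_{t(b)} d(b) e_{s(b)} = d(b)`, and `Ω¹` is the direct sum of the bimodules
`A e_{t(b)} D(b) e_{s(b)} A`. Since `ω = ∑ D(a*) D(a)` pairs every arrow `b` of the double quiver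
with its reverse `b'`, contraction with `ω` sends `θ` to `∑ ± θ(b') D(b)`, and a double derivation
`λ` to the one-form whose `D(b)`-coordinate is `±λ(b')` with its two factors exchanged. This gives
both nondegeneracy statements. With `λ = δ` it gives `ι_δ ω = D w`, and with `D W = ∑ (∂W/∂a) D(a)`
it identifies `{W, -}` as the derivation `ξ` with `a ↦ 0` and `a* ↦ ∂W/∂a`.

As `ξ` takes its values on the arrows in `kQ`, on which it vanishes, `ξ² = 0`. The identity
`ξ(w) = 0` is `∑ [a, ∂W/∂a] = 0`, which says that moving the last arrow of a cycle to its front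
does not change the sum of its rotations. An element `t` that commutes with the constant paths is
the same as one loop `t_i = e_i t` at each vertex, which identifies `A *_R R[t]` with the path
algebra of `Q.hat`.
-/

noncomputable section

namespace NCForms

universe u v w

/-! ### Derivations and graded algebras -/

section Derivations

variable {k A B C : Type*} [Field k] [Ring A] [Algebra k A] [Ring B] [Algebra k B]
  [Ring C] [Algebra k C]

/-- `d` is a derivation from `A` to `B`, where `A` acts on `B` from the left through `f` and from
the right through `g`. Super-derivations and double derivations are of this form, with the signs
absorbed in `f`. -/
def IsDerivationAlong (f g : A →ₐ[k] B) (d : A →ₗ[k] B) : Prop :=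
  ∀ x y, d (x * y) = d x * g y + f x * d y

namespace IsDerivationAlong

variable {f g : A →ₐ[k] B} {d : A →ₗ[k] B}

theorem map_one (hd : IsDerivationAlong f g d) : d 1 = 0 := by
  simpa using hd 1 1

theorem map_algebraMap (hd : IsDerivationAlong f g d) (c : k) : d (algebraMap k A c) = 0 := by
  rw [Algebra.algebraMap_eq_smul_one, map_smul, hd.map_one, smul_zero]

theorem algHom_comp (hd : IsDerivationAlong f g d) (φ : B →ₐ[k] C) :
    IsDerivationAlong (φ.comp f) (φ.comp g) (φ.toLinearMap ∘ₗ d) := fun x y => by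
  simp [hd x y]

theorem comp_algHom (hd : IsDerivationAlong f g d) (ψ : C →ₐ[k] A) :
    IsDerivationAlong (f.comp ψ) (g.comp ψ) (d ∘ₗ ψ.toLinearMap) := fun x y => by
  simp [hd (ψ x) (ψ y)]

theorem sum {ι : Type*} {s : Finset ι} {δ : ι → A →ₗ[k] B}
    (h : ∀ i ∈ s, IsDerivationAlong f g (δ i)) : IsDerivationAlong f g (∑ i ∈ s, δ i) := by
  intro x y
  simp only [LinearMap.sum_apply, Finset.sum_mul, Finset.mul_sum, ← Finset.sum_add_distrib]
  exact Finset.sum_congr rfl fun i hi => h i hi x y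

end IsDerivationAlong

/-- The linear map `p ⊗ q ↦ f p * b * g q`. -/
def sandwich (f g : A →ₐ[k] B) (b : B) : A ⊗[k] A →ₗ[k] B :=
  LinearMap.mul' k B ∘ₗ TensorProduct.map (LinearMap.mulRight k b ∘ₗ f.toLinearMap) g.toLinearMap

@[simp]
theorem sandwich_tmul (f g : A →ₐ[k] B) (b : B) (p q : A) :
    sandwich f g b (p ⊗ₜ[k] q) = f p * b * g q := rfl

theorem sandwich_sub (f g : A →ₐ[k] B) (b b' : B) :
    sandwich f g (b - b') = sandwich f g b - sandwich f g b' := by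
  ext p q
  simp [mul_sub, sub_mul]

theorem sandwich_mul (f g : A →ₐ[k] B) (b : B) (p q : A) (t : A ⊗[k] A) :
    sandwich f g b ((p ⊗ₜ[k] 1) * t * (1 ⊗ₜ[k] q)) = f p * sandwich f g b t * g q := by
  induction t with
  | zero => simp
  | add t t' h h' => simp only [mul_add, add_mul, map_add, h, h']
  | tmul x y => simp [mul_assoc]

theorem sandwich_tmul_one_mul (f g : A →ₐ[k] B) (b : B) (p : A) (t : A ⊗[k] A) :
    sandwich f g b ((p ⊗ₜ[k] 1) * t) = f p * sandwich f g b t := by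
  simpa [← Algebra.TensorProduct.one_def] using sandwich_mul f g b p 1 t

theorem sandwich_mul_one_tmul (f g : A →ₐ[k] B) (b : B) (q : A) (t : A ⊗[k] A) :
    sandwich f g b (t * (1 ⊗ₜ[k] q)) = sandwich f g b t * g q := by
  simpa [← Algebra.TensorProduct.one_def] using sandwich_mul f g b 1 q t

theorem IsDerivationAlong.sandwich {d : A →ₗ[k] A ⊗[k] A}
    (hd : IsDerivationAlong Algebra.TensorProduct.includeLeft Algebra.TensorProduct.includeRight d)
    (f g : A →ₐ[k] B) (b : B) : IsDerivationAlong f g (sandwich f g b ∘ₗ d) := fun x y => by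
  rw [LinearMap.comp_apply, hd, map_add, Algebra.TensorProduct.includeRight_apply,
    Algebra.TensorProduct.includeLeft_apply, sandwich_mul_one_tmul, sandwich_tmul_one_mul]
  rfl

end Derivations

section Graded

variable {k : Type u} {I : Type v} {A : Type w} [Field k] [Ring A] [Algebra k A] [GrAlg k I A]

theorem linearMap_ext_of_mem_deg {X : Type*} [AddCommGroup X] [Module k X] {f g : A →ₗ[k] X}
    (h : ∀ n, ∀ a ∈ deg k I A n, f a = g a) : f = g := by
  ext a
  induction a using DirectSum.Decomposition.inductionOn (deg k I A) with
  | zero => simp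
  | homogeneous a => exact h _ _ a.2
  | add a b ha hb => simp only [map_add, ha, hb]

theorem linearMap_ext_of_tmul_mem_deg {X : Type*} [AddCommGroup X] [Module k X]
    {f g : A ⊗[k] A →ₗ[k] X}
    (h : ∀ i j, ∀ x ∈ deg k I A i, ∀ y ∈ deg k I A j, f (x ⊗ₜ[k] y) = g (x ⊗ₜ[k] y)) : f = g :=
  TensorProduct.ext <| linearMap_ext_of_mem_deg (I := I) fun i x hx =>
    linearMap_ext_of_mem_deg (I := I) fun j y hy => h i j x hx y hy

theorem one_mem_deg : (1 : A) ∈ deg k I A 0 := SetLike.GradedOne.one_mem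

theorem mul_mem_deg {m n : ℤ} {a b : A} (ha : a ∈ deg k I A m) (hb : b ∈ deg k I A n) :
    a * b ∈ deg k I A (m + n) := SetLike.mul_mem_graded ha hb

theorem twist_twist (n : ℤ) (a : A) : twist k I A n (twist k I A n a) = a := by
  rcases Int.even_or_odd n with hn | hn
  · simp [twist_even hn]
  · rw [twist_odd hn, twist_one_twist_one]

theorem twist_mem (n : ℤ) {m : ℤ} {a : A} (ha : a ∈ deg k I A m) :
    twist k I A n a ∈ deg k I A m := by
  rw [twist_of_mem n ha]
  exact Submodule.smul_mem _ _ ha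

theorem map_twist {J : Type*} {B : Type*} [Ring B] [Algebra k B] [GrAlg k J B] (φ : A →ₐ[k] B)
    (hφ : ∀ m, ∀ a ∈ deg k I A m, φ a ∈ deg k J B m) (n : ℤ) (a : A) :
    φ (twist k I A n a) = twist k J B n (φ a) := by
  induction a using DirectSum.Decomposition.inductionOn (deg k I A) with
  | zero => simp
  | homogeneous a => rw [twist_of_mem n a.2, twist_of_mem n (hφ _ _ a.2), map_smul]
  | add a b ha hb => simp only [map_add, ha, hb]

theorem tmul_mem_degTen {m n : ℤ} {a b : A} (ha : a ∈ deg k I A m) (hb : b ∈ deg k I A n) :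
    a ⊗ₜ[k] b ∈ degTen k I A (m + n) :=
  Submodule.subset_span ⟨m, n, rfl, a, ha, b, hb, rfl⟩

theorem one_mem_degTen : (1 : A ⊗[k] A) ∈ degTen k I A 0 := by
  simpa [Algebra.TensorProduct.one_def] using
    tmul_mem_degTen (one_mem_deg (k := k) (I := I) (A := A)) one_mem_deg

theorem mul_mem_degTen {m n : ℤ} {s t : A ⊗[k] A} (hs : s ∈ degTen k I A m)
    (ht : t ∈ degTen k I A n) : s * t ∈ degTen k I A (m + n) := by
  have h : s * t ∈ degTen k I A m * degTen k I A n := Submodule.mul_mem_mul hs ht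
  rw [degTen, degTen, Submodule.span_mul_span] at h
  refine Submodule.span_le.2 ?_ h
  rintro _ ⟨_, ⟨i, j, rfl, x, hx, y, hy, rfl⟩, _, ⟨i', j', rfl, x', hx', y', hy', rfl⟩, rfl⟩
  have hmem := tmul_mem_degTen (mul_mem_deg hx hx') (mul_mem_deg hy hy')
  rwa [show i + i' + (j + j') = i + j + (i' + j') by ring,
    ← Algebra.TensorProduct.tmul_mul_tmul] at hmem

theorem isDerivationAlong_of_mem_sder {n : ℤ} {θ : A →ₗ[k] A} (hθ : θ ∈ sder k I A n) :
    IsDerivationAlong (twist k I A n) (AlgHom.id k A) θ := sder_mul hθ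

theorem isDerivationAlong_of_mem_dder {n : ℤ} {μ : A →ₗ[k] A ⊗[k] A} (hμ : μ ∈ dder k I A n) :
    IsDerivationAlong (Algebra.TensorProduct.includeLeft.comp (twist k I A n))
      Algebra.TensorProduct.includeRight μ := dder_mul hμ

theorem mem_sder_of_isDerivationAlong {n : ℤ} {θ : A →ₗ[k] A}
    (hθ : IsDerivationAlong (twist k I A n) (AlgHom.id k A) θ)
    (hR : ∀ r, θ (str k I A r) = 0)
    (hdeg : ∀ m, ∀ a ∈ deg k I A m, θ a ∈ deg k I A (m + n)) : θ ∈ sder k I A n :=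
  ⟨hR, hdeg, fun m a ha b => by rw [hθ, twist_of_mem n ha, smul_mul_assoc, AlgHom.id_apply]⟩

theorem mem_dder_of_isDerivationAlong {n : ℤ} {μ : A →ₗ[k] A ⊗[k] A}
    (hμ : IsDerivationAlong (Algebra.TensorProduct.includeLeft.comp (twist k I A n))
      Algebra.TensorProduct.includeRight μ)
    (hR : ∀ r, μ (str k I A r) = 0)
    (hdeg : ∀ m, ∀ a ∈ deg k I A m, μ a ∈ degTen k I A (m + n)) : μ ∈ dder k I A n :=
  ⟨hR, hdeg, fun m a ha b => by
    rw [hμ, AlgHom.comp_apply, twist_of_mem n ha, map_smul, smul_mul_assoc]; rfl⟩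

theorem iSupIndep_deg : iSupIndep (deg k I A) :=
  (DirectSum.Decomposition.isInternal (deg k I A)).submodule_iSupIndep

theorem iSupIndep_of_projections {X : Type*} [AddCommGroup X] [Module k X] {D : ℤ → Submodule k X}
    (π : ℤ → X →ₗ[k] X) (hπ : ∀ n, ∀ x ∈ D n, π n x = x)
    (hπ' : ∀ m n, m ≠ n → ∀ x ∈ D m, π n x = 0) : iSupIndep D := by
  intro n
  have hker : ⨆ m, ⨆ (_ : m ≠ n), D m ≤ LinearMap.ker (π n) :=
    iSup₂_le fun m hm x hx => hπ' m n hm x hx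
  rw [Submodule.disjoint_def]
  intro x hx hx'
  rw [← hπ n x hx]
  exact hker hx'

variable (k I A) in
/-- The projection of `A ⊗ A` to its component of total degree `n`: it sends `x ⊗ y`, for `x` of
degree `i`, to `x ⊗ y'` with `y'` the component of `y` of degree `n - i`. -/
def degTenProj (n : ℤ) : A ⊗[k] A →ₗ[k] A ⊗[k] A :=
  TensorProduct.lift <|
    (DirectSum.toModule k ℤ (A →ₗ[k] A ⊗[k] A) fun i =>
      (TensorProduct.mk k A A).compl₂ (GradedAlgebra.proj (deg k I A) (n - i)) ∘ₗ
        (deg k I A i).subtype) ∘ₗ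
      (DirectSum.decomposeLinearEquiv (deg k I A)).toLinearMap

theorem degTenProj_tmul {n i : ℤ} {x : A} (hx : x ∈ deg k I A i) (y : A) :
    degTenProj k I A n (x ⊗ₜ[k] y) =
      x ⊗ₜ[k] (DirectSum.decompose (deg k I A) y (n - i) : A) := by
  simp only [degTenProj, TensorProduct.lift.tmul, LinearMap.comp_apply, LinearEquiv.coe_coe,
    DirectSum.decomposeLinearEquiv_apply, DirectSum.decompose_of_mem _ hx]
  rw [← DirectSum.lof_eq_of k, DirectSum.toModule_lof]
  simp [GradedAlgebra.proj_apply]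

theorem iSupIndep_degTen : iSupIndep (degTen k I A) := by
  refine iSupIndep_of_projections (degTenProj k I A) (fun n t ht => ?_) fun m n hmn t ht => ?_
  · refine LinearMap.eqOn_span (g := LinearMap.id) ?_ ht
    rintro _ ⟨i, j, rfl, x, hx, y, hy, rfl⟩
    rw [degTenProj_tmul hx, add_sub_cancel_left, DirectSum.decompose_of_mem_same _ hy]
    rfl
  · refine LinearMap.eqOn_span (g := 0) ?_ ht
    rintro _ ⟨i, j, rfl, x, hx, y, hy, rfl⟩
    rw [degTenProj_tmul hx, DirectSum.decompose_of_mem_ne _ hy (by omega), TensorProduct.tmul_zero]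
    rfl

theorem component_apply_eq {X : Type*} [AddCommGroup X] [Module k X]
    {S : ℤ → Submodule k (A →ₗ[k] X)} {D : ℤ → Submodule k X} (hD : iSupIndep D) {a : A} {m : ℤ}
    (hS : ∀ n, ∀ θ ∈ S n, θ a ∈ D (m + n)) {z z' : ⨁ n, S n}
    (h : DirectSum.coeLinearMap S z a = DirectSum.coeLinearMap S z' a) (n : ℤ) :
    (z n : A →ₗ[k] X) a = (z' n : A →ₗ[k] X) a := by
  let ev (n : ℤ) : S n →ₗ[k] D (m + n) :=
    (LinearMap.applyₗ a ∘ₗ (S n).subtype).codRestrict _ fun θ => hS n θ θ.2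
  have hev (y : ⨁ n, S n) : DirectSum.coeLinearMap (fun n => D (m + n)) (DirectSum.lmap ev y) =
      DirectSum.coeLinearMap S y a := by
    induction y using DirectSum.induction_on with
    | zero => simp
    | add y y' h h' => simp only [map_add, LinearMap.add_apply, h, h']
    | of n θ =>
      rw [← DirectSum.lof_eq_of k, DirectSum.lmap_lof, DirectSum.coeLinearMap_lof,
        DirectSum.coeLinearMap_lof]
      rfl
  have hinj := (hD.comp (add_right_injective m)).dfinsupp_lsum_injective
  rw [← hev z, ← hev z'] at h
  exact congrArg Subtype.val (DFunLike.congr_fun (hinj h) n)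

namespace Omega

variable {B : Type*} [Ring B] [Algebra k B]

section OneFormLift

variable (f g : A →ₐ[k] B) (d : A →ₗ[k] B) (hd : IsDerivationAlong f g d)
  (hR : ∀ r, d (str k I A r) = 0)

/-- The linear map `Ω_R A → B` with `p (D x) q ↦ f p * d x * g q` on one-forms, for a derivation
`d` along `f`, `g`; it vanishes on the forms of degree different from `1`. -/
def oneFormLift : Omega k I A →ₗ[k] B :=
  Matrix.entryLinearMap k B (0 : Fin 2) (1 : Fin 2) ∘ₗ
    (lift (triAlg f g 0 (by simp)) (triLin 0 d 0)
      (fun a b => by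
        ext i j
        fin_cases i <;> fin_cases j <;> simp [triAlg, triLin, hd a b])
      (fun r => by
        ext i j
        fin_cases i <;> fin_cases j <;> simp [triLin, hR])).toLinearMap

theorem oneFormLift_mul_mul (p : A) (η : Omega k I A) (q : A) :
    oneFormLift f g d hd hR (inA k I A p * η * inA k I A q) =
      f p * oneFormLift f g d hd hR η * g q := by
  simp only [oneFormLift, LinearMap.comp_apply, AlgHom.toLinearMap_apply, map_mul, lift_inA,
    Matrix.entryLinearMap_apply, Matrix.mul_apply, Fin.sum_univ_two]
  simp [triAlg, triLin]

theorem oneFormLift_dA (x : A) : oneFormLift f g d hd hR (dA k I A x) = d x := by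
  simp [oneFormLift, triLin]

end OneFormLift

theorem isDerivationAlong_dA : IsDerivationAlong (inA k I A) (inA k I A) (dA k I A) :=
  fun a b => dA_mul k I A a b

end Omega
end Graded

/-! ### Forms -/

section Forms

variable {k : Type u} {I : Type v} {A : Type w} [Field k] [Ring A] [Algebra k A] [GrAlg k I A]

namespace Omega

theorem inOne_smul (p q : A) (η : Omega1 k I A) :
    inOne k I A ((p ⊗ₜ[k] MulOpposite.op q : Env k A) • η) =
      inA k I A p * inOne k I A η * inA k I A q :=
  BimodTA.inM_smul k A _ p q η

theorem sandwich_dA_mem_oneForms (x : A) (t : A ⊗[k] A) :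
    sandwich (inA k I A) (inA k I A) (dA k I A x) t ∈ oneForms k I A := by
  induction t with
  | zero => rw [map_zero]; exact zero_mem _
  | add t t' h h' => rw [map_add]; exact add_mem h h'
  | tmul p q => exact ⟨(p ⊗ₜ[k] MulOpposite.op q : Env k A) • dOne k I A x, inOne_smul p q _⟩

theorem oneForms_le {S : Submodule k (Omega k I A)}
    (h : ∀ x y, dA k I A x * inA k I A y ∈ S) : oneForms k I A ≤ S := by
  rintro _ ⟨η, rfl⟩
  induction η using omega1_induction with
  | add η η' hη hη' => rw [map_add]; exact add_mem hη hη'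
  | zero => rw [map_zero]; exact zero_mem S
  | mem x y =>
    rw [inOne_smul, map_one, one_mul]
    exact h x y

/-- The bimodule homomorphism `Ω¹_R A → A ⊗ A`, `D x ↦ d x`, for a double derivation `d` (without
signs), with `A ⊗ A` identified with the enveloping algebra. -/
def doubleDerHom (d : A →ₗ[k] A ⊗[k] A)
    (hd : IsDerivationAlong Algebra.TensorProduct.includeLeft Algebra.TensorProduct.includeRight d)
    (hR : ∀ r, d (str k I A r) = 0) : Omega1 k I A →ₗ[Env k A] Env k A where
  toFun η := (MulOpposite.opLinearEquiv k).toLinearMap.lTensor A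
    (oneFormLift _ _ d hd hR (inOne k I A η))
  map_add' η η' := by simp only [map_add]
  map_smul' z η := by
    induction z using TensorProduct.induction_on with
    | zero =>
      exact (congrArg (fun ζ => (MulOpposite.opLinearEquiv k).toLinearMap.lTensor A
        (oneFormLift _ _ d hd hR (inOne k I A ζ))) (zero_smul (Env k A) η)).trans (by simp)
    | add z z' h h' => simp only [RingHom.id_apply] at h h' ⊢; simp only [add_smul, map_add, h, h']
    | tmul p q =>
      have hmul (t : A ⊗[k] A) : (MulOpposite.opLinearEquiv k).toLinearMap.lTensor A
          ((p ⊗ₜ[k] 1) * t * (1 ⊗ₜ[k] q.unop)) =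
          (p ⊗ₜ[k] q : Env k A) * (MulOpposite.opLinearEquiv k).toLinearMap.lTensor A t := by
        induction t with
        | zero => simp
        | add t t' h h' => simp only [mul_add, add_mul, map_add, h, h']
        | tmul x y => simp
      rw [← MulOpposite.op_unop q, inOne_smul, oneFormLift_mul_mul]
      exact hmul _

theorem doubleDerHom_dOne (d : A →ₗ[k] A ⊗[k] A)
    (hd : IsDerivationAlong Algebra.TensorProduct.includeLeft Algebra.TensorProduct.includeRight d)
    (hR : ∀ r, d (str k I A r) = 0) (x : A) : doubleDerHom d hd hR (dOne k I A x) =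
      (MulOpposite.opLinearEquiv k).toLinearMap.lTensor A (d x) :=
  congrArg _ (oneFormLift_dA _ _ d hd hR x)

@[simp] theorem D_inA (a : A) : D k I A (inA k I A a) = dA k I A a := by simp [D]
@[simp] theorem D_dA (a : A) : D k I A (dA k I A a) = 0 := by simp [D]

@[simp]
theorem contr_dA {n : ℤ} (θ : sder k I A n) (a : A) :
    contr θ (dA k I A a) = inA k I A (θ.1 a) := by simp [contr]

@[simp]
theorem lie_dA {n : ℤ} (θ : sder k I A n) (a : A) :
    lie θ (dA k I A a) = dA k I A (θ.1 a) := by simp [lie]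

variable (k I A) in
/-- The projection of `Ω_R A` to `A`. -/
def toA : Omega k I A →ₐ[k] A := lift (AlgHom.id k A) 0 (by simp) (by simp)

@[simp] theorem toA_inA (a : A) : toA k I A (inA k I A a) = a := lift_inA _ _ _ _ a

theorem inA_injective : Function.Injective (inA k I A) :=
  Function.LeftInverse.injective toA_inA

end Omega

section KoszulSwap

variable (k I A) in
/-- The signed swap `x ⊗ y ↦ (-1) ^ (i * (j + m)) • y ⊗ x` of `A ⊗ A`, for `x` of degree `i` and
`y` of degree `j`. The sign is that of moving `x` past `y` and an element of degree `m`. -/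
def koszulSwap (m : ℤ) : A ⊗[k] A →ₗ[k] A ⊗[k] A :=
  TensorProduct.map (Omega.toA k I A).toLinearMap (Omega.toA k I A).toLinearMap ∘ₗ
    Omega.flip k I A ∘ₗ TensorProduct.map
      ((Omega.inA k I A).toLinearMap ∘ₗ (twist k I A m).toLinearMap) (Omega.inA k I A).toLinearMap

variable [CharZero k]

theorem koszulSwap_tmul (m : ℤ) {i j : ℤ} {x y : A} (hx : x ∈ deg k I A i)
    (hy : y ∈ deg k I A j) :
    koszulSwap k I A m (x ⊗ₜ[k] y) = ((-1 : k) ^ (i * (j + m))) • y ⊗ₜ[k] x := by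
  simp only [koszulSwap, LinearMap.comp_apply, TensorProduct.map_tmul, AlgHom.toLinearMap_apply,
    twist_of_mem m hx, map_smul, ← TensorProduct.smul_tmul',
    Omega.flip_tmul (Omega.par_inA_of_mem hx) (Omega.par_inA_of_mem hy), Omega.toA_inA, smul_smul,
    sign_mul]
  congr 2
  ring

theorem koszulSwap_koszulSwap (m : ℤ) (t : A ⊗[k] A) :
    koszulSwap k I A m (koszulSwap k I A m t) =
      Algebra.TensorProduct.map (twist k I A m) (twist k I A m) t := by
  refine LinearMap.congr_fun (f := koszulSwap k I A m ∘ₗ koszulSwap k I A m)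
    (g := (Algebra.TensorProduct.map (twist k I A m) (twist k I A m)).toLinearMap)
    (linearMap_ext_of_tmul_mem_deg (I := I) fun i j x hx y hy => ?_) t
  rw [LinearMap.comp_apply, koszulSwap_tmul m hx hy, map_smul, koszulSwap_tmul m hy hx, smul_smul,
    sign_mul, AlgHom.toLinearMap_apply, Algebra.TensorProduct.map_tmul, twist_of_mem m hx,
    twist_of_mem m hy, TensorProduct.smul_tmul_smul, sign_mul,
    sign_congr k (b := m * i + m * j) ⟨i * j, by ring⟩]

theorem koszulSwap_injective (m : ℤ) : Function.Injective (koszulSwap k I A m) := by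
  have htwist : (twist k I A m).comp (twist k I A m) = AlgHom.id k A :=
    AlgHom.ext (twist_twist m)
  refine Function.LeftInverse.injective (g := fun t => Algebra.TensorProduct.map (twist k I A m)
    (twist k I A m) (koszulSwap k I A m t)) fun t => ?_
  beta_reduce
  rw [koszulSwap_koszulSwap, ← AlgHom.comp_apply, ← Algebra.TensorProduct.map_comp, htwist,
    Algebra.TensorProduct.map_id, AlgHom.id_apply]

theorem koszulSwap_mul_mul {m : ℤ} {e e' : A} (he : e ∈ deg k I A 0) (he' : e' ∈ deg k I A 0)
    (t : A ⊗[k] A) : koszulSwap k I A m ((e ⊗ₜ[k] 1) * t * (1 ⊗ₜ[k] e')) =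
      (1 ⊗ₜ[k] e) * koszulSwap k I A m t * (e' ⊗ₜ[k] 1) := by
  refine LinearMap.congr_fun (f := koszulSwap k I A m ∘ₗ LinearMap.mulRight k (1 ⊗ₜ[k] e') ∘ₗ
    LinearMap.mulLeft k (e ⊗ₜ[k] 1)) (g := LinearMap.mulRight k (e' ⊗ₜ[k] 1) ∘ₗ
    LinearMap.mulLeft k (1 ⊗ₜ[k] e) ∘ₗ koszulSwap k I A m)
    (linearMap_ext_of_tmul_mem_deg (I := I) fun i j x hx y hy => ?_) t
  have hex : e * x ∈ deg k I A i := by simpa using mul_mem_deg he hx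
  have hye : y * e' ∈ deg k I A j := by simpa using mul_mem_deg hy he'
  simp only [LinearMap.comp_apply, LinearMap.mulLeft_apply, LinearMap.mulRight_apply,
    Algebra.TensorProduct.tmul_mul_tmul, one_mul, mul_one, koszulSwap_tmul m hex hye,
    koszulSwap_tmul m hx hy, mul_smul_comm, smul_mul_assoc]

end KoszulSwap

namespace Omega

theorem map_sgn_map_inA (t : A ⊗[k] A) : Algebra.TensorProduct.map (sgn k I A 1) (sgn k I A 1)
    (Algebra.TensorProduct.map (inA k I A) (inA k I A) t) =
      Algebra.TensorProduct.map (inA k I A) (inA k I A)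
        (Algebra.TensorProduct.map (twist k I A 1) (twist k I A 1) t) := by
  induction t with
  | zero => simp
  | add t t' h h' => simp only [map_add, h, h']
  | tmul x y => simp

theorem map_par_map_inA (t : A ⊗[k] A) : Algebra.TensorProduct.map (par k I A) (par k I A)
    (Algebra.TensorProduct.map (inA k I A) (inA k I A) t) =
      Algebra.TensorProduct.map (inA k I A) (inA k I A) t := by
  induction t with
  | zero => simp
  | add t t' h h' => simp only [map_add, h, h']
  | tmul x y => simp

variable [CharZero k]

theorem mulFlip_map_inA_mul_dA {m : ℤ} {c : A} (hc : c ∈ deg k I A m) (t : A ⊗[k] A) :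
    LinearMap.mul' k _ (flip k I A
      (Algebra.TensorProduct.map (inA k I A) (inA k I A) t * (1 ⊗ₜ[k] dA k I A c))) =
      sandwich (inA k I A) (inA k I A) (dA k I A c) (koszulSwap k I A m t) := by
  refine LinearMap.congr_fun (f := LinearMap.mul' k _ ∘ₗ flip k I A ∘ₗ
    LinearMap.mulRight k (1 ⊗ₜ[k] dA k I A c) ∘ₗ
      (Algebra.TensorProduct.map (inA k I A) (inA k I A)).toLinearMap)
    (g := sandwich (inA k I A) (inA k I A) (dA k I A c) ∘ₗ koszulSwap k I A m)
    (linearMap_ext_of_tmul_mem_deg (I := I) fun i j x hx y hy => ?_) t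
  simp only [LinearMap.comp_apply, LinearMap.mulRight_apply, AlgHom.toLinearMap_apply,
    Algebra.TensorProduct.map_tmul, Algebra.TensorProduct.tmul_mul_tmul, mul_one,
    mulFlip_tmul (par_inA_of_mem hx) ((par_inA_of_mem hy).mul (par_dA_of_mem hc)),
    koszulSwap_tmul m hx hy, map_smul, sandwich_tmul, zero_add]

theorem iota_dA_mul_dA {n m m' : ℤ} (μ : dder k I A n) {b c : A}
    (hb : b ∈ deg k I A m) (hc : c ∈ deg k I A m') : iota μ (dA k I A b * dA k I A c) =
      sandwich (inA k I A) (inA k I A) (dA k I A c) (koszulSwap k I A m' (μ.1 b)) -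
        ((-1 : k) ^ (m * m')) •
          sandwich (inA k I A) (inA k I A) (dA k I A b) (koszulSwap k I A m (μ.1 c)) := by
  have hsgn : Algebra.TensorProduct.map (sgn k I A 1) (sgn k I A 1)
      (Algebra.TensorProduct.map (inA k I A) (inA k I A) (μ.1 c)) = ((-1 : k) ^ (m' + n)) •
        Algebra.TensorProduct.map (inA k I A) (inA k I A) (μ.1 c) := by
    rw [map_sgn_map_inA, degTen_twist (μ.2.2.1 _ _ hc), map_smul]
  have hrot := mulFlip_rotate' (p := 0) (par_dA_of_mem hb)
    (by rw [map_par_map_inA, zpow_zero, one_smul]) hsgn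
  rw [iota, LinearMap.comp_apply, LinearMap.comp_apply, dcontr_mul μ (par_dA_of_mem hb),
    dcontr_dA, dcontr_dA, map_add, map_add, map_smul, map_smul, hrot, smul_smul, sign_mul,
    mulFlip_map_inA_mul_dA hb, mulFlip_map_inA_mul_dA hc, sub_eq_add_neg, ← neg_smul]
  congr 2
  rw [show 1 + n * m + (0 * 1 + (m' + n) * m) = 1 + (2 * (n * m) + m * m') by ring, ← sign_mul,
    zpow_one, neg_one_mul, sign_congr k (b := m * m') ⟨n * m, by ring⟩]

end Omega

namespace DR

theorem mk_mul_comm {p m q n : ℤ} {x y : Omega k I A} (hx : Omega.Par p m x)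
    (hy : Omega.Par q n y) :
    mk k I A (x * y) = ((-1 : k) ^ (p * q + m * n)) • mk k I A (y * x) := by
  rw [← map_smul, ← sub_eq_zero, ← map_sub]
  exact (Submodule.Quotient.mk_eq_zero _).2 (Submodule.subset_span ⟨p, m, q, n, x, y, hx, hy, rfl⟩)

@[simp] theorem D_mk (x : Omega k I A) : D k I A (mk k I A x) = mk k I A (Omega.D k I A x) := rfl

@[simp]
theorem contr_mk {n : ℤ} (θ : sder k I A n) (x : Omega k I A) :
    contr θ (mk k I A x) = mk k I A (Omega.contr θ x) := rfl

@[simp]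
theorem lie_mk {n : ℤ} (θ : sder k I A n) (x : Omega k I A) :
    lie θ (mk k I A x) = mk k I A (Omega.lie θ x) := rfl

@[simp]
theorem iota_mk [CharZero k] {n : ℤ} (μ : dder k I A n) (x : Omega k I A) :
    iota μ (mk k I A x) = Omega.iota μ x := rfl

theorem contr_dA_mul_dA {n m m' : ℤ} (θ : sder k I A n) {b c : A}
    (hb : b ∈ deg k I A m) (hc : c ∈ deg k I A m') :
    contr θ (mk k I A (Omega.dA k I A b * Omega.dA k I A c)) =
      mk k I A (Omega.inA k I A (θ.1 b) * Omega.dA k I A c) -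
        ((-1 : k) ^ (m * m')) • mk k I A (Omega.inA k I A (θ.1 c) * Omega.dA k I A b) := by
  have hcomm := mk_mul_comm (Omega.par_dA_of_mem hb) (Omega.par_inA_of_mem (θ.2.2.1 _ _ hc))
  rw [contr_mk, Omega.contr_mul θ (Omega.par_dA_of_mem hb), Omega.contr_dA, Omega.contr_dA,
    map_add, map_smul, hcomm, smul_smul, sign_mul, sub_eq_add_neg, ← neg_smul]
  congr 2
  rw [show 1 + n * m + (1 * 0 + m * (m' + n)) = 1 + (2 * (n * m) + m * m') by ring, ← sign_mul,
    zpow_one, neg_one_mul, sign_congr k (b := m * m') ⟨n * m, by ring⟩]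

end DR

theorem contrForm_lof (ω : DR k I A) {n : ℤ} (θ : sder k I A n) :
    contrForm ω (DirectSum.lof k ℤ _ n θ) = DR.contr θ ω := by
  rw [contrForm, DirectSum.toModule_lof]
  rfl

theorem iotaForm_lof [CharZero k] (ω : DR k I A) {n : ℤ} (μ : dder k I A n) :
    iotaForm ω (DirectSum.lof k ℤ _ n μ) = DR.iota μ ω := by
  rw [iotaForm, DirectSum.toModule_lof]
  rfl

theorem dOne_mem_omega1Deg {n : ℤ} {a : A} (ha : a ∈ deg k I A n) :
    dOne k I A a ∈ omega1Deg k I A n := by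
  change tmulR (k := k) I a 1 - tmulR I 1 a ∈ Submodule.span k _
  exact Submodule.sub_mem _
    (Submodule.subset_span ⟨n, 0, add_zero n, a, ha, 1, one_mem_deg, rfl⟩)
    (Submodule.subset_span ⟨0, n, zero_add n, 1, one_mem_deg, a, ha, rfl⟩)

theorem dA_mul_dA_mem_omegaDeg {m n : ℤ} {a b : A} (ha : a ∈ deg k I A m)
    (hb : b ∈ deg k I A n) :
    Omega.dA k I A a * Omega.dA k I A b ∈ omegaDeg k I A 2 (m + n) := by
  refine Submodule.subset_span ⟨m, n, rfl, _, ?_, _, dOne_mem_omega1Deg hb, rfl⟩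
  refine Submodule.subset_span
    ⟨0, m, zero_add m, 1, ⟨1, one_mem_deg, by simp⟩, _, dOne_mem_omega1Deg ha, ?_⟩
  rw [one_mul]
  rfl

end Forms

/-! ### The free product with a polynomial ring -/

section FreeProduct

variable {k : Type u} {I : Type v} {A : Type w} [Field k] [Ring A] [Algebra k A] [GrAlg k I A]

namespace FreeProd

variable (k I A) in
/-- The projection to the free product from the tensor algebra of which it is a quotient. -/
def proj : TensorAlgebra k (A × Polynomial (I → k)) →ₐ[k] FreeProd k I A :=
  RingQuot.mkAlgHom k (Rel k I A)

theorem proj_eq_of_rel {x y : TensorAlgebra k (A × Polynomial (I → k))} (h : Rel k I A x y) :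
    proj k I A x = proj k I A y := RingQuot.mkAlgHom_rel k h

variable (k I A) in
/-- The canonical map `inl` from `A` to the free product, as an algebra homomorphism. -/
def inlHom : A →ₐ[k] FreeProd k I A :=
  AlgHom.ofLinearMap ((proj k I A).toLinearMap ∘ₗ TensorAlgebra.ι k ∘ₗ
    LinearMap.inl k A (Polynomial (I → k)))
    (by simpa using proj_eq_of_rel (Rel.one (k := k) (I := I) (A := A)))
    (fun a b => by simpa using proj_eq_of_rel (Rel.mul_left (k := k) (I := I) a b))

theorem inlHom_apply (a : A) : inlHom k I A a = inl k I A a := rfl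

variable (k I A) in
/-- The canonical homomorphism from `R[t]` to the free product. -/
def polyHom : Polynomial (I → k) →ₐ[k] FreeProd k I A :=
  AlgHom.ofLinearMap ((proj k I A).toLinearMap ∘ₗ TensorAlgebra.ι k ∘ₗ
    LinearMap.inr k A (Polynomial (I → k)))
    (by
      have hamalg := proj_eq_of_rel (Rel.amalg (k := k) (I := I) (A := A) 1)
      rw [map_one, map_one, proj_eq_of_rel Rel.one, map_one] at hamalg
      exact hamalg.symm)
    (fun p q => by simpa using proj_eq_of_rel (Rel.mul_right (k := k) (A := A) p q))

theorem polyHom_X : polyHom k I A Polynomial.X = t k I A := rfl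

theorem polyHom_C (r : I → k) : polyHom k I A (Polynomial.C r) = inlHom k I A (str k I A r) :=
  (proj_eq_of_rel (Rel.amalg (k := k) (I := I) (A := A) r)).symm

theorem inlHom_str_mul_t (r : I → k) :
    inlHom k I A (str k I A r) * t k I A = t k I A * inlHom k I A (str k I A r) := by
  rw [← polyHom_C, ← polyHom_X, ← map_mul, ← map_mul, Polynomial.X_mul_C]

section Lift

variable {B : Type*} [Ring B] [Algebra k B] (f : A →ₐ[k] B) (T : B)
  (hT : ∀ r, Commute (f (str k I A r)) T)

/-- The universal property of the free product: the homomorphism that is `f` on `A` and sends `t`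
to `T`. -/
def lift : FreeProd k I A →ₐ[k] B :=
  RingQuot.liftAlgHom k ⟨TensorAlgebra.lift k (f.toLinearMap.coprod
    (Polynomial.eval₂AlgHom (f.comp (str k I A)) T hT).toLinearMap), by
    rintro _ _ (_ | _ | _ | _)
    · simp
    · simp
    · simp
    · simp only [TensorAlgebra.lift_ι_apply, LinearMap.coprod_apply, map_zero, add_zero, zero_add,
        AlgHom.toLinearMap_apply]
      exact (Polynomial.eval₂_C (f.comp (str k I A) : (I → k) →+* B) T).symm⟩

theorem lift_inlHom (a : A) : lift f T hT (inlHom k I A a) = f a :=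
  (RingQuot.liftAlgHom_mkAlgHom_apply k _ _ _).trans (by simp)

theorem lift_t : lift f T hT (t k I A) = T := by
  refine (RingQuot.liftAlgHom_mkAlgHom_apply k _ _ _).trans ?_
  simp only [TensorAlgebra.lift_ι_apply, LinearMap.coprod_apply, map_zero, zero_add,
    AlgHom.toLinearMap_apply]
  exact Polynomial.eval₂_X _ T

theorem hom_ext {f g : FreeProd k I A →ₐ[k] B}
    (h : ∀ a, f (inlHom k I A a) = g (inlHom k I A a)) (ht : f (t k I A) = g (t k I A)) :
    f = g := by
  have hpoly : f.comp (polyHom k I A) = g.comp (polyHom k I A) := by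
    refine Polynomial.algHom_ext' (AlgHom.ext fun r => ?_) ht
    change f (polyHom k I A (Polynomial.C r)) = g (polyHom k I A (Polynomial.C r))
    rw [polyHom_C, h]
  exact RingQuot.ringQuot_ext' k f g <| TensorAlgebra.hom_ext <| LinearMap.prod_ext
    (LinearMap.ext h) (congrArg AlgHom.toLinearMap hpoly)

end Lift

theorem mul_mem_degree {e m n : ℤ} {x y : FreeProd k I A} (hx : x ∈ degree k I A e m)
    (hy : y ∈ degree k I A e n) : x * y ∈ degree k I A e (m + n) := by
  have hxy : x * y ∈ degree k I A e m * degree k I A e n := Submodule.mul_mem_mul hx hy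
  rw [degree, degree, Submodule.span_mul_span] at hxy
  refine Submodule.span_le.2 ?_ hxy
  rintro _ ⟨_, ⟨l, hl, rfl, rfl⟩, _, ⟨l', hl', rfl, rfl⟩, rfl⟩
  refine Submodule.subset_span ⟨l ++ l', fun z hz => ?_, by simp, by simp⟩
  exact (List.mem_append.1 hz).elim (hl z) (hl' z)

theorem inlHom_mem_degree (e : ℤ) {m : ℤ} {a : A} (ha : a ∈ deg k I A m) :
    inlHom k I A a ∈ degree k I A e m :=
  Submodule.subset_span ⟨[(inl k I A a, m)], by simpa using Or.inl ⟨a, ha, rfl⟩, by simp, by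
    simp [inlHom_apply]⟩

theorem t_mem_degree (e : ℤ) : t k I A ∈ degree k I A e e :=
  Submodule.subset_span ⟨[(t k I A, e)], by simp, by simp, by simp⟩

theorem degree_le {e : ℤ} {S : ℤ → Submodule k (FreeProd k I A)}
    (hinl : ∀ m, ∀ a ∈ deg k I A m, inlHom k I A a ∈ S m) (ht : t k I A ∈ S e)
    (hmul : ∀ m n x y, x ∈ S m → y ∈ S n → x * y ∈ S (m + n)) (n : ℤ) :
    degree k I A e n ≤ S n := by
  refine Submodule.span_le.2 ?_
  rintro _ ⟨l, hl, rfl, rfl⟩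
  induction l with
  | nil => simpa using hinl 0 1 one_mem_deg
  | cons y l ih =>
    simp only [List.map_cons, List.sum_cons, List.prod_cons]
    refine hmul _ _ _ _ ?_ (ih fun z hz => hl z (List.mem_cons_of_mem _ hz))
    rcases hl y List.mem_cons_self with ⟨a, ha, hy⟩ | ⟨hy, hdeg⟩
    · exact hy ▸ hinl _ a ha
    · exact hy ▸ hdeg ▸ ht

end FreeProd

end FreeProduct

/-! ### Path algebras -/

section PathAlgebras

variable {k : Type u} [Field k] {V : Type v} {E : Type w} [Fintype V] {Q : GrQuiver V E}

namespace PathAlg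

theorem str_apply (r : V → k) : str k V (PathAlg k Q) r = ∑ i, r i • vert k Q i := rfl

theorem str_single [DecidableEq V] (i : V) :
    str k V (PathAlg k Q) (Pi.single i 1) = vert k Q i := by
  simp [str_apply, Pi.single_apply, ite_smul]

theorem vert_mem_range_str (i : V) : vert k Q i ∈ (str k V (PathAlg k Q)).range := by
  classical exact ⟨Pi.single i 1, str_single i⟩

theorem apply_vert_eq_zero {X : Type*} [AddCommGroup X] [Module k X] {d : PathAlg k Q →ₗ[k] X}
    (h : ∀ r, d (str k V _ r) = 0) (i : V) : d (vert k Q i) = 0 := by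
  obtain ⟨r, hr⟩ := vert_mem_range_str (k := k) (Q := Q) i
  exact hr ▸ h r

theorem apply_str_eq_zero {X : Type*} [AddCommGroup X] [Module k X] {d : PathAlg k Q →ₗ[k] X}
    (h : ∀ i, d (vert k Q i) = 0) (r : V → k) : d (str k V _ r) = 0 := by
  simp [str_apply, h]

theorem vert_mem_deg (i : V) : vert k Q i ∈ deg k V (PathAlg k Q) 0 := vert_mem i

theorem arrow_mem_deg (a : E) : arrow k Q a ∈ deg k V (PathAlg k Q) (Q.deg a) := arrow_mem a

theorem deg_le {S : ℤ → Submodule k (PathAlg k Q)} (hvert : ∀ i, vert k Q i ∈ S 0)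
    (harrow : ∀ a, arrow k Q a ∈ S (Q.deg a))
    (hmul : ∀ m n x y, x ∈ S m → y ∈ S n → x * y ∈ S (m + n)) (n : ℤ) :
    deg k V (PathAlg k Q) n ≤ S n := by
  have hword (l : List E) : word k Q l ∈ S (l.map Q.deg).sum := by
    induction l with
    | nil =>
      change (1 : PathAlg k Q) ∈ S 0
      rw [← sum_vert]
      exact sum_mem fun i _ => hvert i
    | cons a l ih => simpa [word] using hmul _ _ _ _ (harrow a) ih
  refine Submodule.span_le.2 ?_
  rintro _ ⟨i, l, rfl, rfl⟩
  simpa using hmul _ _ _ _ (hvert i) (hword l)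

theorem deg_eq_bot (hQ : ∀ a, Q.deg a ≤ 0) {n : ℤ} (hn : 0 < n) :
    deg k V (PathAlg k Q) n = ⊥ := by
  let S (m : ℤ) : Submodule k (PathAlg k Q) := if 0 < m then ⊥ else ⊤
  have mem_S {m : ℤ} (hm : m ≤ 0) (x : PathAlg k Q) : x ∈ S m := by simp [S, hm.not_gt]
  have eq_zero {m : ℤ} (hm : 0 < m) {x : PathAlg k Q} (hx : x ∈ S m) : x = 0 := by
    simpa [S, hm] using hx
  have hS : deg k V (PathAlg k Q) n ≤ S n := by
    refine deg_le (fun i => mem_S le_rfl _) (fun a => mem_S (hQ a) _) (fun i j x y hx hy => ?_) n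
    rcases lt_or_ge 0 i with hi | hi
    · simp [eq_zero hi hx]
    · rcases lt_or_ge 0 j with hj | hj
      · simp [eq_zero hj hy]
      · exact mem_S (by omega) _
  exact eq_bot_iff.2 fun x hx => (Submodule.mem_bot k).2 (eq_zero hn (hS hx))

theorem finiteType [Finite E] : Algebra.FiniteType k (PathAlg k Q) :=
  Algebra.FiniteType.of_surjective (proj k Q) (RingQuot.mkAlgHom_surjective k _)

section Derivations

variable {B : Type*} [Ring B] [Algebra k B] {f g : PathAlg k Q →ₐ[k] B}
  {d d' : PathAlg k Q →ₗ[k] B}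

theorem isDerivationAlong_der (f g : PathAlg k Q →ₐ[k] B) (x : E → B) :
    IsDerivationAlong f g (der f g x) := der_mul f g x

theorem derivation_ext (hd : IsDerivationAlong f g d) (hd' : IsDerivationAlong f g d')
    (hv : ∀ i, d (vert k Q i) = d' (vert k Q i)) (ha : ∀ a, d (arrow k Q a) = d' (arrow k Q a)) :
    d = d' := by
  ext x
  induction x using PathAlg.induction with
  | hv i => exact hv i
  | ha a => exact ha a
  | hs c => rw [hd.map_algebraMap, hd'.map_algebraMap]
  | add x y hx hy => rw [map_add, map_add, hx, hy]
  | mul x y hx hy => rw [hd, hd', hx, hy]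

theorem derivation_arrow (hd : IsDerivationAlong f g d) (hv : ∀ i, d (vert k Q i) = 0) (a : E) :
    f (vert k Q (Q.tgt a)) * d (arrow k Q a) * g (vert k Q (Q.src a)) = d (arrow k Q a) := by
  have htgt := hd (vert k Q (Q.tgt a)) (arrow k Q a)
  have hsrc := hd (arrow k Q a) (vert k Q (Q.src a))
  rw [tgt_mul, hv, zero_mul, zero_add] at htgt
  rw [mul_src, hv, mul_zero, add_zero] at hsrc
  rw [← htgt, ← hsrc]

theorem derivation_mem {D : ℤ → Submodule k B} {n : ℤ}
    (hf : ∀ i j, ∀ x ∈ deg k V (PathAlg k Q) i, ∀ y ∈ D j, f x * y ∈ D (i + j))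
    (hg : ∀ i j, ∀ y ∈ D i, ∀ x ∈ deg k V (PathAlg k Q) j, y * g x ∈ D (i + j))
    (hd : IsDerivationAlong f g d) (hv : ∀ i, d (vert k Q i) = 0)
    (ha : ∀ a, d (arrow k Q a) ∈ D (Q.deg a + n)) (m : ℤ) {x : PathAlg k Q}
    (hx : x ∈ deg k V (PathAlg k Q) m) : d x ∈ D (m + n) := by
  refine (deg_le (S := fun m => deg k V (PathAlg k Q) m ⊓ (D (m + n)).comap d)
    (fun i => ⟨vert_mem_deg i, by simp [hv]⟩) (fun a => ⟨arrow_mem_deg a, ha a⟩) ?_ m hx).2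
  rintro i j x y ⟨hx, hdx⟩ ⟨hy, hdy⟩
  refine ⟨mul_mem_deg hx hy, ?_⟩
  change d (x * y) ∈ D (i + j + n)
  rw [hd]
  refine add_mem ?_ ?_
  · convert hg _ _ _ hdx _ hy using 2; ring
  · convert hf _ _ _ hx _ hdy using 2; ring

/-- The super-derivation of degree `n` whose value on an arrow `a` is the component of `x a` from
the source to the target of `a`. -/
def sderOf (n : ℤ) (x : E → PathAlg k Q)
    (hx : ∀ a, x a ∈ deg k V (PathAlg k Q) (Q.deg a + n)) : sder k V (PathAlg k Q) n where
  val := der (twist k V _ n) (AlgHom.id k _) x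
  property := mem_sder_of_isDerivationAlong (isDerivationAlong_der _ _ x)
    (apply_str_eq_zero (der_vert _ _ x)) fun m _ ha => derivation_mem (D := deg k V _)
      (fun _ _ _ hx _ hy => mul_mem_deg (twist_mem n hx) hy)
      (fun _ _ _ hy _ hx => mul_mem_deg hy hx)
      (isDerivationAlong_der _ _ x) (der_vert _ _ x) (fun a => by
        simpa [twist_vert] using
          mul_mem_deg (mul_mem_deg (vert_mem_deg (Q.tgt a)) (hx a)) (vert_mem_deg (Q.src a))) m ha

theorem sderOf_arrow (n : ℤ) (x : E → PathAlg k Q)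
    (hx : ∀ a, x a ∈ deg k V (PathAlg k Q) (Q.deg a + n)) (a : E) :
    (sderOf n x hx).1 (arrow k Q a) = vert k Q (Q.tgt a) * x a * vert k Q (Q.src a) := by
  simp [sderOf, twist_vert]

/-- The double super-derivation of degree `n` whose value on an arrow `a` is the component of `x a`
from the source to the target of `a`. -/
def dderOf (n : ℤ) (x : E → PathAlg k Q ⊗[k] PathAlg k Q)
    (hx : ∀ a, x a ∈ degTen k V (PathAlg k Q) (Q.deg a + n)) : dder k V (PathAlg k Q) n where
  val := der (Algebra.TensorProduct.includeLeft.comp (twist k V _ n))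
    Algebra.TensorProduct.includeRight x
  property := by
    have hleft {i : ℤ} {p : PathAlg k Q} (hp : p ∈ deg k V _ i) :
        p ⊗ₜ[k] 1 ∈ degTen k V (PathAlg k Q) i := by simpa using tmul_mem_degTen hp one_mem_deg
    have hright {i : ℤ} {p : PathAlg k Q} (hp : p ∈ deg k V _ i) :
        1 ⊗ₜ[k] p ∈ degTen k V (PathAlg k Q) i := by simpa using tmul_mem_degTen one_mem_deg hp
    refine mem_dder_of_isDerivationAlong (isDerivationAlong_der _ _ x)
      (apply_str_eq_zero (der_vert _ _ x)) fun m _ ha => derivation_mem (D := degTen k V _)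
        (fun _ _ _ hx _ hy => mul_mem_degTen (hleft (twist_mem n hx)) hy)
        (fun _ _ _ hy _ hx => mul_mem_degTen hy (hright hx))
        (isDerivationAlong_der _ _ x) (der_vert _ _ x) (fun a => ?_) m ha
    simpa [twist_vert] using mul_mem_degTen (mul_mem_degTen (hleft (vert_mem_deg (Q.tgt a))) (hx a))
      (hright (vert_mem_deg (Q.src a)))

theorem dderOf_arrow (n : ℤ) (x : E → PathAlg k Q ⊗[k] PathAlg k Q)
    (hx : ∀ a, x a ∈ degTen k V (PathAlg k Q) (Q.deg a + n)) (a : E) :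
    (dderOf n x hx).1 (arrow k Q a) =
      (vert k Q (Q.tgt a) ⊗ₜ[k] 1) * x a * (1 ⊗ₜ[k] vert k Q (Q.src a)) := by
  simp [dderOf, twist_vert]

section Single

variable [DecidableEq E] (b : E) {l : ℤ}

/-- The super-derivation whose value on the arrow `b` is the component of `x` from the source to
the target of `b`, and which vanishes on the other arrows. -/
def sderSingle {x : PathAlg k Q} (hx : x ∈ deg k V (PathAlg k Q) l) :
    sder k V (PathAlg k Q) (l - Q.deg b) :=
  sderOf (l - Q.deg b) (Pi.single b x) fun a => by
    rcases eq_or_ne a b with rfl | h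
    · simpa using hx
    · rw [Pi.single_eq_of_ne h]
      exact zero_mem _

theorem sderSingle_arrow_self {x : PathAlg k Q} (hx : x ∈ deg k V (PathAlg k Q) l) :
    (sderSingle b hx).1 (arrow k Q b) = vert k Q (Q.tgt b) * x * vert k Q (Q.src b) := by
  rw [sderSingle, sderOf_arrow, Pi.single_eq_same]

variable {b} in
theorem sderSingle_arrow_of_ne {a : E} (h : a ≠ b) {x : PathAlg k Q}
    (hx : x ∈ deg k V (PathAlg k Q) l) : (sderSingle b hx).1 (arrow k Q a) = 0 := by
  rw [sderSingle, sderOf_arrow, Pi.single_eq_of_ne h, mul_zero, zero_mul]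

/-- The double super-derivation whose value on the arrow `b` is the component of `t` from the source
to the target of `b`, and which vanishes on the other arrows. -/
def dderSingle {t : PathAlg k Q ⊗[k] PathAlg k Q} (ht : t ∈ degTen k V (PathAlg k Q) l) :
    dder k V (PathAlg k Q) (l - Q.deg b) :=
  dderOf (l - Q.deg b) (Pi.single b t) fun a => by
    rcases eq_or_ne a b with rfl | h
    · simpa using ht
    · rw [Pi.single_eq_of_ne h]
      exact zero_mem _

theorem dderSingle_arrow_self {t : PathAlg k Q ⊗[k] PathAlg k Q}
    (ht : t ∈ degTen k V (PathAlg k Q) l) : (dderSingle b ht).1 (arrow k Q b) =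
      (vert k Q (Q.tgt b) ⊗ₜ[k] 1) * t * (1 ⊗ₜ[k] vert k Q (Q.src b)) := by
  rw [dderSingle, dderOf_arrow, Pi.single_eq_same]

variable {b} in
theorem dderSingle_arrow_of_ne {a : E} (h : a ≠ b) {t : PathAlg k Q ⊗[k] PathAlg k Q}
    (ht : t ∈ degTen k V (PathAlg k Q) l) : (dderSingle b ht).1 (arrow k Q a) = 0 := by
  rw [dderSingle, dderOf_arrow, Pi.single_eq_of_ne h, mul_zero, zero_mul]

end Single

theorem sder_arrow {n : ℤ} (θ : sder k V (PathAlg k Q) n) (a : E) :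
    vert k Q (Q.tgt a) * θ.1 (arrow k Q a) * vert k Q (Q.src a) = θ.1 (arrow k Q a) := by
  simpa [twist_vert] using
    derivation_arrow (isDerivationAlong_of_mem_sder θ.2) (apply_vert_eq_zero θ.2.1) a

theorem dder_arrow {n : ℤ} (μ : dder k V (PathAlg k Q) n) (a : E) :
    (vert k Q (Q.tgt a) ⊗ₜ[k] 1) * μ.1 (arrow k Q a) * (1 ⊗ₜ[k] vert k Q (Q.src a)) =
      μ.1 (arrow k Q a) := by
  simpa [twist_vert] using
    derivation_arrow (isDerivationAlong_of_mem_dder μ.2) (apply_vert_eq_zero μ.2.1) a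

theorem sder_ext {n : ℤ} {θ η : sder k V (PathAlg k Q) n}
    (h : ∀ a, θ.1 (arrow k Q a) = η.1 (arrow k Q a)) : θ = η :=
  Subtype.ext <| derivation_ext (isDerivationAlong_of_mem_sder θ.2)
    (isDerivationAlong_of_mem_sder η.2)
    (fun i => by rw [apply_vert_eq_zero θ.2.1, apply_vert_eq_zero η.2.1]) h

theorem dder_ext {n : ℤ} {μ ν : dder k V (PathAlg k Q) n}
    (h : ∀ a, μ.1 (arrow k Q a) = ν.1 (arrow k Q a)) : μ = ν :=
  Subtype.ext <| derivation_ext (isDerivationAlong_of_mem_dder μ.2)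
    (isDerivationAlong_of_mem_dder ν.2)
    (fun i => by rw [apply_vert_eq_zero μ.2.1, apply_vert_eq_zero ν.2.1]) h

theorem sder_sq_eq_zero (θ : sder k V (PathAlg k Q) 1)
    (h : ∀ a, θ.1 (θ.1 (arrow k Q a)) = 0) (x : PathAlg k Q) : θ.1 (θ.1 x) = 0 := by
  induction x using PathAlg.induction with
  | hv i => rw [apply_vert_eq_zero θ.2.1, map_zero]
  | ha a => exact h a
  | hs c => rw [(isDerivationAlong_of_mem_sder θ.2).map_algebraMap, map_zero]
  | add x y hx hy => rw [map_add, map_add, hx, hy, add_zero]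
  | mul x y hx hy =>
    rw [sder_mul θ.2, map_add, sder_mul θ.2, sder_mul θ.2, hx, hy, sder_twist θ.2]
    simp

end Derivations

section PartialDerivatives

variable [DecidableEq E]

theorem isDerivationAlong_partialDer (a : E) : IsDerivationAlong
    Algebra.TensorProduct.includeLeft Algebra.TensorProduct.includeRight
      (partialDer (k := k) (Q := Q) a) :=
  isDerivationAlong_der _ _ _

theorem partialDer_vert (a : E) (i : V) : partialDer a (vert k Q i) = 0 := der_vert _ _ _ i

theorem partialDer_arrow_self (a : E) : partialDer a (arrow k Q a) =
    vert k Q (Q.tgt a) ⊗ₜ[k] vert k Q (Q.src a) := by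
  simp [partialDer]

theorem partialDer_arrow_of_ne {a b : E} (h : b ≠ a) : partialDer a (arrow k Q b) = 0 := by
  simp [partialDer, h]

theorem derivation_eq_sum_sandwich_partialDer [Fintype E] {B : Type*} [Ring B] [Algebra k B]
    {f g : PathAlg k Q →ₐ[k] B} {d : PathAlg k Q →ₗ[k] B} (hd : IsDerivationAlong f g d)
    (hv : ∀ i, d (vert k Q i) = 0) (x : PathAlg k Q) :
    d x = ∑ a, sandwich f g (d (arrow k Q a)) (partialDer a x) := by
  have hsum : IsDerivationAlong f g (∑ a, sandwich f g (d (arrow k Q a)) ∘ₗ partialDer a) :=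
    .sum fun a _ => (isDerivationAlong_partialDer a).sandwich f g _
  refine (LinearMap.congr_fun (derivation_ext hd hsum (fun i => ?_) fun a => ?_) x).trans ?_
  · simp [hv, partialDer_vert]
  · rw [LinearMap.sum_apply, Finset.sum_eq_single a
      (fun b _ hb => by simp [partialDer_arrow_of_ne hb.symm]) (by simp)]
    simp [partialDer_arrow_self, derivation_arrow hd hv]
  · simp

end PartialDerivatives

section OneForms

theorem dA_vert (i : V) : Omega.dA k V (PathAlg k Q) (vert k Q i) = 0 :=
  apply_vert_eq_zero (Omega.dA_str k V _) i

theorem dA_arrow (a : E) : Omega.inA k V _ (vert k Q (Q.tgt a)) *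
    Omega.dA k V (PathAlg k Q) (arrow k Q a) * Omega.inA k V _ (vert k Q (Q.src a)) =
      Omega.dA k V (PathAlg k Q) (arrow k Q a) :=
  derivation_arrow Omega.isDerivationAlong_dA dA_vert a

theorem tgt_mul_dA_arrow (a : E) : Omega.inA k V _ (vert k Q (Q.tgt a)) *
    Omega.dA k V (PathAlg k Q) (arrow k Q a) = Omega.dA k V (PathAlg k Q) (arrow k Q a) := by
  rw [← dA_arrow, ← mul_assoc, ← mul_assoc, ← map_mul, vert_mul_self]

theorem dA_arrow_mul_src (a : E) : Omega.dA k V (PathAlg k Q) (arrow k Q a) *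
    Omega.inA k V _ (vert k Q (Q.src a)) = Omega.dA k V (PathAlg k Q) (arrow k Q a) := by
  rw [← dA_arrow, mul_assoc, ← map_mul, vert_mul_self]

theorem dA_eq_sum_sandwich_partialDer [Fintype E] [DecidableEq E] (x : PathAlg k Q) :
    Omega.dA k V (PathAlg k Q) x = ∑ a, sandwich (Omega.inA k V _) (Omega.inA k V _)
      (Omega.dA k V _ (arrow k Q a)) (partialDer a x) :=
  derivation_eq_sum_sandwich_partialDer Omega.isDerivationAlong_dA dA_vert x

theorem dOne_arrow (a : E) : (vert k Q (Q.tgt a) ⊗ₜ[k] MulOpposite.op (vert k Q (Q.src a)) :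
    Env k (PathAlg k Q)) • dOne k V (PathAlg k Q) (arrow k Q a) =
      dOne k V (PathAlg k Q) (arrow k Q a) := by
  have htgt := dOne_mul k V _ (vert k Q (Q.tgt a)) (arrow k Q a)
  have hsrc := dOne_mul k V _ (arrow k Q a) (vert k Q (Q.src a))
  rw [tgt_mul, apply_vert_eq_zero (dOne_str k V _), smul_zero, zero_add] at htgt
  rw [mul_src, apply_vert_eq_zero (dOne_str k V _), smul_zero, add_zero] at hsrc
  have hmul := mul_smul (vert k Q (Q.tgt a) ⊗ₜ[k] 1 : Env k (PathAlg k Q))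
    (1 ⊗ₜ[k] MulOpposite.op (vert k Q (Q.src a))) (dOne k V _ (arrow k Q a))
  rw [Algebra.TensorProduct.tmul_mul_tmul, mul_one, one_mul] at hmul
  exact hmul.trans ((congrArg _ hsrc.symm).trans htgt.symm)

theorem span_dOne_arrow : Submodule.span (Env k (PathAlg k Q))
    (Set.range fun a : E => dOne k V (PathAlg k Q) (arrow k Q a)) = ⊤ := by
  set S := Submodule.span (Env k (PathAlg k Q))
    (Set.range fun a : E => dOne k V (PathAlg k Q) (arrow k Q a))
  have hdOne (x : PathAlg k Q) : dOne k V _ x ∈ S := by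
    induction x using PathAlg.induction with
    | hv i => rw [apply_vert_eq_zero (dOne_str k V _)]; exact zero_mem _
    | ha a => exact Submodule.subset_span ⟨a, rfl⟩
    | hs c => rw [← AlgHom.commutes (str k V _), dOne_str]; exact zero_mem _
    | add x y hx hy => rw [map_add]; exact add_mem hx hy
    | mul x y hx hy =>
      rw [dOne_mul]
      exact add_mem (S.smul_mem _ hx) (S.smul_mem _ hy)
  refine eq_top_iff.2 fun η _ => ?_
  induction η using omega1_induction with
  | add x y hx hy => exact add_mem (hx trivial) (hy trivial)
  | zero => exact zero_mem _
  | mem a b => exact S.smul_mem _ (hdOne a)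

theorem omega1_projective [Finite E] :
    Module.Projective (Env k (PathAlg k Q)) (Omega1 k V (PathAlg k Q)) := by
  classical
  have := Fintype.ofFinite E
  let coord (b : E) : Omega1 k V (PathAlg k Q) →ₗ[Env k (PathAlg k Q)] Env k (PathAlg k Q) :=
    Omega.doubleDerHom (partialDer b) (isDerivationAlong_partialDer b)
      (apply_str_eq_zero (partialDer_vert b))
  refine Module.Projective.of_split (LinearMap.pi coord)
    (Fintype.linearCombination (Env k (PathAlg k Q)) fun a => dOne k V _ (arrow k Q a))
    (LinearMap.ext_on span_dOne_arrow ?_)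
  rintro _ ⟨a, rfl⟩
  rw [LinearMap.comp_apply, Fintype.linearCombination_apply, Finset.sum_eq_single a _ (by simp)]
  · simpa [coord, Omega.doubleDerHom_dOne, partialDer_arrow_self] using dOne_arrow a
  · intro b _ hb
    rw [LinearMap.pi_apply, Omega.doubleDerHom_dOne, partialDer_arrow_of_ne hb.symm, map_zero]
    exact zero_smul (Env k (PathAlg k Q)) (dOne k V _ (arrow k Q b))

theorem oneForms_le [Finite E] {S : Submodule k (Omega k V (PathAlg k Q))}
    (h : ∀ (a : E) (i j : ℤ), ∀ p ∈ deg k V (PathAlg k Q) i, ∀ q ∈ deg k V (PathAlg k Q) j,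
      Omega.inA k V _ p * Omega.dA k V _ (arrow k Q a) * Omega.inA k V _ q ∈ S) :
    oneForms k V (PathAlg k Q) ≤ S := by
  classical
  have := Fintype.ofFinite E
  have hsandwich (a : E) (t : PathAlg k Q ⊗[k] PathAlg k Q) :
      sandwich (Omega.inA k V _) (Omega.inA k V _) (Omega.dA k V _ (arrow k Q a)) t ∈ S := by
    refine (Submodule.Quotient.mk_eq_zero S).1 (LinearMap.congr_fun
      (f := S.mkQ ∘ₗ sandwich (Omega.inA k V _) (Omega.inA k V _) (Omega.dA k V _ (arrow k Q a)))
      (g := 0) (linearMap_ext_of_tmul_mem_deg (I := V) fun i j p hp q hq => ?_) t)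
    exact (Submodule.Quotient.mk_eq_zero S).2 (h a i j p hp q hq)
  refine Omega.oneForms_le fun x y => ?_
  rw [dA_eq_sum_sandwich_partialDer, Finset.sum_mul]
  refine sum_mem fun a _ => ?_
  rw [← sandwich_mul_one_tmul]
  exact hsandwich a _

section Coordinates

variable [DecidableEq E]

/-- The coordinate of a one-form along `D b`, for an arrow `b`: it sends `p (D b) q` to
`p e_{t(b)} ⊗ e_{s(b)} q` and vanishes on `p (D a) q` for the other arrows `a`. -/
def coord (b : E) : Omega k V (PathAlg k Q) →ₗ[k] PathAlg k Q ⊗[k] PathAlg k Q :=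
  Omega.oneFormLift _ _ (partialDer b) (isDerivationAlong_partialDer b)
    (apply_str_eq_zero (partialDer_vert b))

theorem coord_sandwich_self (b : E) (t : PathAlg k Q ⊗[k] PathAlg k Q) :
    coord b (sandwich (Omega.inA k V _) (Omega.inA k V _) (Omega.dA k V _ (arrow k Q b)) t) =
      (1 ⊗ₜ[k] vert k Q (Q.src b)) * t * (vert k Q (Q.tgt b) ⊗ₜ[k] 1) := by
  induction t with
  | zero => simp
  | add t t' h h' => simp only [map_add, mul_add, add_mul, h, h']
  | tmul p q =>
    rw [sandwich_tmul, coord, Omega.oneFormLift_mul_mul, Omega.oneFormLift_dA,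
      partialDer_arrow_self]
    simp

theorem coord_sandwich_of_ne {a b : E} (h : a ≠ b) (t : PathAlg k Q ⊗[k] PathAlg k Q) :
    coord b (sandwich (Omega.inA k V _) (Omega.inA k V _) (Omega.dA k V _ (arrow k Q a)) t) =
      0 := by
  induction t with
  | zero => simp
  | add t t' h h' => simp only [map_add, h, h', add_zero]
  | tmul p q =>
    rw [sandwich_tmul, coord, Omega.oneFormLift_mul_mul, Omega.oneFormLift_dA,
      partialDer_arrow_of_ne h, mul_zero, zero_mul]

end Coordinates

variable (k Q) in
/-- The augmentation, which sends all arrows to `0`. -/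
def augment : PathAlg k Q →ₐ[k] PathAlg k Q :=
  lift (vert k Q) 0 (sum_vert k Q) (vert_mul_self k Q) (fun _ _ h => vert_mul_of_ne k Q h)
    (by simp) (by simp)

theorem augment_mem_range_str (x : PathAlg k Q) :
    augment k Q x ∈ (str k V (PathAlg k Q)).range := by
  induction x using PathAlg.induction with
  | hv i => rw [augment, lift_vert]; exact vert_mem_range_str i
  | ha a => rw [augment, lift_arrow]; exact zero_mem _
  | hs c => rw [AlgHom.commutes]; exact Subalgebra.algebraMap_mem _ _
  | add x y hx hy => rw [map_add]; exact add_mem hx hy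
  | mul x y hx hy => rw [map_mul]; exact mul_mem hx hy

theorem augment_str (r : V → k) :
    augment k Q (str k V (PathAlg k Q) r) = str k V (PathAlg k Q) r := by
  simp [str_apply, augment]

theorem dA_eq_zero_iff {x : PathAlg k Q} :
    Omega.dA k V (PathAlg k Q) x = 0 ↔ x ∈ (str k V (PathAlg k Q)).range := by
  constructor
  · intro h
    -- `id - augment` is a derivation vanishing on `R`, so it factors through `D`
    have hd : IsDerivationAlong (AlgHom.id k _) (augment k Q)
        (LinearMap.id - (augment k Q).toLinearMap) := fun x y => by
      simp [sub_mul, mul_sub]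
    have haug := Omega.oneFormLift_dA _ _ _ hd (fun r : V → k => by simp [augment_str]) x
    rw [h, map_zero] at haug
    rw [sub_eq_zero.1 haug.symm]
    exact augment_mem_range_str x
  · rintro ⟨r, rfl⟩
    exact Omega.dA_str k V _ r

end OneForms

section CoDerivations

theorem sandwich_dA_arrow (b : E) (t : PathAlg k Q ⊗[k] PathAlg k Q) :
    sandwich (Omega.inA k V _) (Omega.inA k V _) (Omega.dA k V _ (arrow k Q b))
      ((1 ⊗ₜ[k] vert k Q (Q.src b)) * t * (vert k Q (Q.tgt b) ⊗ₜ[k] 1)) =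
        sandwich (Omega.inA k V _) (Omega.inA k V _) (Omega.dA k V _ (arrow k Q b)) t := by
  induction t with
  | zero => simp
  | add t t' h h' => simp only [mul_add, add_mul, map_add, h, h']
  | tmul p q =>
    conv_rhs => rw [sandwich_tmul, ← dA_arrow b]
    simp [mul_assoc]

theorem mk_inA_mul_dA_arrow (b : E) {l : ℤ} {x : PathAlg k Q}
    (hx : x ∈ deg k V (PathAlg k Q) l) :
    DR.mk k V _ (Omega.inA k V _ (vert k Q (Q.src b) * x * vert k Q (Q.tgt b)) *
        Omega.dA k V _ (arrow k Q b)) =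
      DR.mk k V _ (Omega.inA k V _ x * Omega.dA k V _ (arrow k Q b)) := by
  have h := DR.mk_mul_comm (((Omega.par_inA_of_mem hx).mul (Omega.par_inA_of_mem
    (vert_mem_deg (Q.tgt b)))).mul (Omega.par_dA_of_mem (arrow_mem_deg b)))
    (Omega.par_inA_of_mem (vert_mem_deg (Q.src b)))
  rw [mul_zero, mul_zero, add_zero, zpow_zero, one_smul] at h
  conv_rhs => rw [← dA_arrow b]
  simp only [map_mul, mul_assoc] at h ⊢
  exact h.symm

variable [DecidableEq E]

variable (k Q) in
/-- The double super-derivation dual to the arrow `b`: it sends `b` to `e_{t(b)} ⊗ e_{s(b)}` and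
the other arrows to `0`. -/
def coDer (b : E) : dder k V (PathAlg k Q) (0 - Q.deg b) :=
  dderSingle b (one_mem_degTen (k := k) (I := V))

theorem coDer_arrow_self (b : E) : (coDer k Q b).1 (arrow k Q b) =
    vert k Q (Q.tgt b) ⊗ₜ[k] vert k Q (Q.src b) := by
  simp [coDer, dderSingle_arrow_self]

theorem coDer_arrow_of_ne {a b : E} (h : a ≠ b) : (coDer k Q b).1 (arrow k Q a) = 0 :=
  dderSingle_arrow_of_ne h _

theorem iota_coDer_of_ne {a b : E} (h : a ≠ b) (x : PathAlg k Q) :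
    Omega.iota (coDer k Q b) (Omega.inA k V _ x * Omega.dA k V _ (arrow k Q a)) = 0 := by
  rw [Omega.iota, LinearMap.comp_apply, LinearMap.comp_apply, Omega.dcontr_mul_raw,
    Omega.dcontr_inA, Omega.dcontr_dA, coDer_arrow_of_ne h]
  simp

theorem iota_coDer_self [CharZero k] (b : E) (x : PathAlg k Q) :
    Omega.iota (coDer k Q b) (Omega.inA k V _ x * Omega.dA k V _ (arrow k Q b)) =
      Omega.inA k V _
        (twist k V _ (0 - Q.deg b) (vert k Q (Q.src b) * x * vert k Q (Q.tgt b))) := by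
  refine LinearMap.congr_fun (f := Omega.iota (coDer k Q b) ∘ₗ
      LinearMap.mulRight k (Omega.dA k V _ (arrow k Q b)) ∘ₗ (Omega.inA k V _).toLinearMap)
    (g := (Omega.inA k V _).toLinearMap ∘ₗ (twist k V _ (0 - Q.deg b)).toLinearMap ∘ₗ
      LinearMap.mulRight k (vert k Q (Q.tgt b)) ∘ₗ LinearMap.mulLeft k (vert k Q (Q.src b)))
    (linearMap_ext_of_mem_deg (I := V) fun j x hx => ?_) x
  have hxt : x * vert k Q (Q.tgt b) ∈ deg k V (PathAlg k Q) j := by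
    simpa using mul_mem_deg hx (vert_mem_deg (Q.tgt b))
  simp only [LinearMap.comp_apply, LinearMap.mulRight_apply, LinearMap.mulLeft_apply,
    AlgHom.toLinearMap_apply, Omega.iota, Omega.dcontr_mul _ (Omega.par_inA_of_mem hx),
    Omega.dcontr_inA, Omega.dcontr_dA, coDer_arrow_self, Algebra.TensorProduct.map_tmul,
    Algebra.TensorProduct.tmul_mul_tmul, one_mul, ← map_mul, zero_mul, zero_add, map_smul,
    Omega.mulFlip_tmul (Omega.par_inA_of_mem hxt) (Omega.par_inA_of_mem (vert_mem_deg _))]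
  rw [map_mul (twist k V _ _), map_mul (twist k V _ _), twist_vert, twist_vert, twist_of_mem _ hx]
  simp [mul_assoc]

end CoDerivations

end PathAlg

end PathAlgebras

/-! ### The double quiver -/

section DoubleArrows

variable {V : Type v} {E : Type w} {Q : FinQuiver V E}

theorem double_src_swap (b : E ⊕ E) : Q.double.src b.swap = Q.double.tgt b := by
  cases b <;> rfl

theorem double_tgt_swap (b : E ⊕ E) : Q.double.tgt b.swap = Q.double.src b := by
  cases b <;> rfl

theorem double_deg_swap (b : E ⊕ E) : Q.double.deg b.swap = -1 - Q.double.deg b := by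
  cases b <;> rfl

end DoubleArrows

section QuiverForm

variable {V : Type v} {E : Type w} {k : Type u} [Field k] [Fintype V] {Q : FinQuiver V E}

open PathAlg

theorem arr_mem_deg (a : E) : arr k Q a ∈ deg k V (PathAlg k Q.double) 0 :=
  arrow_mem_deg (Q := Q.double) (Sum.inl a)

theorem arrStar_mem_deg (a : E) : arrStar k Q a ∈ deg k V (PathAlg k Q.double) (-1) :=
  arrow_mem_deg (Q := Q.double) (Sum.inr a)

theorem sign_smul_sign_smul {X : Type*} [AddCommGroup X] [Module k X] (n : ℤ) (x : X) :
    (-1 : k) ^ n • (-1 : k) ^ n • x = x := by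
  rw [smul_smul, sign_mul, (Even.add_self n).neg_one_zpow, one_smul]

variable (k) in
/-- The sign with which an arrow of the double quiver enters `ω = ∑ D a* D a`, after reordering so
that the arrow comes last: `1` for `a` and `-1` for `a*`. -/
def doubleSign : E ⊕ E → k := Sum.elim 1 (-1)

theorem doubleSign_swap (b : E ⊕ E) : doubleSign k b.swap = -doubleSign k b := by
  cases b <;> simp [doubleSign]

theorem doubleSign_smul_injective {X : Type*} [AddCommGroup X] [Module k X] (b : E ⊕ E) :
    Function.Injective fun x : X => doubleSign k b • x := by
  cases b <;> simp [doubleSign, Function.Injective]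

theorem eq_doubleSign_smul {X : Type*} [AddCommGroup X] [Module k X] {b : E ⊕ E} {x y : X}
    (h : y = doubleSign k b • x) : x = doubleSign k b • y := by
  subst h
  cases b <;> simp [doubleSign]

variable [Fintype E]

theorem isClosedTwoForm_quiverForm : IsClosedTwoForm (-1) (quiverForm k Q) := by
  refine ⟨⟨_, Submodule.sum_mem _ fun a _ => ?_, rfl⟩, ?_⟩
  · simpa using dA_mul_dA_mem_omegaDeg (arrStar_mem_deg a) (arr_mem_deg (k := k) (Q := Q) a)
  · rw [quiverForm, DR.D_mk, map_sum, Finset.sum_eq_zero, map_zero]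
    intro a _
    rw [Omega.D_mul (Omega.par_dA_of_mem (arrStar_mem_deg a))]
    simp

theorem contr_quiverForm {n : ℤ} (θ : sder k V (PathAlg k Q.double) n) :
    DR.contr θ (quiverForm k Q) = DR.mk k V _ (∑ b, doubleSign k b •
      (Omega.inA k V _ (θ.1 (arrow k Q.double b.swap)) * Omega.dA k V _ (arrow k Q.double b))) := by
  rw [quiverForm, map_sum, map_sum, map_sum, Fintype.sum_sum_type, ← Finset.sum_add_distrib]
  refine Finset.sum_congr rfl fun a _ => ?_
  rw [DR.contr_dA_mul_dA θ (arrStar_mem_deg a) (arr_mem_deg a)]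
  simp [doubleSign, sub_eq_add_neg, arr, arrStar]

theorem contr_sderSingle_quiverForm [DecidableEq E] (b : E ⊕ E) {l : ℤ} {x : PathAlg k Q.double}
    (hx : x ∈ deg k V (PathAlg k Q.double) l) :
    DR.contr (sderSingle b.swap hx) (quiverForm k Q) =
      doubleSign k b • DR.mk k V _ (Omega.inA k V _ x * Omega.dA k V _ (arrow k Q.double b)) := by
  rw [contr_quiverForm, map_sum, Finset.sum_eq_single b _ (by simp)]
  · rw [map_smul, sderSingle_arrow_self, double_src_swap, double_tgt_swap,
      mk_inA_mul_dA_arrow b hx]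
  · intro c _ hc
    rw [sderSingle_arrow_of_ne (Sum.swap_leftInverse.injective.ne hc)]
    simp

theorem contrForm_quiverForm_mem (z : SDer k V (PathAlg k Q.double)) :
    contrForm (quiverForm k Q) z ∈ (oneForms k V (PathAlg k Q.double)).map (DR.mk k V _) := by
  induction z using DirectSum.induction_on with
  | zero => simp
  | add z z' h h' => exact map_add (contrForm _) z z' ▸ Submodule.add_mem _ h h'
  | of n θ =>
    rw [← DirectSum.lof_eq_of k, contrForm_lof, contr_quiverForm]
    refine Submodule.mem_map_of_mem (f := DR.mk k V (PathAlg k Q.double))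
      (Submodule.sum_smul_mem _ _ fun b _ => ?_)
    simpa using Omega.sandwich_dA_mem_oneForms (k := k) (I := V) (arrow k Q.double b)
      (θ.1 (arrow k Q.double b.swap) ⊗ₜ[k] 1)

section Nondegenerate

variable [CharZero k]

theorem iota_coDer_contrForm_quiverForm [DecidableEq E] (z : SDer k V (PathAlg k Q.double))
    (b : E ⊕ E) :
    DR.iota (coDer k Q.double b) (contrForm (quiverForm k Q) z) = doubleSign k b •
      Omega.inA k V _ (twist k V _ (0 - Q.double.deg b)
        (DirectSum.coeLinearMap (sder k V _) z (arrow k Q.double b.swap))) := by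
  induction z using DirectSum.induction_on with
  | zero => simp
  | add z z' h h' => simp only [map_add, LinearMap.add_apply, smul_add, h, h']
  | of n θ =>
    rw [← DirectSum.lof_eq_of k, contrForm_lof, DirectSum.coeLinearMap_lof, contr_quiverForm,
      DR.iota_mk, map_sum, Finset.sum_eq_single b _ (by simp)]
    · rw [map_smul, iota_coDer_self, ← double_src_swap, ← double_tgt_swap, sder_arrow]
    · intro c _ hc
      rw [map_smul, iota_coDer_of_ne hc, smul_zero]

theorem contrForm_quiverForm_injective : Function.Injective (contrForm (quiverForm k Q)) := by
  classical
  intro z z' h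
  refine DFinsupp.ext fun n => sder_ext fun b => ?_
  refine component_apply_eq (S := sder k V (PathAlg k Q.double)) iSupIndep_deg
    (fun _ (θ : _ →ₗ[k] _) hθ => hθ.2.1 _ _ (arrow_mem_deg b)) ?_ n
  have hb := congrArg (DR.iota (coDer k Q.double b.swap)) h
  rw [iota_coDer_contrForm_quiverForm, iota_coDer_contrForm_quiverForm, Sum.swap_swap] at hb
  have htwist := Function.LeftInverse.injective (twist_twist (k := k) (I := V)
    (A := PathAlg k Q.double) (0 - Q.double.deg b.swap))
  exact htwist (Omega.inA_injective (doubleSign_smul_injective _ hb))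

theorem iota_quiverForm {n : ℤ} (μ : dder k V (PathAlg k Q.double) n) :
    DR.iota μ (quiverForm k Q) = ∑ b, doubleSign k b •
      sandwich (Omega.inA k V _) (Omega.inA k V _) (Omega.dA k V _ (arrow k Q.double b))
        (koszulSwap k V _ (Q.double.deg b) (μ.1 (arrow k Q.double b.swap))) := by
  rw [quiverForm, DR.iota_mk, map_sum, Fintype.sum_sum_type, ← Finset.sum_add_distrib]
  refine Finset.sum_congr rfl fun a _ => ?_
  rw [Omega.iota_dA_mul_dA μ (arrStar_mem_deg a) (arr_mem_deg a)]
  simp only [doubleSign, Sum.elim_inl, Sum.elim_inr, Pi.one_apply, Pi.neg_apply, neg_smul, mul_zero,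
    zpow_zero, one_smul]
  exact sub_eq_add_neg _ _

theorem coord_iotaForm_quiverForm [DecidableEq E] (z : DDer k V (PathAlg k Q.double)) (b : E ⊕ E) :
    coord b (iotaForm (quiverForm k Q) z) = doubleSign k b •
      koszulSwap k V _ (Q.double.deg b)
        (DirectSum.coeLinearMap (dder k V _) z (arrow k Q.double b.swap)) := by
  induction z using DirectSum.induction_on with
  | zero => simp
  | add z z' h h' => simp only [map_add, LinearMap.add_apply, smul_add, h, h']
  | of n μ =>
    rw [← DirectSum.lof_eq_of k, iotaForm_lof, DirectSum.coeLinearMap_lof, iota_quiverForm,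
      map_sum, Finset.sum_eq_single b _ (by simp)]
    · rw [map_smul, coord_sandwich_self, ← koszulSwap_mul_mul (vert_mem_deg _) (vert_mem_deg _),
        ← double_tgt_swap b, ← double_src_swap b, dder_arrow]
    · intro c _ hc
      rw [map_smul, coord_sandwich_of_ne hc, smul_zero]

theorem iotaForm_quiverForm_injective : Function.Injective (iotaForm (quiverForm k Q)) := by
  classical
  intro z z' h
  refine DFinsupp.ext fun n => dder_ext fun b => ?_
  refine component_apply_eq (S := dder k V (PathAlg k Q.double)) iSupIndep_degTen
    (fun _ (μ : _ →ₗ[k] _) hμ => hμ.2.1 _ _ (arrow_mem_deg b)) ?_ n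
  have hb := congrArg (coord b.swap) h
  rw [coord_iotaForm_quiverForm, coord_iotaForm_quiverForm, Sum.swap_swap] at hb
  exact koszulSwap_injective _ (doubleSign_smul_injective _ hb)

theorem iota_dderSingle_quiverForm [DecidableEq E] (b : E ⊕ E) {l : ℤ}
    {t : PathAlg k Q.double ⊗[k] PathAlg k Q.double} (ht : t ∈ degTen k V (PathAlg k Q.double) l) :
    DR.iota (dderSingle b.swap ht) (quiverForm k Q) =
      doubleSign k b • sandwich (Omega.inA k V _) (Omega.inA k V _)
        (Omega.dA k V _ (arrow k Q.double b)) (koszulSwap k V _ (Q.double.deg b) t) := by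
  rw [iota_quiverForm, Finset.sum_eq_single b _ (by simp)]
  · rw [dderSingle_arrow_self, koszulSwap_mul_mul (vert_mem_deg _) (vert_mem_deg _),
      double_src_swap, double_tgt_swap, sandwich_dA_arrow]
  · intro c _ hc
    rw [dderSingle_arrow_of_ne (Sum.swap_leftInverse.injective.ne hc)]
    simp

theorem iotaForm_quiverForm_mem (z : DDer k V (PathAlg k Q.double)) :
    iotaForm (quiverForm k Q) z ∈ oneForms k V (PathAlg k Q.double) := by
  induction z using DirectSum.induction_on with
  | zero => simp
  | add z z' h h' => exact map_add (iotaForm _) z z' ▸ Submodule.add_mem _ h h'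
  | of n μ =>
    rw [← DirectSum.lof_eq_of k, iotaForm_lof, iota_quiverForm]
    exact Submodule.sum_smul_mem _ _ fun b _ => Omega.sandwich_dA_mem_oneForms _ _

theorem isSymplectic_quiverForm : IsSymplectic (quiverForm k Q) := by
  classical
  refine ⟨fun z _ => contrForm_quiverForm_mem z, contrForm_quiverForm_injective.injOn, ?_⟩
  rw [Set.SurjOn, Set.image_univ, ← LinearMap.coe_range, SetLike.coe_subset_coe,
    Submodule.map_le_iff_le_comap]
  refine oneForms_le fun b i j p hp q hq => ?_
  have hcontr := contr_sderSingle_quiverForm b (mul_mem_deg hq hp)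
  rw [Submodule.mem_comap, DR.mk_mul_comm ((Omega.par_inA_of_mem hp).mul
    (Omega.par_dA_of_mem (arrow_mem_deg b))) (Omega.par_inA_of_mem hq), ← mul_assoc, ← map_mul,
    eq_doubleSign_smul hcontr, ← contrForm_lof]
  exact Submodule.smul_mem _ _ (Submodule.smul_mem _ _ (LinearMap.mem_range_self _ _))

theorem isBisymplectic_quiverForm : IsBisymplectic (quiverForm k Q) := by
  classical
  refine ⟨fun z _ => iotaForm_quiverForm_mem z, iotaForm_quiverForm_injective.injOn, ?_⟩
  rw [Set.SurjOn, Set.image_univ, ← LinearMap.coe_range, SetLike.coe_subset_coe]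
  refine oneForms_le fun b i j p hp q hq => ?_
  have hiota := iota_dderSingle_quiverForm b (tmul_mem_degTen hq hp)
  rw [koszulSwap_tmul _ hq hp, map_smul, sandwich_tmul] at hiota
  rw [← sign_smul_sign_smul (k := k) (j * (i + Q.double.deg b)) (_ * _), eq_doubleSign_smul hiota,
    ← iotaForm_lof]
  exact Submodule.smul_mem _ _ (Submodule.smul_mem _ _ (LinearMap.mem_range_self _ _))

end Nondegenerate

end QuiverForm

section Commutators

variable {k : Type u} [Field k] {V : Type v} {E : Type w} [Fintype V] {Q : GrQuiver V E}

namespace PathAlg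

theorem vert_mul_arrow_of_ne {a : E} {i : V} (h : i ≠ Q.tgt a) :
    vert k Q i * arrow k Q a = 0 := by
  rw [← tgt_mul, ← mul_assoc, vert_mul_of_ne k Q h, zero_mul]

theorem delta_apply [DecidableEq V] (x : PathAlg k Q) : (delta k V (PathAlg k Q)).1 x =
    ∑ i, ((x * vert k Q i) ⊗ₜ[k] vert k Q i - vert k Q i ⊗ₜ[k] (vert k Q i * x)) := by
  simp [delta, LinearMap.sum_apply, idem, str_single]

theorem delta_arrow [DecidableEq V] (a : E) : (delta k V (PathAlg k Q)).1 (arrow k Q a) =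
    arrow k Q a ⊗ₜ[k] vert k Q (Q.src a) - vert k Q (Q.tgt a) ⊗ₜ[k] arrow k Q a := by
  rw [delta_apply, Finset.sum_sub_distrib, Finset.sum_eq_single (Q.src a),
    Finset.sum_eq_single (Q.tgt a), mul_src, tgt_mul]
  · intro i _ hi
    rw [vert_mul_arrow_of_ne hi, TensorProduct.tmul_zero]
  · simp
  · intro i _ hi
    rw [arrow_mul_of_ne k Q (Ne.symm hi), TensorProduct.zero_tmul]
  · simp

theorem vert_mul_comm {x : PathAlg k Q} {j : V} (hl : vert k Q j * x = x)
    (hr : x * vert k Q j = x) (i : V) : vert k Q i * x = x * vert k Q i := by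
  by_cases h : i = j
  · rw [h, hl, hr]
  · rw [← hl, ← mul_assoc, vert_mul_of_ne k Q h, hl, ← hr, mul_assoc,
      vert_mul_of_ne k Q (Ne.symm h), zero_mul, mul_zero]

theorem mul_comm_sandwich (u v : PathAlg k Q) (t : PathAlg k Q ⊗[k] PathAlg k Q) :
    LinearMap.mul' k _ (TensorProduct.comm k _ _ (sandwich Algebra.TensorProduct.includeLeft
      Algebra.TensorProduct.includeRight (u ⊗ₜ[k] v) t)) =
        v * LinearMap.mul' k _ (TensorProduct.comm k _ _ t) * u := by
  induction t with
  | zero => simp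
  | add t t' h h' => simp only [map_add, mul_add, add_mul, h, h']
  | tmul p q => simp [mul_assoc]

variable [DecidableEq E]

theorem src_mul_cyclicDer (a : E) (x : PathAlg k Q) :
    vert k Q (Q.src a) * cyclicDer a x = cyclicDer a x := by
  rw [← cyclicDer_sandwich, ← mul_assoc, ← mul_assoc, vert_mul_self]

theorem cyclicDer_mul_tgt (a : E) (x : PathAlg k Q) :
    cyclicDer a x * vert k Q (Q.tgt a) = cyclicDer a x := by
  rw [← cyclicDer_sandwich, mul_assoc, vert_mul_self]

theorem sum_arrow_commutator_cyclicDer [Fintype E] (x : PathAlg k Q) :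
    ∑ a, (arrow k Q a * cyclicDer a x - cyclicDer a x * arrow k Q a) = 0 := by
  classical
  -- multiply out, in the opposite order, the expansion of the double derivation `δ`
  have hdelta : IsDerivationAlong Algebra.TensorProduct.includeLeft
      Algebra.TensorProduct.includeRight (delta k V (PathAlg k Q)).1 := by
    simpa only [twist_even Even.zero, AlgHom.comp_id] using
      isDerivationAlong_of_mem_dder (delta k V (PathAlg k Q)).2
  have hexpand := congrArg (LinearMap.mul' k _ ∘ₗ (TensorProduct.comm k _ _).toLinearMap)
    (derivation_eq_sum_sandwich_partialDer hdelta (apply_vert_eq_zero (delta k V _).2.1) x)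
  have hzero : LinearMap.mul' k _ (TensorProduct.comm k _ _ ((delta k V (PathAlg k Q)).1 x)) =
      0 := by
    simp [delta_apply, mul_assoc]
  have hterm (a : E) : LinearMap.mul' k _ (TensorProduct.comm k _ _
      (sandwich Algebra.TensorProduct.includeLeft Algebra.TensorProduct.includeRight
        ((delta k V (PathAlg k Q)).1 (arrow k Q a)) (partialDer a x))) =
      cyclicDer a x * arrow k Q a - arrow k Q a * cyclicDer a x := by
    have hcyc : LinearMap.mul' k _ (TensorProduct.comm k _ _ (partialDer a x)) =
      cyclicDer a x := rfl
    rw [delta_arrow, sandwich_sub, LinearMap.sub_apply, map_sub, map_sub, mul_comm_sandwich,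
      mul_comm_sandwich, hcyc, src_mul_cyclicDer, mul_assoc, cyclicDer_mul_tgt]
  simp only [LinearMap.comp_apply, LinearEquiv.coe_coe, map_sum, hzero, hterm] at hexpand
  rw [← neg_eq_zero, ← Finset.sum_neg_distrib, hexpand]
  simp only [neg_sub]

end PathAlg

end Commutators

section MomentMap

variable {V : Type v} {E : Type w} {k : Type u} [Field k] [Fintype V] {Q : FinQuiver V E}

open PathAlg

theorem koszulSwap_delta_arrow_swap [CharZero k] [DecidableEq V] (b : E ⊕ E) :
    koszulSwap k V _ (Q.double.deg b)
      ((delta k V (PathAlg k Q.double)).1 (arrow k Q.double b.swap)) =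
        vert k Q.double (Q.double.tgt b) ⊗ₜ[k] arrow k Q.double b.swap -
          arrow k Q.double b.swap ⊗ₜ[k] vert k Q.double (Q.double.src b) := by
  have hsign : Even (Q.double.deg b.swap * (0 + Q.double.deg b)) := by
    cases b <;> simp [FinQuiver.double]
  rw [delta_arrow, map_sub, koszulSwap_tmul _ (arrow_mem_deg _) (vert_mem_deg _),
    koszulSwap_tmul _ (vert_mem_deg _) (arrow_mem_deg _), hsign.neg_one_zpow, zero_mul, zpow_zero,
    one_smul, one_smul, double_src_swap, double_tgt_swap]

variable [Fintype E]

theorem quiverMoment_eq_sum_doubleSign : quiverMoment k Q =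
    ∑ b, doubleSign k b • (arrow k Q.double b * arrow k Q.double b.swap) := by
  rw [quiverMoment, Fintype.sum_sum_type, ← Finset.sum_add_distrib]
  exact Finset.sum_congr rfl fun a _ => by simp [doubleSign, arr, arrStar, sub_eq_add_neg]

theorem quiverMoment_mem_deg : quiverMoment k Q ∈ deg k V (PathAlg k Q.double) (-1) := by
  rw [quiverMoment_eq_sum_doubleSign]
  refine Submodule.sum_smul_mem _ _ fun b _ => ?_
  simpa [double_deg_swap] using
    mul_mem_deg (arrow_mem_deg (k := k) (Q := Q.double) b) (arrow_mem_deg b.swap)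

theorem vert_mul_quiverMoment (i : V) :
    vert k Q.double i * quiverMoment k Q = quiverMoment k Q * vert k Q.double i := by
  rw [quiverMoment_eq_sum_doubleSign, Finset.mul_sum, Finset.sum_mul]
  refine Finset.sum_congr rfl fun b _ => ?_
  rw [mul_smul_comm, smul_mul_assoc, vert_mul_comm (j := Q.double.tgt b)]
  · rw [← mul_assoc, tgt_mul]
  · rw [mul_assoc, ← double_src_swap, mul_src]

theorem str_mul_quiverMoment (r : V → k) :
    str k V _ r * quiverMoment k Q = quiverMoment k Q * str k V _ r := by
  simp only [str_apply, Finset.sum_mul, Finset.mul_sum, smul_mul_assoc, mul_smul_comm,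
    vert_mul_quiverMoment]

theorem dA_quiverMoment : Omega.dA k V _ (quiverMoment k Q) = ∑ b, doubleSign k b •
    (Omega.dA k V _ (arrow k Q.double b) * Omega.inA k V _ (arrow k Q.double b.swap) -
      Omega.inA k V _ (arrow k Q.double b.swap) * Omega.dA k V _ (arrow k Q.double b)) := by
  have hswap : ∑ b : E ⊕ E, doubleSign k b • (Omega.inA k V _ (arrow k Q.double b) *
      Omega.dA k V _ (arrow k Q.double b.swap)) = -∑ b, doubleSign k b •
        (Omega.inA k V _ (arrow k Q.double b.swap) * Omega.dA k V _ (arrow k Q.double b)) := by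
    rw [← (Equiv.sumComm E E).sum_comp, ← Finset.sum_neg_distrib]
    simp [doubleSign_swap]
  simp only [quiverMoment_eq_sum_doubleSign, map_sum, map_smul, Omega.dA_mul, smul_add, smul_sub,
    Finset.sum_add_distrib, Finset.sum_sub_distrib, hswap, ← sub_eq_add_neg]

variable [CharZero k]

theorem iota_delta_quiverForm [DecidableEq V] :
    DR.iota (delta k V (PathAlg k Q.double)) (quiverForm k Q) =
      Omega.dA k V _ (quiverMoment k Q) := by
  rw [iota_quiverForm, dA_quiverMoment]
  refine Finset.sum_congr rfl fun b _ => ?_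
  rw [koszulSwap_delta_arrow_swap, map_sub, sandwich_tmul, sandwich_tmul, tgt_mul_dA_arrow,
    mul_assoc, dA_arrow_mul_src]

theorem representsMoment_quiverMoment [DecidableEq V] :
    RepresentsMoment (quiverForm k Q) (quiverMoment k Q) := by
  refine ⟨fun r => ?_, fun a => ?_⟩
  · rw [str_mul_quiverMoment, sub_self]
    exact zero_mem _
  · rw [iota_delta_quiverForm, ← dA_eq_zero_iff, map_sub, sub_eq_zero]

end MomentMap

section Hamiltonian

variable {V : Type v} {E : Type w} {k : Type u} [Field k] [Fintype V] {Q : FinQuiver V E}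

open PathAlg

theorem toDouble_vert (i : V) : toDouble k Q (vert k Q.plain i) = vert k Q.double i :=
  map_vert _ _ _ i

theorem toDouble_arrow (a : E) : toDouble k Q (arrow k Q.plain a) = arr k Q a := by
  simp [toDouble, PathAlg.map, arr]

theorem toDouble_mem_deg (x : PathAlg k Q.plain) :
    toDouble k Q x ∈ deg k V (PathAlg k Q.double) 0 := by
  induction x using PathAlg.induction with
  | hv i => exact toDouble_vert (k := k) (Q := Q) i ▸ vert_mem_deg i
  | ha a => exact toDouble_arrow (k := k) (Q := Q) a ▸ arr_mem_deg a
  | hs c => exact AlgHom.commutes (toDouble k Q) c ▸ SetLike.algebraMap_mem_graded _ c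
  | add x y hx hy => exact map_add (toDouble k Q) x y ▸ add_mem hx hy
  | mul x y hx hy => simpa using mul_mem_deg hx hy

theorem mk_sandwich_toDouble (a : E) (t : PathAlg k Q.plain ⊗[k] PathAlg k Q.plain) :
    DR.mk k V _ (sandwich ((Omega.inA k V _).comp (toDouble k Q))
      ((Omega.inA k V _).comp (toDouble k Q)) (Omega.dA k V _ (arr k Q a)) t) =
    DR.mk k V _ (Omega.inA k V _ (toDouble k Q
      (LinearMap.mul' k _ (TensorProduct.comm k _ _ t))) * Omega.dA k V _ (arr k Q a)) := by
  induction t with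
  | zero => simp
  | add t t' h h' => simp only [add_mul, map_add, h, h']
  | tmul p q =>
    have hcomm := DR.mk_mul_comm ((Omega.par_inA_of_mem (toDouble_mem_deg p)).mul
      (Omega.par_dA_of_mem (arr_mem_deg a))) (Omega.par_inA_of_mem (toDouble_mem_deg q))
    simpa [mul_assoc] using hcomm

theorem span_omega1Deg_quiver : Submodule.span (Env k (PathAlg k Q.double))
    {η : Omega1 k V (PathAlg k Q.double) | ∃ n, -1 ≤ n ∧ n ≤ 0 ∧ η ∈ omega1Deg k V _ n} = ⊤ := by
  rw [eq_top_iff, ← span_dOne_arrow]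
  refine Submodule.span_mono ?_
  rintro _ ⟨b, rfl⟩
  refine ⟨Q.double.deg b, ?_, ?_, dOne_mem_omega1Deg (arrow_mem_deg b)⟩ <;>
  cases b <;> simp [FinQuiver.double]

variable [DecidableEq E]

/-- The Hamiltonian vector field `{W, -}_ω`, as the super-derivation with `a ↦ 0` and
`a* ↦ ∂W/∂a`. -/
def hamiltonian (W : Potential k Q) : sder k V (PathAlg k Q.double) 1 :=
  sderOf 1 (Sum.elim 0 fun a => toDouble k Q (W.deriv a)) <| by
    rintro (a | a)
    · exact zero_mem _
    · exact toDouble_mem_deg _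

theorem hamiltonian_arr (W : Potential k Q) (a : E) : (hamiltonian W).1 (arr k Q a) = 0 :=
  (sderOf_arrow _ _ _ _).trans (by simp)

theorem hamiltonian_arrStar (W : Potential k Q) (a : E) :
    (hamiltonian W).1 (arrStar k Q a) = toDouble k Q (W.deriv a) := by
  obtain ⟨x, rfl⟩ := Submodule.mkQ_surjective _ W
  refine (sderOf_arrow _ _ _ _).trans ?_
  have hcyclic := congrArg (toDouble k Q) (cyclicDer_sandwich (Q := Q.plain) a x)
  rwa [map_mul, map_mul, toDouble_vert, toDouble_vert] at hcyclic

theorem hamiltonian_toDouble (W : Potential k Q) (x : PathAlg k Q.plain) :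
    (hamiltonian W).1 (toDouble k Q x) = 0 := by
  induction x using PathAlg.induction with
  | hv i => rw [toDouble_vert, apply_vert_eq_zero (hamiltonian W).2.1]
  | ha a => rw [toDouble_arrow, hamiltonian_arr]
  | hs c =>
    rw [AlgHom.commutes, (isDerivationAlong_of_mem_sder (hamiltonian W).2).map_algebraMap]
  | add x y hx hy => rw [map_add, map_add, hx, hy, add_zero]
  | mul x y hx hy => rw [map_mul, sder_mul (hamiltonian W).2, hx, hy, zero_mul, mul_zero, add_zero]

theorem hamiltonian_hamiltonian (W : Potential k Q) (x : PathAlg k Q.double) :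
    (hamiltonian W).1 ((hamiltonian W).1 x) = 0 := by
  refine sder_sq_eq_zero _ (fun b => ?_) x
  rcases b with a | a
  · exact (congrArg _ (hamiltonian_arr W a)).trans (map_zero _)
  · exact (congrArg _ (hamiltonian_arrStar W a)).trans (hamiltonian_toDouble W _)

variable [Fintype E]

theorem mk_dA_toDouble (x : PathAlg k Q.plain) : DR.mk k V _ (Omega.dA k V _ (toDouble k Q x)) =
    DR.mk k V _ (∑ a, Omega.inA k V _ (toDouble k Q (cyclicDer a x)) *
      Omega.dA k V _ (arr k Q a)) := by
  have hexpand := derivation_eq_sum_sandwich_partialDer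
    (Omega.isDerivationAlong_dA.comp_algHom (toDouble k Q))
    (fun i => (congrArg _ (toDouble_vert i)).trans (dA_vert i)) x
  simp only [LinearMap.comp_apply, AlgHom.toLinearMap_apply, toDouble_arrow] at hexpand
  rw [hexpand, map_sum, map_sum]
  exact Finset.sum_congr rfl fun a _ => mk_sandwich_toDouble a _

theorem contr_hamiltonian (x : PathAlg k Q.plain) :
    DR.contr (hamiltonian (Potential.mk k Q x)) (quiverForm k Q) =
      DR.D k V _ (DR.mk k V _ (Omega.inA k V _ (toDouble k Q x))) := by
  rw [contr_quiverForm, DR.D_mk, Omega.D_inA, mk_dA_toDouble, Fintype.sum_sum_type]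
  congr 1
  have hstar (a : E) := hamiltonian_arrStar (Potential.mk k Q x) a
  have harr (a : E) := hamiltonian_arr (Potential.mk k Q x) a
  simp only [arr, arrStar] at harr hstar
  simp only [doubleSign, Sum.swap_inl, Sum.swap_inr, Sum.elim_inl, Sum.elim_inr, harr, hstar,
    map_zero, zero_mul, smul_zero, Finset.sum_const_zero, add_zero, one_smul, Pi.one_apply]
  rfl

theorem lie_hamiltonian (W : Potential k Q) : DR.lie (hamiltonian W) (quiverForm k Q) = 0 := by
  obtain ⟨x, rfl⟩ := Submodule.mkQ_surjective _ W
  have hD := congrArg (DR.D k V (PathAlg k Q.double)) (mk_dA_toDouble x)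
  rw [DR.D_mk, DR.D_mk, Omega.D_dA, map_zero, map_sum] at hD
  rw [quiverForm, DR.lie_mk, map_sum, hD]
  congr 1
  refine Finset.sum_congr rfl fun a _ => ?_
  rw [Omega.lie_mul _ (Omega.par_dA_of_mem (arrStar_mem_deg a)), Omega.lie_dA, Omega.lie_dA,
    hamiltonian_arr, hamiltonian_arrStar, Omega.D_mul (Omega.par_inA_of_mem (toDouble_mem_deg _)),
    Omega.D_inA, Omega.D_dA, map_zero, mul_zero, smul_zero, mul_zero, smul_zero]
  rfl

theorem hamiltonian_quiverMoment (W : Potential k Q) :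
    (hamiltonian W).1 (quiverMoment k Q) = 0 := by
  obtain ⟨x, rfl⟩ := Submodule.mkQ_surjective _ W
  have hcomm := congrArg (toDouble k Q) (sum_arrow_commutator_cyclicDer (Q := Q.plain) x)
  rw [map_zero, map_sum] at hcomm
  rw [quiverMoment, map_sum, ← hcomm]
  refine Finset.sum_congr rfl fun a _ => ?_
  rw [map_sub, sder_mul (hamiltonian _).2, sder_mul (hamiltonian _).2, hamiltonian_arr,
    hamiltonian_arrStar, twist_of_mem 1 (arr_mem_deg a), map_sub, map_mul, map_mul, toDouble_arrow,
    mul_zero, zpow_zero, one_smul, zero_mul, zero_add, mul_zero, add_zero]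
  rfl

theorem isGinzburgTriple_hamiltonian [CharZero k] [DecidableEq V] (W : Potential k Q) :
    IsGinzburgTriple (-1) (quiverForm k Q) (hamiltonian W) (quiverMoment k Q) where
  nonpos _ := deg_eq_bot <| by rintro (_ | _) <;> simp [FinQuiver.double]
  finiteType := finiteType
  projective := omega1_projective
  generated := span_omega1Deg_quiver
  closed := isClosedTwoForm_quiverForm
  bisymplectic := isBisymplectic_quiverForm
  sq_zero := hamiltonian_hamiltonian W
  lie_zero := lie_hamiltonian W
  moment := representsMoment_quiverMoment
  moment_deg := quiverMoment_mem_deg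
  moment_zero := hamiltonian_quiverMoment W

end Hamiltonian

/-! ### The differential of the Ginzburg algebra -/

section Hat

variable {V : Type v} {E : Type w} {k : Type u} [Field k] [Fintype V] {Q : FinQuiver V E}

open PathAlg

variable (k Q) in
/-- The inclusion of the path algebra of the double quiver into that of `Q.hat`. -/
def doubleToHat : PathAlg k Q.double →ₐ[k] PathAlg k Q.hat :=
  PathAlg.map Sum.inl (fun _ => rfl) (fun _ => rfl)

theorem doubleToHat_vert (i : V) : doubleToHat k Q (vert k Q.double i) = vert k Q.hat i :=
  map_vert _ _ _ i

theorem doubleToHat_arrow (b : E ⊕ E) :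
    doubleToHat k Q (arrow k Q.double b) = arrow k Q.hat (Sum.inl b) := by
  simp [doubleToHat, PathAlg.map]

theorem doubleToHat_arr (a : E) : doubleToHat k Q (arr k Q a) = hatArr k Q a :=
  doubleToHat_arrow _

theorem doubleToHat_arrStar (a : E) : doubleToHat k Q (arrStar k Q a) = hatStar k Q a :=
  doubleToHat_arrow _

theorem doubleToHat_str (r : V → k) : doubleToHat k Q (str k V _ r) = str k V _ r := by
  simp [str_apply, doubleToHat_vert]

theorem doubleToHat_toDouble (x : PathAlg k Q.plain) :
    doubleToHat k Q (toDouble k Q x) = toHat k Q x := by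
  suffices (doubleToHat k Q).comp (toDouble k Q) = toHat k Q from DFunLike.congr_fun this x
  refine PathAlg.hom_ext (fun i => ?_) (fun a => ?_)
  · rw [AlgHom.comp_apply, toDouble_vert, doubleToHat_vert]
    exact (map_vert _ _ _ i).symm
  · rw [AlgHom.comp_apply, toDouble_arrow, doubleToHat_arr]
    simp [toHat, PathAlg.map, hatArr]

theorem doubleToHat_mem_deg (n : ℤ) : ∀ x ∈ deg k V (PathAlg k Q.double) n,
    doubleToHat k Q x ∈ deg k V (PathAlg k Q.hat) n :=
  PathAlg.deg_le (S := fun n => (deg k V (PathAlg k Q.hat) n).comap (doubleToHat k Q).toLinearMap)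
    (fun i => by simpa [doubleToHat_vert] using vert_mem_deg i)
    (fun b => by
      rw [Submodule.mem_comap, AlgHom.toLinearMap_apply, doubleToHat_arrow]
      exact arrow_mem_deg (Q := Q.hat) (Sum.inl b))
    (fun m n x y hx hy => by simpa using mul_mem_deg hx hy) n

theorem hatLoop_mem_deg (i : V) : hatLoop k Q i ∈ deg k V (PathAlg k Q.hat) (-2) :=
  arrow_mem_deg (Q := Q.hat) (Sum.inr i)

theorem vert_mul_sum_hatLoop (i : V) : vert k Q.hat i * ∑ j, hatLoop k Q j = hatLoop k Q i := by
  rw [Finset.mul_sum]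
  exact (Finset.sum_eq_single_of_mem i (Finset.mem_univ i) fun j _ hj =>
    vert_mul_arrow_of_ne (Q := Q.hat) (a := Sum.inr j) hj.symm).trans (tgt_mul k Q.hat (Sum.inr i))

theorem sum_hatLoop_mul_vert (i : V) : (∑ j, hatLoop k Q j) * vert k Q.hat i = hatLoop k Q i := by
  rw [Finset.sum_mul]
  exact (Finset.sum_eq_single_of_mem i (Finset.mem_univ i) fun j _ hj =>
    arrow_mul_of_ne k Q.hat (a := Sum.inr j) hj).trans (mul_src k Q.hat (Sum.inr i))

theorem commute_str_sum_hatLoop (r : V → k) :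
    Commute (str k V (PathAlg k Q.hat) r) (∑ j, hatLoop k Q j) := by
  rw [str_apply]
  refine Commute.sum_left _ _ _ fun i _ => Commute.smul_left ?_ _
  exact (vert_mul_sum_hatLoop i).trans (sum_hatLoop_mul_vert i).symm

variable (k Q) in
/-- The homomorphism `t ↦ ∑ t_i` from the free product to the path algebra of `Q.hat`. -/
def freeProdToHat : FreeProd k V (PathAlg k Q.double) →ₐ[k] PathAlg k Q.hat :=
  FreeProd.lift (doubleToHat k Q) (∑ i, hatLoop k Q i) fun r =>
    (doubleToHat_str (Q := Q) r).symm ▸ commute_str_sum_hatLoop r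

theorem freeProdToHat_inlHom (x : PathAlg k Q.double) :
    freeProdToHat k Q (FreeProd.inlHom k V _ x) = doubleToHat k Q x :=
  FreeProd.lift_inlHom _ _ _ x

theorem freeProdToHat_t : freeProdToHat k Q (FreeProd.t k V _) = ∑ i, hatLoop k Q i :=
  FreeProd.lift_t _ _ _

theorem inlHom_vert_mul_t (i : V) :
    FreeProd.inlHom k V _ (vert k Q.double i) * FreeProd.t k V _ =
      FreeProd.t k V _ * FreeProd.inlHom k V _ (vert k Q.double i) := by
  obtain ⟨r, hr⟩ := vert_mem_range_str (k := k) (Q := Q.double) i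
  exact hr ▸ FreeProd.inlHom_str_mul_t r

variable (k Q) in
/-- The homomorphism `t_i ↦ e_i t` from the path algebra of `Q.hat` to the free product. -/
def hatToFreeProd : PathAlg k Q.hat →ₐ[k] FreeProd k V (PathAlg k Q.double) :=
  PathAlg.lift (fun i => FreeProd.inlHom k V _ (vert k Q.double i))
    (Sum.elim (fun b => FreeProd.inlHom k V _ (arrow k Q.double b))
      fun i => FreeProd.inlHom k V _ (vert k Q.double i) * FreeProd.t k V _)
    (by rw [← map_sum, sum_vert, map_one])
    (fun i => by rw [← map_mul, vert_mul_self])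
    (fun i j h => by rw [← map_mul, vert_mul_of_ne k _ h, map_zero])
    (by
      rintro (b | i)
      · exact (map_mul _ _ _).symm.trans (congrArg _ (tgt_mul k Q.double b))
      · change FreeProd.inlHom k V _ (vert k Q.double i) *
          (FreeProd.inlHom k V _ (vert k Q.double i) * _) = _
        rw [← mul_assoc, ← map_mul, vert_mul_self]
        rfl)
    (by
      rintro (b | i)
      · exact (map_mul _ _ _).symm.trans (congrArg _ (mul_src k Q.double b))
      · change FreeProd.inlHom k V _ (vert k Q.double i) * _ *
          FreeProd.inlHom k V _ (vert k Q.double i) = _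
        rw [mul_assoc, ← inlHom_vert_mul_t, ← mul_assoc, ← map_mul, vert_mul_self]
        rfl)

theorem hatToFreeProd_vert (i : V) :
    hatToFreeProd k Q (vert k Q.hat i) = FreeProd.inlHom k V _ (vert k Q.double i) :=
  PathAlg.lift_vert _ _ _ _ _ _ _ i

theorem hatToFreeProd_arrow (b : E ⊕ E) : hatToFreeProd k Q (arrow k Q.hat (Sum.inl b)) =
    FreeProd.inlHom k V _ (arrow k Q.double b) :=
  PathAlg.lift_arrow _ _ _ _ _ _ _ (Sum.inl b)

theorem hatToFreeProd_hatLoop (i : V) : hatToFreeProd k Q (hatLoop k Q i) =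
    FreeProd.inlHom k V _ (vert k Q.double i) * FreeProd.t k V _ :=
  PathAlg.lift_arrow _ _ _ _ _ _ _ (Sum.inr i)

theorem hatToFreeProd_sum_hatLoop :
    hatToFreeProd k Q (∑ i, hatLoop k Q i) = FreeProd.t k V _ := by
  simp only [map_sum, hatToFreeProd_hatLoop]
  rw [← Finset.sum_mul, ← map_sum, sum_vert, map_one, one_mul]

theorem hatToFreeProd_doubleToHat (x : PathAlg k Q.double) :
    hatToFreeProd k Q (doubleToHat k Q x) = FreeProd.inlHom k V _ x := by
  suffices (hatToFreeProd k Q).comp (doubleToHat k Q) = FreeProd.inlHom k V _ from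
    DFunLike.congr_fun this x
  exact PathAlg.hom_ext
    (fun i => by rw [AlgHom.comp_apply, doubleToHat_vert, hatToFreeProd_vert])
    (fun b => by rw [AlgHom.comp_apply, doubleToHat_arrow, hatToFreeProd_arrow])

theorem freeProdToHat_hatToFreeProd_hatLoop (i : V) :
    freeProdToHat k Q (hatToFreeProd k Q (hatLoop k Q i)) = hatLoop k Q i := by
  rw [hatToFreeProd_hatLoop, map_mul, freeProdToHat_inlHom, doubleToHat_vert, freeProdToHat_t,
    vert_mul_sum_hatLoop]

variable (k Q) in
/-- The isomorphism between the free product `kQ.double *_R R[t]` and the path algebra of `Q.hat`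
that identifies the arrows and sends `t` to `∑ t_i`. -/
def freeProdEquivHat : FreeProd k V (PathAlg k Q.double) ≃ₐ[k] PathAlg k Q.hat :=
  AlgEquiv.ofAlgHom (freeProdToHat k Q) (hatToFreeProd k Q)
    (PathAlg.hom_ext
      (fun i => by
        rw [AlgHom.comp_apply, hatToFreeProd_vert, freeProdToHat_inlHom, doubleToHat_vert]
        rfl)
      (by
        rintro (b | i)
        · rw [AlgHom.comp_apply, hatToFreeProd_arrow, freeProdToHat_inlHom, doubleToHat_arrow]
          rfl
        · exact freeProdToHat_hatToFreeProd_hatLoop i))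
    (FreeProd.hom_ext
      (fun x => by
        rw [AlgHom.comp_apply, freeProdToHat_inlHom, hatToFreeProd_doubleToHat]
        rfl)
      (by
        rw [AlgHom.comp_apply, freeProdToHat_t, hatToFreeProd_sum_hatLoop]
        rfl))

theorem freeProdEquivHat_inl (x : PathAlg k Q.double) :
    freeProdEquivHat k Q (FreeProd.inl k V _ x) = doubleToHat k Q x :=
  freeProdToHat_inlHom x

theorem freeProdEquivHat_t : freeProdEquivHat k Q (FreeProd.t k V _) = ∑ i, hatLoop k Q i :=
  freeProdToHat_t

theorem hatToFreeProd_mem_degree (n : ℤ) : ∀ x ∈ deg k V (PathAlg k Q.hat) n,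
    hatToFreeProd k Q x ∈ FreeProd.degree k V (PathAlg k Q.double) (-2) n := by
  refine PathAlg.deg_le (S := fun n =>
    (FreeProd.degree k V (PathAlg k Q.double) (-2) n).comap (hatToFreeProd k Q).toLinearMap)
    (fun i => ?_) ?_ (fun m n x y hx hy => by simpa using FreeProd.mul_mem_degree hx hy) n
  · simpa [hatToFreeProd_vert] using FreeProd.inlHom_mem_degree (-2) (vert_mem_deg i)
  · rintro (b | i)
    · rw [Submodule.mem_comap, AlgHom.toLinearMap_apply, hatToFreeProd_arrow]
      exact FreeProd.inlHom_mem_degree (-2) (arrow_mem_deg (Q := Q.double) b)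
    · have hloop := FreeProd.mul_mem_degree (FreeProd.inlHom_mem_degree (-2)
        (vert_mem_deg (k := k) (Q := Q.double) i)) (FreeProd.t_mem_degree (-2))
      rwa [zero_add, ← hatToFreeProd_hatLoop] at hloop

theorem freeProdToHat_mem_deg (n : ℤ) : ∀ x ∈ FreeProd.degree k V (PathAlg k Q.double) (-2) n,
    freeProdToHat k Q x ∈ deg k V (PathAlg k Q.hat) n := by
  refine FreeProd.degree_le (S := fun n =>
    (deg k V (PathAlg k Q.hat) n).comap (freeProdToHat k Q).toLinearMap)
    (fun m x hx => ?_) ?_ (fun m n x y hx hy => by simpa using mul_mem_deg hx hy) n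
  · simpa [freeProdToHat_inlHom] using doubleToHat_mem_deg m x hx
  · rw [Submodule.mem_comap, AlgHom.toLinearMap_apply, freeProdToHat_t]
    exact sum_mem fun i _ => hatLoop_mem_deg i

theorem map_degree_freeProdEquivHat (n : ℤ) :
    (FreeProd.degree k V (PathAlg k Q.double) (-2) n).map (freeProdEquivHat k Q).toLinearMap =
      deg k V (PathAlg k Q.hat) n :=
  le_antisymm (Submodule.map_le_iff_le_comap.2 (freeProdToHat_mem_deg n)) fun x hx =>
    ⟨_, hatToFreeProd_mem_degree n x hx, (freeProdEquivHat k Q).apply_symm_apply x⟩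

section Differential

variable [Fintype E]

theorem doubleToHat_quiverMoment : doubleToHat k Q (quiverMoment k Q) =
    ∑ a, (hatArr k Q a * hatStar k Q a - hatStar k Q a * hatArr k Q a) := by
  simp only [quiverMoment, map_sum, map_sub, map_mul, doubleToHat_arr, doubleToHat_arrStar]

variable [DecidableEq E] (W : Potential k Q)

theorem gammaD_mem_sder : gammaD W ∈ sder k V (PathAlg k Q.hat) 1 := by
  refine (sderOf (Q := Q.hat) 1 (Sum.elim (Sum.elim 0 fun a => toHat k Q (W.deriv a))
    fun _ => ∑ a, (hatArr k Q a * hatStar k Q a - hatStar k Q a * hatArr k Q a)) ?_).2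
  rintro ((_ | a) | _)
  · exact zero_mem _
  · have hderiv := doubleToHat_mem_deg 0 _ (toDouble_mem_deg (W.deriv a))
    rwa [doubleToHat_toDouble] at hderiv
  · have hmoment := doubleToHat_mem_deg (k := k) (Q := Q) (-1) _ quiverMoment_mem_deg
    rwa [doubleToHat_quiverMoment] at hmoment

theorem gammaD_doubleToHat (x : PathAlg k Q.double) :
    gammaD W (doubleToHat k Q x) = doubleToHat k Q ((hamiltonian W).1 x) := by
  have hgamma := (isDerivationAlong_of_mem_sder (gammaD_mem_sder W)).comp_algHom (doubleToHat k Q)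
  have hham := (isDerivationAlong_of_mem_sder (hamiltonian W).2).algHom_comp (doubleToHat k Q)
  rw [show (doubleToHat k Q).comp (twist k V _ 1) = (twist k V _ 1).comp (doubleToHat k Q) from
    AlgHom.ext (map_twist _ doubleToHat_mem_deg 1)] at hham
  refine DFunLike.congr_fun (derivation_ext hgamma hham (fun i => ?_) (fun b => ?_)) x
  · simp only [LinearMap.comp_apply, AlgHom.toLinearMap_apply, doubleToHat_vert,
      apply_vert_eq_zero (hamiltonian W).2.1, apply_vert_eq_zero (gammaD_mem_sder W).1, map_zero]
  · simp only [LinearMap.comp_apply, AlgHom.toLinearMap_apply, doubleToHat_arrow]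
    rcases b with a | a
    · exact (gammaD_arr W a).trans
        ((congrArg _ (hamiltonian_arr W a)).trans (map_zero _)).symm
    · exact (gammaD_star W a).trans
        ((congrArg _ (hamiltonian_arrStar W a)).trans (doubleToHat_toDouble _)).symm

theorem gammaD_hatLoop (i : V) : gammaD W (hatLoop k Q i) =
    doubleToHat k Q (vert k Q.double i * quiverMoment k Q) := by
  rw [gammaD_loop, ← doubleToHat_quiverMoment, ← doubleToHat_vert, ← map_mul, ← map_mul, mul_assoc,
    ← vert_mul_quiverMoment, ← mul_assoc, vert_mul_self]

theorem gammaD_gammaD (x : PathAlg k Q.hat) : gammaD W (gammaD W x) = 0 := by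
  refine sder_sq_eq_zero ⟨gammaD W, gammaD_mem_sder W⟩ ?_ x
  rintro (b | i)
  · change gammaD W (gammaD W (arrow k Q.hat (Sum.inl b))) = 0
    rw [← doubleToHat_arrow, gammaD_doubleToHat, gammaD_doubleToHat, hamiltonian_hamiltonian,
      map_zero]
  · change gammaD W (gammaD W (hatLoop k Q i)) = 0
    rw [gammaD_hatLoop, gammaD_doubleToHat, sder_mul (hamiltonian W).2, hamiltonian_quiverMoment,
      apply_vert_eq_zero (hamiltonian W).2.1, zero_mul, mul_zero, add_zero, map_zero]

theorem isGinzburgIso_freeProdEquivHat :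
    IsGinzburgIso (-1) (hamiltonian W) (quiverMoment k Q) (gammaD W) (freeProdEquivHat k Q) where
  map_str r := (freeProdEquivHat_inl _).trans (doubleToHat_str r)
  map_degree := map_degree_freeProdEquivHat
  superder := gammaD_mem_sder W
  sq_zero := gammaD_gammaD W
  d_inl x := by rw [freeProdEquivHat_inl, freeProdEquivHat_inl, gammaD_doubleToHat]
  d_t := by
    simp only [freeProdEquivHat_t, freeProdEquivHat_inl, map_sum, gammaD_hatLoop]
    rw [← map_sum, ← Finset.sum_mul, sum_vert, one_mul]

end Differential

end Hat

end NCForms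

end

open NCForms in
theorem mainTheorem7 {k V E : Type*} [Field k] [CharZero k] [Fintype V] [DecidableEq V] [Fintype E]
    [DecidableEq E] (Q : FinQuiver V E) (W : Potential k Q) :
    ∃ ξ : sder k V (PathAlg k Q.double) 1,
      IsGinzburgTriple (-1) (quiverForm k Q) ξ (quiverMoment k Q) ∧
      IsSymplectic (quiverForm k Q) ∧
      (∀ W₀ : PathAlg k Q.plain, Potential.mk k Q W₀ = W →
        contrForm (quiverForm k Q) (DirectSum.lof k ℤ _ 1 ξ) =
          DR.D k V _ (DR.mk k V _ (Omega.inA k V _ (toDouble k Q W₀)))) ∧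
      (∀ a : E, ξ.1 (arr k Q a) = 0 ∧ ξ.1 (arrStar k Q a) = toDouble k Q (W.deriv a)) ∧
      ∃ φ : FreeProd k V (PathAlg k Q.double) ≃ₐ[k] PathAlg k Q.hat,
        IsGinzburgIso (-1) ξ (quiverMoment k Q) (gammaD W) φ ∧
        (∀ a : E, φ (FreeProd.inl k V _ (arr k Q a)) = hatArr k Q a ∧
          φ (FreeProd.inl k V _ (arrStar k Q a)) = hatStar k Q a) ∧
        φ (FreeProd.t k V _) = ∑ i, hatLoop k Q i := by
  refine ⟨hamiltonian W, isGinzburgTriple_hamiltonian W, isSymplectic_quiverForm, ?_,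
    fun a => ⟨hamiltonian_arr W a, hamiltonian_arrStar W a⟩, freeProdEquivHat k Q,
    isGinzburgIso_freeProdEquivHat W, fun a => ⟨?_, ?_⟩, freeProdEquivHat_t⟩
  · rintro W₀ rfl
    rw [contrForm_lof, contr_hamiltonian]
  · rw [freeProdEquivHat_inl, doubleToHat_arr]
  · rw [freeProdEquivHat_inl, doubleToHat_arrStar]
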